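/- Fix an integer $n\ge 0$, write $\mathrm{U}(1)=\mathbb{R}/\mathbb{Z}$ additively, $\mathbb{T}^n=\mathrm{U}(1)^n$, and write $xy=\sum_i x_iy_i$ for the standard pairing. **The presheaf $\mathcal{B}\mathbb{TD}$.** For a smooth manifold $X$, the bicategory $\mathcal{B}\mathbb{TD}(X)$ has one object. Its 1-morphisms are pairs $(a,\hat a)$ of smooth maps $X\to\mathbb{R}^n$, composed by pointwise addition. Its 2-morphisms $(a,\hat a)\Rightarrow(a+m,\hat a+\hat m)$ are triples $(t,m,\hat m)$ of a smooth map $t:X\to\mathrm{U}(1)$ and locally constant maps $m,\hat m:X\to\mathbb{Z}^n$, composed vertically by addition; the horizontal composition of $(t_1,m_1,\hat m_1):(a_1,\hat a_1)\Rightarrow\cdots$ followed by $(t_2,m_2,\hat m_2):(a_2,\hat a_2)\Rightarrow\cdots$ is $(t_2+t_1-m_1\hat a_2,\;m_1+m_2,\;\hat m_1+\hat m_2)$. **The presheaf $\mathcal{T}$.** Let $\mathcal{P}_n$ be the $n$-fold Poincaré bundle, the principal $\mathrm{U}(1)$-bundle over $\mathbb{T}^n\times\mathbb{T}^n$ obtained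 as the quotient of $\mathbb{R}^n\times\mathbb{R}^n\times\mathrm{U}(1)$ by $(a,\hat a,t)\sim(a+m,\hat a+\hat m,t+\hat m a)$ for $m,\hat m\in\mathbb{Z}^n$. Over $X$ consider the correspondence $\mathcal{T}_X=((X\times\mathbb{T}^n,\mathcal{I}),(X\times\mathbb{T}^n,\mathcal{I}),\mathrm{id}_{\mathcal I}\otimes\mathrm{pr}^*\mathcal{P}_n)$ of trivial torus bundles with trivial bundle gerbes $\mathcal I$. For smooth $a,\hat a:X\to\mathbb{R}^n$ it has the automorphism $\mathcal{A}_{a,\hat a}=((f_a,\mathrm{id}),(f_{\hat a},\mathrm{id}),\zeta_{a,\hat a})$, where $f_a(x,c)=(x,c+[a(x)])$ and $\zeta_{a,\hat a}$ is, over $x \in X$, the bundle isomorphism $[a',\hat a',t]\mapsto[a'+a(x),\hat a'+\hat a(x),t+\hat a'a(x)+a(x)\hat a(x)]$ of $\mathcal{P}_n$ covering $f_a\times f_{\hat a}$. The bicategory $\mathcal{T}(X)$ has the single object $\mathcal{T}_X$; its 1-morphisms $((f,\mathrm{id}),(\hat f,\mathrm{id}),\zeta)$ are all finite compositions of the $\mathcal{A}_{a,\hat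 a}$ and their inverses; a 2-morphism $((f,\mathrm{id}),(\hat f,\mathrm{id}),\zeta)\Rightarrow((f',\mathrm{id}),(\hat f',\mathrm{id}),\zeta')$ exists only if $f=f'$ and $\hat f=\hat f'$, and is a pair of smooth maps $\alpha,\beta:X\times\mathbb{T}^n\to\mathrm{U}(1)$ (automorphisms of the identities of the trivial gerbes) with $\mathrm{pr}_1^*\alpha\cdot\zeta=\zeta'\cdot\mathrm{pr}_2^*\beta$. **The 2-functor $C:\mathcal{B}\mathbb{TD}\to\mathcal{T}$.** It sends $(a,\hat a)$ to $\mathcal{A}_{a,\hat a}$ and the 2-morphism $(t,m,\hat m)$ with source $(a,\hat a)$ to $(\alpha,\beta)$ with $\alpha(x,c)=-t(x)-\hat m(x)c$ and $\beta(x,c)=-t(x)-m(x)(c+\hat a(x))$; its compositor $\mathcal{A}_{a_2,\hat a_2}\circ\mathcal{A}_{a_1,\hat a_1}\Rightarrow\mathcal{A}_{a_1+a_2,\hat a_1+\hat a_2}$ is $(\hat a_2a_1,0)$. It is compatible with pullback along smooth maps. **2-stackification.** For a presheaf $\mathcal{F}$ of one-object bicategories on smooth manifolds whose 2-morphisms form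 sheaves (as they do for $\mathcal{B}\mathbb{TD}$ and $\mathcal{T}$), the objects of its 2-stackification $\mathcal{F}^+$ over $X$ are open covers $(U_i)$ of $X$ with 1-morphisms $g_{ij}$ of $\mathcal{F}(U_i\cap U_j)$ and 2-morphisms $\gamma_{ijk}:g_{jk}\circ g_{ij}\Rightarrow g_{ik}$ satisfying the cocycle condition over fourfold intersections; 1-morphisms are 1-morphisms of descent objects over common refinements of the covers, and 2-morphisms are compatible families of local 2-morphisms. The 2-stack $\mathrm{TCor}$ of T-duality correspondences is the closure of $\mathcal{T}$ under descent, i.e. the 2-stackification $\mathcal{T}^+$ of $\mathcal{T}$: its objects are the correspondences obtained by gluing the $\mathcal{T}_{U_i}$ along 1-morphisms of $\mathcal{T}$. **Proposition.** The morphism $C^+:\mathcal{B}\mathbb{TD}^+\to\mathrm{TCor}$ induced by the 2-functor $C$ is an isomorphism of 2-stacks, $\mathcal{B}\mathbb{TD}^+\cong\mathrm{TCor}$. That is, for every smooth manifold $X$ every object $y$ of $\mathrm{TCor}(X)$ is equivalent, over the identity of $X$, to $C^+(x)$ for an object $x$ of $\mathcal{B}\mathbb{TD}^+(X)$; and for all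 objects $x$ of $\mathcal{B}\mathbb{TD}^+(X)$ and $x'$ of $\mathcal{B}\mathbb{TD}^+(X')$, the functor from the category of 1-morphisms $x\to x'$ over smooth maps $X\to X'$ to the category of 1-morphisms $C^+(x)\to C^+(x')$ over smooth maps $X\to X'$ is an equivalence of categories. -/

import Mathlib

open CategoryTheory TopologicalSpace
open scoped ContDiff

noncomputable section

namespace TDual

section Manifolds

open scoped Manifold

/-- A smooth manifold: finite-dimensional, without boundary, Hausdorff, second countable. -/
structure Mfd where
  carrier : Type
  dim : ℕ
  [top : TopologicalSpace carrier]
  [chart : ChartedSpace (EuclideanSpace ℝ (Fin dim)) carrier]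
  [mfd : IsManifold (𝓡 dim) ∞ carrier]
  [t2 : T2Space carrier]
  [sct : SecondCountableTopology carrier]

instance : CoeSort Mfd Type := ⟨Mfd.carrier⟩

attribute [instance] Mfd.top Mfd.chart Mfd.mfd Mfd.t2 Mfd.sct

/-- The category of smooth manifolds and smooth maps. -/
instance : Category Mfd where
  Hom X Y := {f : X → Y // ContMDiff (𝓡 X.dim) (𝓡 Y.dim) ∞ f}
  id _ := ⟨fun x => x, contMDiff_id⟩
  comp f g := ⟨fun x => g.1 (f.1 x), g.2.comp f.2⟩

instance {X Y : Mfd} : CoeFun (X ⟶ Y) (fun _ => X → Y) := ⟨fun f => f.1⟩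

/-- An open subset of a smooth manifold, as a smooth manifold. -/
def Mfd.op (X : Mfd) (U : Opens X) : Mfd where
  carrier := U
  dim := X.dim

/-- A smooth map restricted to open subsets of source and target. -/
def Mfd.restr {X Y : Mfd} (φ : X ⟶ Y) {V : Opens X} {U : Opens Y} (h : ∀ x ∈ V, φ x ∈ U) :
    X.op V ⟶ Y.op U :=
  ⟨fun x => ⟨φ.1 x.1, h x.1 x.2⟩,
    show ContMDiff (𝓡 X.dim) (𝓡 Y.dim) ∞ (fun x : V => (⟨φ.1 x.1, h x.1 x.2⟩ : U)) from
    (ContMDiff.subtypeVal_comp_iff U _).1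
      (show ContMDiff (𝓡 X.dim) (𝓡 Y.dim) ∞ (fun x : V => φ.1 x.1) from
        φ.2.comp contMDiff_subtype_val)⟩

/-- The inclusion of an open subset. -/
def Mfd.incl (X : Mfd) (U : Opens X) : X.op U ⟶ X :=
  ⟨Subtype.val, show ContMDiff (𝓡 X.dim) (𝓡 X.dim) ∞ (Subtype.val : U → X) from
    contMDiff_subtype_val⟩

end Manifolds

/-- A presheaf, over the category of smooth manifolds, of strict one-object bigroupoids of the
following concrete kind.  Over `X`, the 1-morphisms are functions `g : X → B` in `G X`, composed
pointwise in the group `B`; a 2-morphism `g ⟹ g'` is a function `h : X → A` in `H X` with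
`rel (h x) (g x) (g' x)` for all `x`.  Vertical composition is addition in `A`; `pre h k` is the
whiskering `h ∘ k : g ∘ k ⟹ g' ∘ k` and `post k h` is the whiskering `k ∘ h : k ∘ g ⟹ k ∘ g'`, so
that the horizontal composition of `h₁ : g₁ ⟹ g₁'` with `h₂ : g₂ ⟹ g₂'` is
`pre h₂ g₁' + post g₂ h₁ : g₂ ∘ g₁ ⟹ g₂' ∘ g₁'`.  Restriction along a smooth map is precomposition;
it is strictly functorial.  2-morphisms form a sheaf (`H_local`). -/
structure OneObj where
  B : Type
  A : Type
  [grp : Group B]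
  [ab : AddCommGroup A]
  rel : A → B → B → Prop
  pre : A → B → A
  post : B → A → A
  rel_zero : ∀ g, rel 0 g g
  rel_add : ∀ {h h' g g' g''}, rel h g g' → rel h' g' g'' → rel (h' + h) g g''
  rel_neg : ∀ {h g g'}, rel h g g' → rel (-h) g' g
  rel_pre : ∀ {h g g'} (k), rel h g g' → rel (pre h k) (g * k) (g' * k)
  rel_post : ∀ {h g g'} (k), rel h g g' → rel (post k h) (k * g) (k * g')
  pre_add : ∀ h h' g, pre (h + h') g = pre h g + pre h' g
  post_add : ∀ g h h', post g (h + h') = post g h + post g h'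
  pre_one : ∀ h, pre h 1 = h
  post_one : ∀ h, post 1 h = h
  pre_mul : ∀ h g g', pre h (g * g') = pre (pre h g) g'
  post_mul : ∀ g g' h, post (g * g') h = post g (post g' h)
  pre_post : ∀ g h g', pre (post g h) g' = post g (pre h g')
  exch : ∀ {h₁ h₂ g₁ g₁' g₂ g₂'}, rel h₁ g₁ g₁' → rel h₂ g₂ g₂' →
    pre h₂ g₁' + post g₂ h₁ = post g₂' h₁ + pre h₂ g₁
  G : ∀ X : Mfd, Subgroup (X → B)
  H : ∀ X : Mfd, AddSubgroup (X → A)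
  G_pull : ∀ {X Y : Mfd} (φ : X ⟶ Y) {g : Y → B}, g ∈ G Y → (fun x => g (φ x)) ∈ G X
  H_pull : ∀ {X Y : Mfd} (φ : X ⟶ Y) {h : Y → A}, h ∈ H Y → (fun x => h (φ x)) ∈ H X
  H_pre : ∀ {X : Mfd} {h : X → A} {g : X → B}, h ∈ H X → g ∈ G X →
    (fun x => pre (h x) (g x)) ∈ H X
  H_post : ∀ {X : Mfd} {g : X → B} {h : X → A}, g ∈ G X → h ∈ H X →
    (fun x => post (g x) (h x)) ∈ H X
  H_local : ∀ {X : Mfd} (h : X → A),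
    (∀ x, ∃ U : Opens X, x ∈ U ∧ (fun y : X.op U => h y.1) ∈ H (X.op U)) → h ∈ H X

attribute [instance] OneObj.grp OneObj.ab
attribute [simp] OneObj.pre_add OneObj.post_add OneObj.pre_one OneObj.post_one OneObj.pre_post

namespace OneObj

variable (Γ : OneObj)

@[simp] lemma pre_zero (g) : Γ.pre 0 g = 0 := by
  simpa using Γ.pre_add 0 0 g

@[simp] lemma post_zero (g) : Γ.post g 0 = 0 := by
  simpa using Γ.post_add g 0 0

@[simp] lemma pre_neg (h g) : Γ.pre (-h) g = -Γ.pre h g := by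
  rw [eq_neg_iff_add_eq_zero, ← Γ.pre_add]; simp

@[simp] lemma post_neg (g h) : Γ.post g (-h) = -Γ.post g h := by
  rw [eq_neg_iff_add_eq_zero, ← Γ.post_add]; simp

@[simp] lemma pre_sub (h h' g) : Γ.pre (h - h') g = Γ.pre h g - Γ.pre h' g := by
  simp [sub_eq_add_neg]

@[simp] lemma post_sub (g h h') : Γ.post g (h - h') = Γ.post g h - Γ.post g h' := by
  simp [sub_eq_add_neg]

lemma pre_inj {h h' g} (e : Γ.pre h g = Γ.pre h' g) : h = h' := by
  have := congrArg (fun z => Γ.pre z g⁻¹) e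
  simpa [← Γ.pre_mul] using this

lemma post_inj {h h' g} (e : Γ.post g h = Γ.post g h') : h = h' := by
  have := congrArg (fun z => Γ.post g⁻¹ z) e
  simpa [← Γ.post_mul] using this

variable {Γ}

lemma G_res {X Y : Mfd} (φ : X ⟶ Y) {V : Opens X} {U : Opens Y} (h : ∀ x ∈ V, φ x ∈ U)
    {g : U → Γ.B} (hg : g ∈ Γ.G (Y.op U)) :
    (fun x : V => g ⟨φ x.1, h x.1 x.2⟩) ∈ Γ.G (X.op V) :=
  Γ.G_pull (Mfd.restr φ h) hg

lemma H_res {X Y : Mfd} (φ : X ⟶ Y) {V : Opens X} {U : Opens Y} (h : ∀ x ∈ V, φ x ∈ U)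
    {g : U → Γ.A} (hg : g ∈ Γ.H (Y.op U)) :
    (fun x : V => g ⟨φ x.1, h x.1 x.2⟩) ∈ Γ.H (X.op V) :=
  Γ.H_pull (Mfd.restr φ h) hg

lemma G_mul {X : Mfd} {g g' : X → Γ.B} (hg : g ∈ Γ.G X) (hg' : g' ∈ Γ.G X) :
    (fun x => g x * g' x) ∈ Γ.G X := (Γ.G X).mul_mem hg hg'

lemma G_inv {X : Mfd} {g : X → Γ.B} (hg : g ∈ Γ.G X) :
    (fun x => (g x)⁻¹) ∈ Γ.G X := (Γ.G X).inv_mem hg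

lemma H_add {X : Mfd} {g g' : X → Γ.A} (hg : g ∈ Γ.H X) (hg' : g' ∈ Γ.H X) :
    (fun x => g x + g' x) ∈ Γ.H X := (Γ.H X).add_mem hg hg'

lemma H_neg {X : Mfd} {g : X → Γ.A} (hg : g ∈ Γ.H X) :
    (fun x => - g x) ∈ Γ.H X := (Γ.H X).neg_mem hg

lemma H_sub {X : Mfd} {g g' : X → Γ.A} (hg : g ∈ Γ.H X) (hg' : g' ∈ Γ.H X) :
    (fun x => g x - g' x) ∈ Γ.H X := (Γ.H X).sub_mem hg hg'

lemma H_zero {X : Mfd} : (fun _ => 0) ∈ Γ.H X := (Γ.H X).zero_mem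

end OneObj

/-- A `Γ`-cocycle: a smooth manifold `X` with an open cover `U i`, and a descent object
with values in `Γ`: 1-morphisms `g i j` over `U i ∩ U j` and 2-morphisms
`γ i j k : g j k ∘ g i j ⟹ g i k` over `U i ∩ U j ∩ U k` satisfying the cocycle condition over
4-fold intersections.  At a point `x` the indices range over the `i` with `x ∈ U i`. -/
structure Coc (Γ : OneObj) where
  X : Mfd
  I : Type
  U : I → Opens X
  cov : ∀ x, ∃ i, x ∈ U i
  g : ∀ x : X, {i // x ∈ U i} → {i // x ∈ U i} → Γ.B
  γ : ∀ x : X, {i // x ∈ U i} → {i // x ∈ U i} → {i // x ∈ U i} → Γ.A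
  rel_γ : ∀ x i j k, Γ.rel (γ x i j k) (g x j k * g x i j) (g x i k)
  coc : ∀ x i j k l, γ x i k l + Γ.post (g x k l) (γ x i j k) =
    γ x i j l + Γ.pre (γ x j k l) (g x i j)
  g_mem : ∀ i j, (fun x : X.op (U i ⊓ U j) => g x.1 ⟨i, x.2.1⟩ ⟨j, x.2.2⟩) ∈
    Γ.G (X.op (U i ⊓ U j))
  γ_mem : ∀ i j k, (fun x : X.op (U i ⊓ U j ⊓ U k) =>
    γ x.1 ⟨i, x.2.1.1⟩ ⟨j, x.2.1.2⟩ ⟨k, x.2.2⟩) ∈ Γ.H (X.op (U i ⊓ U j ⊓ U k))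

variable {Γ : OneObj}

/-- A 1-morphism between `Γ`-cocycles, over a smooth map `φ` of the base manifolds: a common
refinement `W k`, `k ∈ K i i'`, of the covers `U i` and `φ⁻¹ (U' i')` (more precisely, of the cover
by all `U i ∩ φ⁻¹ (U' i')`), together with a 1-morphism of descent objects: 1-morphisms `p k` over
`W k` and 2-morphisms `e k l : p l ∘ g i j ⟹ g' i' j' ∘ p k` over `W k ∩ W l` that are compatible
with `γ` and `γ'`. -/
structure Coc.Hom (a b : Coc Γ) where
  φ : a.X ⟶ b.X
  K : a.I → b.I → Type
  W : ∀ {i i'}, K i i' → Opens a.X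
  W_l : ∀ {i i'} (k : K i i') {x}, x ∈ W k → x ∈ a.U i
  W_r : ∀ {i i'} (k : K i i') {x}, x ∈ W k → φ x ∈ b.U i'
  cov : ∀ {x i i'}, x ∈ a.U i → φ x ∈ b.U i' → ∃ k : K i i', x ∈ W k
  p : ∀ (x : a.X) {i i'}, {k : K i i' // x ∈ W k} → Γ.B
  e : ∀ (x : a.X) {i i' j j'}, {k : K i i' // x ∈ W k} → {l : K j j' // x ∈ W l} → Γ.A
  rel_e : ∀ (x : a.X) {i i' j j'} (k : {k : K i i' // x ∈ W k}) (l : {l : K j j' // x ∈ W l}),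
    Γ.rel (e x k l) (p x l * a.g x ⟨i, W_l k.1 k.2⟩ ⟨j, W_l l.1 l.2⟩)
      (b.g (φ x) ⟨i', W_r k.1 k.2⟩ ⟨j', W_r l.1 l.2⟩ * p x k)
  coh : ∀ (x : a.X) {i i' j j' r r'} (k : {k : K i i' // x ∈ W k}) (l : {l : K j j' // x ∈ W l})
    (m : {m : K r r' // x ∈ W m}),
    e x k m + Γ.post (p x m) (a.γ x ⟨i, W_l k.1 k.2⟩ ⟨j, W_l l.1 l.2⟩ ⟨r, W_l m.1 m.2⟩) =
      Γ.pre (b.γ (φ x) ⟨i', W_r k.1 k.2⟩ ⟨j', W_r l.1 l.2⟩ ⟨r', W_r m.1 m.2⟩) (p x k) +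
      Γ.post (b.g (φ x) ⟨j', W_r l.1 l.2⟩ ⟨r', W_r m.1 m.2⟩) (e x k l) +
      Γ.pre (e x l m) (a.g x ⟨i, W_l k.1 k.2⟩ ⟨j, W_l l.1 l.2⟩)
  p_mem : ∀ {i i'} (k : K i i'), (fun x : a.X.op (W k) => p x.1 ⟨k, x.2⟩) ∈ Γ.G (a.X.op (W k))
  e_mem : ∀ {i i' j j'} (k : K i i') (l : K j j'),
    (fun x : a.X.op (W k ⊓ W l) => e x.1 ⟨k, x.2.1⟩ ⟨l, x.2.2⟩) ∈ Γ.H (a.X.op (W k ⊓ W l))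

namespace Coc

/-- The indices of a refinement whose open set contains `x`. -/
abbrev Hom.Fib {a b : Coc Γ} (m : a.Hom b) (x : a.X) (i : a.I) (i' : b.I) : Type :=
  {k : m.K i i' // x ∈ m.W k}

abbrev Hom.l {a b : Coc Γ} (m : a.Hom b) {x i i'} (k : m.Fib x i i') : {i // x ∈ a.U i} :=
  ⟨i, m.W_l k.1 k.2⟩

abbrev Hom.r {a b : Coc Γ} (m : a.Hom b) {x i i'} (k : m.Fib x i i') : {i // m.φ x ∈ b.U i} :=
  ⟨i', m.W_r k.1 k.2⟩

/-- A 2-morphism between 1-morphisms of `Γ`-cocycles (over the same smooth map): 2-morphisms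
`t k k' : p k ⟹ p' k'` over `W k ∩ W' k'`, for all `k ∈ K i i'` and `k' ∈ K' i i'`, compatible
with the 2-morphisms `e` and `e'`. -/
@[ext] structure Hom₂ {a b : Coc Γ} (m m' : a.Hom b) where
  base : m.φ = m'.φ
  t : ∀ (x : a.X) {i i'}, m.Fib x i i' → m'.Fib x i i' → Γ.A
  rel_t : ∀ (x : a.X) {i i'} (k : m.Fib x i i') (k' : m'.Fib x i i'),
    Γ.rel (t x k k') (m.p x k) (m'.p x k')
  comm : ∀ (x : a.X) {i i' j j'} (k : m.Fib x i i') (k' : m'.Fib x i i') (l : m.Fib x j j')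
    (l' : m'.Fib x j j'), m'.e x k' l' + Γ.pre (t x l l') (a.g x (m.l k) (m.l l)) =
      Γ.post (b.g (m.φ x) (m.r k) (m.r l)) (t x k k') + m.e x k l
  t_mem : ∀ {i i'} (k : m.K i i') (k' : m'.K i i'),
    (fun x : a.X.op (m.W k ⊓ m'.W k') => t x.1 ⟨k, x.2.1⟩ ⟨k', x.2.2⟩) ∈
      Γ.H (a.X.op (m.W k ⊓ m'.W k'))

end Coc
namespace Coc

variable {Γ : OneObj} {a b c d : Coc Γ}

/-- The canonical 2-morphism `g i i ⟹ 1` of a cocycle. -/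
def u (a : Coc Γ) (x : a.X) (i : {i // x ∈ a.U i}) : Γ.A := Γ.pre (a.γ x i i i) (a.g x i i)⁻¹

lemma rel_u (x i) : Γ.rel (a.u x i) (a.g x i i) 1 := by
  have := Γ.rel_pre (a.g x i i)⁻¹ (a.rel_γ x i i i)
  rwa [mul_assoc, mul_inv_cancel, mul_one] at this

lemma pre_u (x i) : Γ.pre (a.u x i) (a.g x i i) = a.γ x i i i := by
  simp [u, ← Γ.pre_mul]

lemma post_u (x i) : Γ.post (a.g x i i) (a.u x i) = a.γ x i i i := by
  have := Γ.exch (a.rel_u x i) (a.rel_u x i)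
  simp only [Γ.pre_one, Γ.post_one, pre_u, add_right_inj] at this
  exact this

lemma γ_iij (x i j) : a.γ x i i j = Γ.post (a.g x i j) (a.u x i) := by
  have := a.coc x i i i j
  rw [add_right_inj] at this
  apply Γ.pre_inj (g := a.g x i i)
  rw [← this, Γ.pre_post, pre_u]

lemma γ_ijj (x i j) : a.γ x i j j = Γ.pre (a.u x j) (a.g x i j) := by
  have := a.coc x i j j j
  rw [add_right_inj] at this
  apply Γ.post_inj (g := a.g x j j)
  rw [this, ← Γ.pre_post, post_u]

lemma u_mem (i : a.I) : (fun x : a.X.op (a.U i) => a.u x.1 ⟨i, x.2⟩) ∈ Γ.H (a.X.op (a.U i)) :=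
  Γ.H_pre (OneObj.H_res (𝟙 a.X) (V := a.U i) (U := a.U i ⊓ a.U i ⊓ a.U i)
    (fun _ h => ⟨⟨h, h⟩, h⟩) (a.γ_mem i i i))
    (OneObj.G_inv (OneObj.G_res (𝟙 a.X) (V := a.U i) (U := a.U i ⊓ a.U i)
      (fun _ h => ⟨h, h⟩) (a.g_mem i i)))

/-- An automorphism 2-cell with the given idempotency property vanishes. -/
lemma eq_zero_of (a b : Coc Γ) {x i y i' q h} (hr : Γ.rel h q q)
    (h1 : h = Γ.post (b.g y i' i') h + Γ.pre h (a.g x i i)) : h = 0 := by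
  have e1 := Γ.exch hr (b.rel_u y i')
  have e2 := Γ.exch (a.rel_u x i) hr
  simp only [Γ.pre_one, Γ.post_one] at e1 e2
  have e3 : Γ.post (b.g y i' i') h = h := by
    rw [add_comm] at e1; exact add_right_cancel e1
  have e4 : Γ.pre h (a.g x i i) = h := by
    rw [add_comm] at e2; exact (add_left_cancel e2).symm
  rw [e3, e4] at h1
  simpa using h1

namespace Hom

lemma e_self (m : a.Hom b) {x i i'} (k : m.Fib x i i') :
    m.e x k k = Γ.post (m.p x k) (a.u x (m.l k)) - Γ.pre (b.u (m.φ x) (m.r k)) (m.p x k) := by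
  have hA := Γ.rel_post (m.p x k) (a.rel_u x (m.l k))
  have hB := Γ.rel_pre (m.p x k) (b.rel_u (m.φ x) (m.r k))
  rw [mul_one] at hA
  rw [one_mul] at hB
  have hC := m.rel_e x k k
  have h0 := m.coh x k k k
  have e1 := Γ.exch hC (b.rel_u (m.φ x) (m.r k))
  have e2 := Γ.exch (a.rel_u x (m.l k)) hC
  have e3 := Γ.exch hA (b.rel_u (m.φ x) (m.r k))
  simp only [Γ.pre_one, Γ.post_one] at e1 e2 e3
  rw [← pre_u (a := b), ← post_u (a := a), ← Γ.post_mul, ← Γ.pre_mul] at h0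
  simp only [Γ.pre_mul, Γ.post_mul] at e1 e2 e3 h0
  rw [eq_sub_iff_add_eq]
  grind

end Hom

/-- The failure of the compatibility condition of 2-morphisms. -/
def df (m m' : a.Hom b) (x : a.X) {i i' j j'} (k : m.Fib x i i') (k' : m'.Fib x i i')
    (l : m.Fib x j j') (l' : m'.Fib x j j') (v w : Γ.A) : Γ.A :=
  m'.e x k' l' + Γ.pre w (a.g x (m.l k) (m.l l)) -
    (Γ.post (b.g (m.φ x) (m.r k) (m.r l)) v + m.e x k l)

lemma g_congr {x y : b.X} (h : x = y) {i j : b.I} (hi hj hi' hj') :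
    b.g x ⟨i, hi⟩ ⟨j, hj⟩ = b.g y ⟨i, hi'⟩ ⟨j, hj'⟩ := by subst h; rfl

lemma γ_congr {x y : b.X} (h : x = y) {i j k : b.I} (hi hj hk hi' hj' hk') :
    b.γ x ⟨i, hi⟩ ⟨j, hj⟩ ⟨k, hk⟩ = b.γ y ⟨i, hi'⟩ ⟨j, hj'⟩ ⟨k, hk'⟩ := by subst h; rfl

section df

variable {m m' : a.Hom b} {x : a.X} {i i' j j' r r'}
  {k : m.Fib x i i'} {k' : m'.Fib x i i'} {l : m.Fib x j j'} {l' : m'.Fib x j j'}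
  {n : m.Fib x r r'} {n' : m'.Fib x r r'} {v w z : Γ.A}

lemma rel_df (base : m.φ = m'.φ) (hv : Γ.rel v (m.p x k) (m'.p x k')) (hw : Γ.rel w (m.p x l) (m'.p x l')) :
    Γ.rel (df m m' x k k' l l' v w) (b.g (m.φ x) (m.r k) (m.r l) * m'.p x k')
      (b.g (m.φ x) (m.r k) (m.r l) * m'.p x k') := by
  have h1 := Γ.rel_neg (Γ.rel_add (m.rel_e x k l)
    (Γ.rel_post (b.g (m.φ x) (m.r k) (m.r l)) hv))
  have h2 := Γ.rel_add (Γ.rel_pre (a.g x (m.l k) (m.l l)) hw) (m'.rel_e x k' l')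
  rw [g_congr (congrArg (fun f => f.1 x) base.symm) _ _ (m.r k).2 (m.r l).2] at h2
  have := Γ.rel_add h1 h2
  rwa [← sub_eq_add_neg] at this

lemma df_trans (base : m.φ = m'.φ) (hv : Γ.rel v (m.p x k) (m'.p x k')) (hz : Γ.rel z (m.p x n) (m'.p x n')) :
    df m m' x k k' n n' v z = Γ.post (b.g (m.φ x) (m.r l) (m.r n)) (df m m' x k k' l l' v w) +
      Γ.pre (df m m' x l l' n n' w z) (a.g x (m.l k) (m.l l)) := by
  have c1 := m.coh x k l n
  have c2 := m'.coh x k' l' n'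
  rw [g_congr (congrArg (fun f => f.1 x) base.symm) _ _ (m.r l).2 (m.r n).2,
    γ_congr (congrArg (fun f => f.1 x) base.symm) _ _ _ (m.r k).2 (m.r l).2 (m.r n).2] at c2
  have x1 := Γ.exch (a.rel_γ x (m.l k) (m.l l) (m.l n)) hz
  have x2 := Γ.exch hv (b.rel_γ (m.φ x) (m.r k) (m.r l) (m.r n))
  simp only [df, Γ.pre_sub, Γ.post_sub, Γ.pre_add, Γ.post_add, Γ.pre_post, Γ.pre_mul,
    Γ.post_mul] at *
  grind

lemma df_self (base : m.φ = m'.φ) (hv : Γ.rel v (m.p x k) (m'.p x k')) : df m m' x k k' k k' v v = 0 :=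
  eq_zero_of a b (rel_df base hv hv) (df_trans base hv hv)

lemma df_of_trans (base : m.φ = m'.φ) (hv : Γ.rel v (m.p x k) (m'.p x k')) (hz : Γ.rel z (m.p x n) (m'.p x n'))
    (h1 : df m m' x k k' l l' v w = 0) (h2 : df m m' x l l' n n' w z = 0) :
    df m m' x k k' n n' v z = 0 := by
  rw [df_trans base hv hz, h1, h2]; simp

lemma df_cancel (base : m.φ = m'.φ) (hv : Γ.rel v (m.p x k) (m'.p x k')) (hz : Γ.rel z (m.p x n) (m'.p x n'))
    (h1 : df m m' x k k' l l' v w = 0) (h2 : df m m' x k k' n n' v z = 0) :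
    df m m' x l l' n n' w z = 0 := by
  rw [df_trans base hv hz, h1] at h2
  apply Γ.pre_inj
  rw [Γ.pre_zero]
  simpa using h2

lemma df_symm (base : m.φ = m'.φ) (hv : Γ.rel v (m.p x k) (m'.p x k')) (h1 : df m m' x k k' l l' v w = 0) :
    df m m' x l l' k k' w v = 0 :=
  df_cancel base hv hv h1 (df_self base hv)

end df

/-- 2-morphisms are equal if, near every point, they agree for some choice of indices. -/
lemma Hom₂.ext' {m m' : a.Hom b} {s t : Hom₂ m m'}
    (h : ∀ x i i', x ∈ a.U i → m.φ x ∈ b.U i' →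
      ∃ (k : m.Fib x i i') (k' : m'.Fib x i i'), s.t x k k' = t.t x k k') : s = t := by
  apply Hom₂.ext
  funext x i i' l l'
  obtain ⟨k, k', e⟩ := h x i i' (m.l l).2 (m.r l).2
  have h1 := s.comm x k k' l l'
  have h2 := t.comm x k k' l l'
  rw [e, ← h2, add_right_inj] at h1
  exact Γ.pre_inj h1

/-- A 2-morphism presented over a common refinement `V d`, `d ∈ D i i'`, of the refinements
underlying two 1-morphisms. -/
structure Ref (m m' : a.Hom b) where
  base : m.φ = m'.φ
  D : a.I → b.I → Type
  V : ∀ {i i'}, D i i' → Opens a.X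
  k : ∀ {i i'}, D i i' → m.K i i'
  k' : ∀ {i i'}, D i i' → m'.K i i'
  V_k : ∀ {i i'} (d : D i i') {x}, x ∈ V d → x ∈ m.W (k d)
  V_k' : ∀ {i i'} (d : D i i') {x}, x ∈ V d → x ∈ m'.W (k' d)
  cov : ∀ {x i i'}, x ∈ a.U i → m.φ x ∈ b.U i' → ∃ d : D i i', x ∈ V d
  t : ∀ (x : a.X) {i i'}, {d : D i i' // x ∈ V d} → Γ.A
  rel_t : ∀ (x : a.X) {i i'} (d : {d : D i i' // x ∈ V d}),
    Γ.rel (t x d) (m.p x ⟨k d.1, V_k d.1 d.2⟩) (m'.p x ⟨k' d.1, V_k' d.1 d.2⟩)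
  comm : ∀ (x : a.X) {i i' j j'} (d : {d : D i i' // x ∈ V d}) (d' : {d : D j j' // x ∈ V d}),
    df m m' x ⟨k d.1, V_k d.1 d.2⟩ ⟨k' d.1, V_k' d.1 d.2⟩
      ⟨k d'.1, V_k d'.1 d'.2⟩ ⟨k' d'.1, V_k' d'.1 d'.2⟩ (t x d) (t x d') = 0
  t_mem : ∀ {i i'} (d : D i i'), (fun x : a.X.op (V d) => t x.1 ⟨d, x.2⟩) ∈ Γ.H (a.X.op (V d))

namespace Ref

variable {m m' : a.Hom b} (R : Ref m m')

abbrev kk {x i i'} (d : {d : R.D i i' // x ∈ R.V d}) : m.Fib x i i' := ⟨R.k d.1, R.V_k d.1 d.2⟩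
abbrev kk' {x i i'} (d : {d : R.D i i' // x ∈ R.V d}) : m'.Fib x i i' :=
  ⟨R.k' d.1, R.V_k' d.1 d.2⟩

/-- The value forced on other indices. -/
def val (x : a.X) {i i' j j'} (d : {d : R.D i i' // x ∈ R.V d}) (l : m.Fib x j j')
    (l' : m'.Fib x j j') : Γ.A :=
  Γ.pre (Γ.post (b.g (m.φ x) (m.r (R.kk d)) (m.r l)) (R.t x d) + m.e x (R.kk d) l -
    m'.e x (R.kk' d) l') (a.g x (m.l (R.kk d)) (m.l l))⁻¹

lemma df_val (x : a.X) {i i' j j'} (d : {d : R.D i i' // x ∈ R.V d}) (l : m.Fib x j j')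
    (l' : m'.Fib x j j') :
    df m m' x (R.kk d) (R.kk' d) l l' (R.t x d) (R.val x d l l') = 0 := by
  rw [df, val, ← Γ.pre_mul, inv_mul_cancel, Γ.pre_one]
  abel

lemma eq_val {x : a.X} {i i' j j'} {d : {d : R.D i i' // x ∈ R.V d}} {l : m.Fib x j j'}
    {l' : m'.Fib x j j'} {w} (h : df m m' x (R.kk d) (R.kk' d) l l' (R.t x d) w = 0) :
    w = R.val x d l l' := by
  have h' := R.df_val x d l l'
  rw [df, sub_eq_zero] at h h'
  rw [← h', add_right_inj] at h
  exact Γ.pre_inj h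

lemma rel_val (x : a.X) {i i' j j'} (d : {d : R.D i i' // x ∈ R.V d}) (l : m.Fib x j j')
    (l' : m'.Fib x j j') : Γ.rel (R.val x d l l') (m.p x l) (m'.p x l') := by
  have h1 := Γ.rel_add (m.rel_e x (R.kk d) l)
    (Γ.rel_post (b.g (m.φ x) (m.r (R.kk d)) (m.r l)) (R.rel_t x d))
  have h2 := Γ.rel_neg (m'.rel_e x (R.kk' d) l')
  rw [g_congr (congrArg (fun f => f.1 x) R.base.symm) _ _ (m.r (R.kk d)).2 (m.r l).2] at h2
  have h3 := Γ.rel_pre (a.g x (m.l (R.kk d)) (m.l l))⁻¹ (Γ.rel_add h1 h2)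
  rw [mul_assoc, mul_inv_cancel, mul_one, mul_assoc, mul_inv_cancel, mul_one] at h3
  rw [val, sub_eq_add_neg, add_comm _ (-_)]
  exact h3

lemma val_eq (x : a.X) {i i' j j' r r'} (d : {d : R.D i i' // x ∈ R.V d})
    (d' : {d : R.D r r' // x ∈ R.V d}) (l : m.Fib x j j') (l' : m'.Fib x j j') :
    R.val x d l l' = R.val x d' l l' :=
  R.eq_val (df_cancel R.base (R.rel_t x d) (R.rel_val x d l l') (R.comm x d d')
    (R.df_val x d l l'))

def pick {x : a.X} {i i'} (hi : x ∈ a.U i) (hi' : m.φ x ∈ b.U i') : {d : R.D i i' // x ∈ R.V d} :=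
  ⟨(R.cov hi hi').choose, (R.cov hi hi').choose_spec⟩

/-- The 2-morphism presented by data over a common refinement. -/
def hom : Hom₂ m m' where
  base := R.base
  t x _ _ l l' := R.val x (R.pick (m.l l).2 (m.r l).2) l l'
  rel_t x _ _ l l' := R.rel_val x _ l l'
  comm x _ _ _ _ k k' l l' := by
    rw [R.val_eq x _ (R.pick (m.l k).2 (m.r k).2) l l', ← sub_eq_zero]
    exact df_cancel R.base (R.rel_t x (R.pick (m.l k).2 (m.r k).2)) (R.rel_val ..)
      (R.df_val ..) (R.df_val ..)
  t_mem {i i'} l l' := by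
    apply Γ.H_local
    intro x
    obtain ⟨d, hd⟩ := R.cov (m.W_l l x.2.1) (m.W_r l x.2.1)
    let U : Opens (a.X.op (m.W l ⊓ m'.W l')) := ⟨Subtype.val ⁻¹' (R.V d).1,
      (R.V d).2.preimage continuous_subtype_val⟩
    refine ⟨U, hd, ?_⟩
    have key : ∀ y : (a.X.op (m.W l ⊓ m'.W l')).op U,
        R.val y.1.1 (R.pick (m.W_l l y.1.2.1) (m.W_r l y.1.2.1)) ⟨l, y.1.2.1⟩ ⟨l', y.1.2.2⟩ =
        R.val y.1.1 ⟨d, y.2⟩ ⟨l, y.1.2.1⟩ ⟨l', y.1.2.2⟩ := fun y => R.val_eq ..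
    simp only [key]
    let inc : (a.X.op (m.W l ⊓ m'.W l')) ⟶ a.X := Mfd.incl _ _
    have hU : ∀ y ∈ U, inc y ∈ R.V d := fun y hy => hy
    refine Γ.H_pre (OneObj.H_sub (OneObj.H_add (Γ.H_post ?_ ?_) ?_) ?_) (OneObj.G_inv ?_)
    · exact OneObj.G_res (inc ≫ m.φ) (V := U) (U := b.U i' ⊓ b.U i')
        (fun y hy => ⟨m.W_r l y.2.1, m.W_r l y.2.1⟩) (b.g_mem i' i')
    · exact OneObj.H_res inc (V := U) hU (R.t_mem d)
    · exact OneObj.H_res inc (V := U) (U := m.W (R.k d) ⊓ m.W l)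
        (fun y hy => ⟨R.V_k d hy, y.2.1⟩) (m.e_mem (R.k d) l)
    · exact OneObj.H_res inc (V := U) (U := m'.W (R.k' d) ⊓ m'.W l')
        (fun y hy => ⟨R.V_k' d hy, y.2.2⟩) (m'.e_mem (R.k' d) l')
    · exact OneObj.G_res inc (V := U) (U := a.U i ⊓ a.U i)
        (fun y hy => ⟨m.W_l l y.2.1, m.W_l l y.2.1⟩) (a.g_mem i i)

lemma hom_t (x : a.X) {i i'} (d : {d : R.D i i' // x ∈ R.V d}) :
    R.hom.t x (R.kk d) (R.kk' d) = R.t x d := by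
  refine (R.eq_val (d := R.pick _ _) ?_).symm
  exact R.comm x _ d

end Ref

end Coc
namespace Coc

variable {Γ : OneObj} {a b c d : Coc Γ}

/-- Preimages of open subsets under smooth maps. -/
def pre {X Y : Mfd} (φ : X ⟶ Y) (U : Opens Y) : Opens X :=
  ⟨φ.1 ⁻¹' U.1, U.2.preimage φ.2.continuous⟩

namespace Hom

lemma id_coh {x : a.X} (i i' j j' r r' : {i // x ∈ a.U i}) :
    a.γ x i r r' - a.γ x i i' r' + Γ.post (a.g x r r') (a.γ x i j r) =
      Γ.pre (a.γ x i' j' r') (a.g x i i') +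
      Γ.post (a.g x j' r') (a.γ x i j j' - a.γ x i i' j') +
      Γ.pre (a.γ x j r r' - a.γ x j j' r') (a.g x i j) := by
  simp only [Γ.pre_sub, Γ.post_sub]
  linear_combination (norm := abel) a.coc x i j r r' + a.coc x i i' j' r' - a.coc x i j j' r'

/-- The identity 1-morphism of a cocycle. -/
def id (a : Coc Γ) : a.Hom a where
  φ := 𝟙 a.X
  K _ _ := Unit
  W {i i'} _ := a.U i ⊓ a.U i'
  W_l _ _ h := h.1
  W_r _ _ h := h.2
  cov h h' := ⟨(), h, h'⟩
  p x i i' k := a.g x ⟨i, k.2.1⟩ ⟨i', k.2.2⟩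
  e x i i' j j' k l := a.γ x ⟨i, k.2.1⟩ ⟨j, l.2.1⟩ ⟨j', l.2.2⟩ -
    a.γ x ⟨i, k.2.1⟩ ⟨i', k.2.2⟩ ⟨j', l.2.2⟩
  rel_e x i i' j j' k l := by
    rw [sub_eq_add_neg, add_comm]
    exact Γ.rel_add (a.rel_γ x _ _ _) (Γ.rel_neg (a.rel_γ x _ _ _))
  coh x i i' j j' r r' k l n := id_coh (a := a) ⟨i, k.2.1⟩ ⟨i', k.2.2⟩ ⟨j, l.2.1⟩ ⟨j', l.2.2⟩
    ⟨r, n.2.1⟩ ⟨r', n.2.2⟩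
  p_mem {i i'} _ := a.g_mem i i'
  e_mem {i i' j j'} _ _ :=
    OneObj.H_sub
      (OneObj.H_res (𝟙 a.X) (V := (a.U i ⊓ a.U i') ⊓ (a.U j ⊓ a.U j'))
        (U := a.U i ⊓ a.U j ⊓ a.U j') (fun _ h => ⟨⟨h.1.1, h.2.1⟩, h.2.2⟩) (a.γ_mem i j j'))
      (OneObj.H_res (𝟙 a.X) (V := (a.U i ⊓ a.U i') ⊓ (a.U j ⊓ a.U j'))
        (U := a.U i ⊓ a.U i' ⊓ a.U j') (fun _ h => ⟨⟨h.1.1, h.1.2⟩, h.2.2⟩) (a.γ_mem i i' j'))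

lemma comp_coh {m : a.Hom b} {n : b.Hom c} {x i i' i'' j j' j'' r r' r''}
    (k : m.Fib x i i') (l : m.Fib x j j') (q : m.Fib x r r') (k' : n.Fib (m.φ x) i' i'')
    (l' : n.Fib (m.φ x) j' j'') (q' : n.Fib (m.φ x) r' r'') :
    Γ.post (n.p _ q') (m.e x k q) + Γ.pre (n.e _ k' q') (m.p x k) +
      Γ.post (n.p _ q' * m.p x q) (a.γ x (m.l k) (m.l l) (m.l q)) =
    Γ.pre (c.γ (n.φ (m.φ x)) (n.r k') (n.r l') (n.r q')) (n.p _ k' * m.p x k) +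
      Γ.post (c.g (n.φ (m.φ x)) (n.r l') (n.r q'))
        (Γ.post (n.p _ l') (m.e x k l) + Γ.pre (n.e _ k' l') (m.p x k)) +
      Γ.pre (Γ.post (n.p _ q') (m.e x l q) + Γ.pre (n.e _ l' q') (m.p x l))
        (a.g x (m.l k) (m.l l)) := by
  have h1 := congrArg (Γ.post (n.p _ q')) (m.coh x k l q)
  have h2 := congrArg (fun z => Γ.pre z (m.p x k)) (n.coh (m.φ x) k' l' q')
  have h3 := Γ.exch (m.rel_e x k l) (n.rel_e (m.φ x) l' q')
  simp only [Γ.pre_add, Γ.post_add, Γ.pre_post, Γ.pre_mul, Γ.post_mul] at *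
  linear_combination (norm := abel) h1 + h2 + h3

/-- The composition of 1-morphisms of cocycles. -/
def comp (m : a.Hom b) (n : b.Hom c) : a.Hom c where
  φ := m.φ ≫ n.φ
  K i i'' := Σ i', m.K i i' × n.K i' i''
  W k := m.W k.2.1 ⊓ pre m.φ (n.W k.2.2)
  W_l k _ h := m.W_l k.2.1 h.1
  W_r k _ h := n.W_r k.2.2 h.2
  cov {x i i''} h h' := by
    obtain ⟨i', hi'⟩ := b.cov (m.φ x)
    obtain ⟨k, hk⟩ := m.cov h hi'
    obtain ⟨k', hk'⟩ := n.cov hi' h'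
    exact ⟨⟨i', k, k'⟩, hk, hk'⟩
  p x i i'' k := n.p (m.φ x) ⟨k.1.2.2, k.2.2⟩ * m.p x ⟨k.1.2.1, k.2.1⟩
  e x i i'' j j'' k l :=
    Γ.post (n.p (m.φ x) ⟨l.1.2.2, l.2.2⟩) (m.e x ⟨k.1.2.1, k.2.1⟩ ⟨l.1.2.1, l.2.1⟩) +
    Γ.pre (n.e (m.φ x) ⟨k.1.2.2, k.2.2⟩ ⟨l.1.2.2, l.2.2⟩) (m.p x ⟨k.1.2.1, k.2.1⟩)
  rel_e x i i'' j j'' k l := by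
    have h1 := Γ.rel_post (n.p (m.φ x) ⟨l.1.2.2, l.2.2⟩)
      (m.rel_e x ⟨k.1.2.1, k.2.1⟩ ⟨l.1.2.1, l.2.1⟩)
    have h2 := Γ.rel_pre (m.p x ⟨k.1.2.1, k.2.1⟩)
      (n.rel_e (m.φ x) ⟨k.1.2.2, k.2.2⟩ ⟨l.1.2.2, l.2.2⟩)
    rw [add_comm]
    simp only [mul_assoc] at h1 h2 ⊢
    exact Γ.rel_add h1 h2
  coh x i i'' j j'' r r'' k l q := comp_coh ⟨k.1.2.1, k.2.1⟩ ⟨l.1.2.1, l.2.1⟩ ⟨q.1.2.1, q.2.1⟩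
    ⟨k.1.2.2, k.2.2⟩ ⟨l.1.2.2, l.2.2⟩ ⟨q.1.2.2, q.2.2⟩
  p_mem k := OneObj.G_mul
    (OneObj.G_res m.φ (V := m.W k.2.1 ⊓ pre m.φ (n.W k.2.2)) (fun _ h => h.2) (n.p_mem k.2.2))
    (OneObj.G_res (𝟙 a.X) (V := m.W k.2.1 ⊓ pre m.φ (n.W k.2.2)) (fun _ h => h.1)
      (m.p_mem k.2.1))
  e_mem {i i'' j j''} k l := by
    have hl : ∀ x ∈ (m.W k.2.1 ⊓ pre m.φ (n.W k.2.2)) ⊓ (m.W l.2.1 ⊓ pre m.φ (n.W l.2.2)),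
      (x ∈ m.W k.2.1 ∧ m.φ x ∈ n.W k.2.2) ∧ (x ∈ m.W l.2.1 ∧ m.φ x ∈ n.W l.2.2) := fun _ h => h
    exact OneObj.H_add (Γ.H_post
      (OneObj.G_res m.φ (fun x h => (hl x h).2.2) (n.p_mem l.2.2))
      (OneObj.H_res (𝟙 a.X) (U := m.W k.2.1 ⊓ m.W l.2.1)
        (fun x h => ⟨(hl x h).1.1, (hl x h).2.1⟩) (m.e_mem k.2.1 l.2.1)))
      (Γ.H_pre (OneObj.H_res m.φ (U := n.W k.2.2 ⊓ n.W l.2.2)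
        (fun x h => ⟨(hl x h).1.2, (hl x h).2.2⟩) (n.e_mem k.2.2 l.2.2))
      (OneObj.G_res (𝟙 a.X) (fun x h => (hl x h).1.1) (m.p_mem k.2.1)))

/-- An index of a composition. -/
abbrev cm {m : a.Hom b} {n : b.Hom c} {x i i' i''} (k : m.Fib x i i')
    (k' : n.Fib (m.φ x) i' i'') : (m.comp n).Fib x i i'' := ⟨⟨i', k.1, k'.1⟩, k.2, k'.2⟩

lemma exists_fib (m : a.Hom b) {x i i'} (h : x ∈ a.U i) (h' : m.φ x ∈ b.U i') :
    ∃ _ : m.Fib x i i', True := by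
  obtain ⟨k, hk⟩ := m.cov h h'
  exact ⟨⟨k, hk⟩, trivial⟩

lemma p_congr (m : a.Hom b) {x y : a.X} (h : x = y) {i i'} {k : m.K i i'} (hk hk') :
    m.p x ⟨k, hk⟩ = m.p y ⟨k, hk'⟩ := by subst h; rfl

lemma e_congr (m : a.Hom b) {x y : a.X} (h : x = y) {i i' j j'} {k : m.K i i'} {l : m.K j j'}
    (hk hk' hl hl') : m.e x ⟨k, hk⟩ ⟨l, hl⟩ = m.e y ⟨k, hk'⟩ ⟨l, hl'⟩ := by subst h; rfl

end Hom

lemma Hom₂.df_eq {m m' : a.Hom b} (s : Hom₂ m m') (x : a.X) {i i' j j'} (k : m.Fib x i i')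
    (k' : m'.Fib x i i') (l : m.Fib x j j') (l' : m'.Fib x j j') :
    df m m' x k k' l l' (s.t x k k') (s.t x l l') = 0 :=
  sub_eq_zero.2 (s.comm x k k' l l')

lemma Hom₂.base_apply {m m' : a.Hom b} (s : Hom₂ m m') (x : a.X) : m.φ x = m'.φ x :=
  congrArg (fun f => f.1 x) s.base

lemma whiskerLeft_comm (f : a.Hom b) {g h : b.Hom c} (s : Hom₂ g h) {x i i' i'' j j' j''}
    (k : f.Fib x i i') (l : f.Fib x j j') (kg : g.Fib (f.φ x) i' i'') (lg : g.Fib (f.φ x) j' j'')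
    (kh : h.Fib (f.φ x) i' i'') (lh : h.Fib (f.φ x) j' j'') :
    Γ.post (h.p _ lh) (f.e x k l) + Γ.pre (h.e _ kh lh) (f.p x k) +
      Γ.pre (Γ.pre (s.t _ lg lh) (f.p x l)) (a.g x (f.l k) (f.l l)) =
    Γ.post (c.g (g.φ (f.φ x)) (g.r kg) (g.r lg)) (Γ.pre (s.t _ kg kh) (f.p x k)) +
      (Γ.post (g.p _ lg) (f.e x k l) + Γ.pre (g.e _ kg lg) (f.p x k)) := by
  have h1 := congrArg (fun z => Γ.pre z (f.p x k)) (s.comm _ kg kh lg lh)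
  have h2 := Γ.exch (f.rel_e x k l) (s.rel_t _ lg lh)
  simp only [Γ.pre_add, Γ.pre_post, Γ.pre_mul] at *
  linear_combination (norm := abel) h1 - h2

lemma whiskerRight_comm {f g : a.Hom b} (s : Hom₂ f g) (h : b.Hom c) {x i i' i'' j j' j''}
    (k : f.Fib x i i') (l : f.Fib x j j') (kg : g.Fib x i i') (lg : g.Fib x j j')
    {kh : h.K i' i''} {lh : h.K j' j''} (hk : f.φ x ∈ h.W kh) (hl : f.φ x ∈ h.W lh)
    (hk' : g.φ x ∈ h.W kh) (hl' : g.φ x ∈ h.W lh) :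
    Γ.post (h.p (g.φ x) ⟨lh, hl'⟩) (g.e x kg lg) +
      Γ.pre (h.e (g.φ x) ⟨kh, hk'⟩ ⟨lh, hl'⟩) (g.p x kg) +
      Γ.pre (Γ.post (h.p (f.φ x) ⟨lh, hl⟩) (s.t x l lg)) (a.g x (f.l k) (f.l l)) =
    Γ.post (c.g (h.φ (f.φ x)) (h.r ⟨kh, hk⟩) (h.r ⟨lh, hl⟩))
        (Γ.post (h.p (f.φ x) ⟨kh, hk⟩) (s.t x k kg)) +
      (Γ.post (h.p (f.φ x) ⟨lh, hl⟩) (f.e x k l) +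
        Γ.pre (h.e (f.φ x) ⟨kh, hk⟩ ⟨lh, hl⟩) (f.p x k)) := by
  have h1 := congrArg (Γ.post (h.p (f.φ x) ⟨lh, hl⟩)) (s.comm x k kg l lg)
  have h2 := Γ.exch (s.rel_t x k kg) (h.rel_e (f.φ x) ⟨kh, hk⟩ ⟨lh, hl⟩)
  rw [h.p_congr (s.base_apply x).symm hl' hl, h.e_congr (s.base_apply x).symm hk' hk hl' hl]
  simp only [Γ.post_add, Γ.pre_post, Γ.post_mul] at *
  linear_combination (norm := abel) h1 + h2

lemma assoc_comm (f : a.Hom b) (g : b.Hom c) (h : c.Hom d) {x i i' i'' i₃ j j' j'' j₃}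
    (k : f.Fib x i i') (l : f.Fib x j j') (kg : g.Fib (f.φ x) i' i'') (lg : g.Fib (f.φ x) j' j'')
    (kh : h.Fib (g.φ (f.φ x)) i'' i₃) (lh : h.Fib (g.φ (f.φ x)) j'' j₃) :
    Γ.post (h.p _ lh * g.p _ lg) (f.e x k l) +
      Γ.pre (Γ.post (h.p _ lh) (g.e _ kg lg) + Γ.pre (h.e _ kh lh) (g.p _ kg)) (f.p x k) +
      Γ.pre 0 (a.g x (f.l k) (f.l l)) =
    Γ.post (d.g (h.φ (g.φ (f.φ x))) (h.r kh) (h.r lh)) 0 +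
      (Γ.post (h.p _ lh) (Γ.post (g.p _ lg) (f.e x k l) + Γ.pre (g.e _ kg lg) (f.p x k)) +
        Γ.pre (h.e _ kh lh) (g.p _ kg * f.p x k)) := by
  simp only [Γ.pre_add, Γ.post_add, Γ.pre_post, Γ.post_mul, Γ.pre_mul, Γ.pre_zero, Γ.post_zero]
  abel

lemma leftUnitor_comm (f : a.Hom b) {x i i' j j'} (k : f.Fib x i i') (l : f.Fib x j j') :
    f.e x k l + Γ.pre (Γ.post (f.p x l) (a.u x (f.l l))) (a.g x (f.l k) (f.l l)) =
    Γ.post (b.g (f.φ x) (f.r k) (f.r l)) (Γ.post (f.p x k) (a.u x (f.l k))) +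
      (Γ.post (f.p x l) (a.γ x (f.l k) (f.l l) (f.l l) - a.γ x (f.l k) (f.l k) (f.l l)) +
        Γ.pre (f.e x k l) (a.g x (f.l k) (f.l k))) := by
  have h1 := Γ.exch (a.rel_u x (f.l k)) (f.rel_e x k l)
  rw [γ_iij, γ_ijj]
  simp only [Γ.post_sub, Γ.pre_one, Γ.post_mul, Γ.pre_post] at *
  linear_combination (norm := abel) h1

lemma rightUnitor_comm (f : a.Hom b) {x i i' j j'} (k : f.Fib x i i') (l : f.Fib x j j') :
    f.e x k l + Γ.pre (Γ.pre (b.u (f.φ x) (f.r l)) (f.p x l)) (a.g x (f.l k) (f.l l)) =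
    Γ.post (b.g (f.φ x) (f.r k) (f.r l)) (Γ.pre (b.u (f.φ x) (f.r k)) (f.p x k)) +
      (Γ.post (b.g (f.φ x) (f.r l) (f.r l)) (f.e x k l) +
        Γ.pre (b.γ (f.φ x) (f.r k) (f.r l) (f.r l) - b.γ (f.φ x) (f.r k) (f.r k) (f.r l))
          (f.p x k)) := by
  have h1 := Γ.exch (f.rel_e x k l) (b.rel_u (f.φ x) (f.r l))
  rw [γ_iij, γ_ijj]
  simp only [Γ.pre_sub, Γ.post_one, Γ.pre_mul, Γ.pre_post] at *
  linear_combination (norm := abel) -h1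

namespace Ref

/-- The identity 2-morphism. -/
def id (m : a.Hom b) : Ref m m where
  base := rfl
  D := m.K
  V k := m.W k
  k d := d
  k' d := d
  V_k _ _ h := h
  V_k' _ _ h := h
  cov := m.cov
  t _ _ _ _ := 0
  rel_t _ _ _ _ := Γ.rel_zero _
  comm _ _ _ _ _ _ _ := by simp [df]
  t_mem _ := OneObj.H_zero

/-- Vertical composition. -/
def comp {m m' m'' : a.Hom b} (s : Hom₂ m m') (s' : Hom₂ m' m'') : Ref m m'' where
  base := s.base.trans s'.base
  D i i' := m.K i i' × m'.K i i' × m''.K i i'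
  V d := m.W d.1 ⊓ m'.W d.2.1 ⊓ m''.W d.2.2
  k d := d.1
  k' d := d.2.2
  V_k _ _ h := h.1.1
  V_k' _ _ h := h.2
  cov h h' := by
    obtain ⟨k, hk⟩ := m.cov h h'
    obtain ⟨k', hk'⟩ := m'.cov h (s.base_apply _ ▸ h')
    obtain ⟨k'', hk''⟩ := m''.cov h (s'.base_apply _ ▸ s.base_apply _ ▸ h')
    exact ⟨⟨k, k', k''⟩, ⟨hk, hk'⟩, hk''⟩
  t x _ _ d := s'.t x ⟨d.1.2.1, d.2.1.2⟩ ⟨d.1.2.2, d.2.2⟩ +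
    s.t x ⟨d.1.1, d.2.1.1⟩ ⟨d.1.2.1, d.2.1.2⟩
  rel_t x _ _ d := Γ.rel_add (s.rel_t x _ _) (s'.rel_t x _ _)
  comm x i i' j j' d d' := by
    have h1 := s.df_eq x ⟨d.1.1, d.2.1.1⟩ ⟨d.1.2.1, d.2.1.2⟩ ⟨d'.1.1, d'.2.1.1⟩
      ⟨d'.1.2.1, d'.2.1.2⟩
    have h2 := s'.df_eq x ⟨d.1.2.1, d.2.1.2⟩ ⟨d.1.2.2, d.2.2⟩ ⟨d'.1.2.1, d'.2.1.2⟩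
      ⟨d'.1.2.2, d'.2.2⟩
    simp only [df, Γ.pre_add, Γ.post_add] at *
    rw [g_congr (s.base_apply x).symm _ _ (m.W_r d.1.1 d.2.1.1) (m.W_r d'.1.1 d'.2.1.1)] at h2
    linear_combination (norm := abel) h1 + h2
  t_mem d := OneObj.H_add
    (OneObj.H_res (𝟙 a.X) (V := m.W d.1 ⊓ m'.W d.2.1 ⊓ m''.W d.2.2)
      (U := m'.W d.2.1 ⊓ m''.W d.2.2) (fun _ h => ⟨h.1.2, h.2⟩) (s'.t_mem d.2.1 d.2.2))
    (OneObj.H_res (𝟙 a.X) (V := m.W d.1 ⊓ m'.W d.2.1 ⊓ m''.W d.2.2)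
      (U := m.W d.1 ⊓ m'.W d.2.1) (fun _ h => ⟨h.1.1, h.1.2⟩) (s.t_mem d.1 d.2.1))

/-- Left whiskering. -/
def whiskerLeft (f : a.Hom b) {g h : b.Hom c} (s : Hom₂ g h) : Ref (f.comp g) (f.comp h) where
  base := congrArg (fun z => f.φ ≫ z) s.base
  D i i'' := Σ i', f.K i i' × g.K i' i'' × h.K i' i''
  V d := f.W d.2.1 ⊓ Coc.pre f.φ (g.W d.2.2.1 ⊓ h.W d.2.2.2)
  k d := ⟨d.1, d.2.1, d.2.2.1⟩
  k' d := ⟨d.1, d.2.1, d.2.2.2⟩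
  V_k _ _ h := ⟨h.1, h.2.1⟩
  V_k' _ _ h := ⟨h.1, h.2.2⟩
  cov {x i i''} hx hx' := by
    obtain ⟨i', hi'⟩ := b.cov (f.φ x)
    obtain ⟨k, hk⟩ := f.cov hx hi'
    obtain ⟨k', hk'⟩ := g.cov hi' hx'
    obtain ⟨k'', hk''⟩ := h.cov hi' (s.base_apply _ ▸ hx')
    exact ⟨⟨i', k, k', k''⟩, hk, hk', hk''⟩
  t x _ _ d := Γ.pre (s.t (f.φ x) ⟨d.1.2.2.1, d.2.2.1⟩ ⟨d.1.2.2.2, d.2.2.2⟩)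
    (f.p x ⟨d.1.2.1, d.2.1⟩)
  rel_t x _ _ d := Γ.rel_pre _ (s.rel_t _ _ _)
  comm x i i'' j j'' d d' := sub_eq_zero.2 (whiskerLeft_comm f s ⟨_, d.2.1⟩ ⟨_, d'.2.1⟩
    ⟨_, d.2.2.1⟩ ⟨_, d'.2.2.1⟩ ⟨_, d.2.2.2⟩ ⟨_, d'.2.2.2⟩)
  t_mem d := Γ.H_pre
    (OneObj.H_res f.φ (V := f.W d.2.1 ⊓ Coc.pre f.φ (g.W d.2.2.1 ⊓ h.W d.2.2.2))
      (fun _ h => h.2) (s.t_mem d.2.2.1 d.2.2.2))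
    (OneObj.G_res (𝟙 a.X) (V := f.W d.2.1 ⊓ Coc.pre f.φ (g.W d.2.2.1 ⊓ h.W d.2.2.2))
      (fun _ h => h.1) (f.p_mem d.2.1))

/-- Right whiskering. -/
def whiskerRight {f g : a.Hom b} (s : Hom₂ f g) (h : b.Hom c) : Ref (f.comp h) (g.comp h) where
  base := congrArg (fun z => z ≫ h.φ) s.base
  D i i'' := Σ i', f.K i i' × g.K i i' × h.K i' i''
  V d := f.W d.2.1 ⊓ g.W d.2.2.1 ⊓ Coc.pre f.φ (h.W d.2.2.2)
  k d := ⟨d.1, d.2.1, d.2.2.2⟩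
  k' d := ⟨d.1, d.2.2.1, d.2.2.2⟩
  V_k _ _ h := ⟨h.1.1, h.2⟩
  V_k' d x hx := ⟨hx.1.2, show g.φ x ∈ h.W d.2.2.2 from s.base_apply x ▸ hx.2⟩
  cov {x i i''} hx hx' := by
    obtain ⟨i', hi'⟩ := b.cov (f.φ x)
    obtain ⟨k, hk⟩ := f.cov hx hi'
    obtain ⟨k', hk'⟩ := g.cov hx (s.base_apply _ ▸ hi')
    obtain ⟨k'', hk''⟩ := h.cov hi' hx'
    exact ⟨⟨i', k, k', k''⟩, ⟨hk, hk'⟩, hk''⟩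
  t x _ _ d := Γ.post (h.p (f.φ x) ⟨d.1.2.2.2, d.2.2⟩)
    (s.t x ⟨d.1.2.1, d.2.1.1⟩ ⟨d.1.2.2.1, d.2.1.2⟩)
  rel_t x _ _ d := by
    have h1 := Γ.rel_post (h.p (f.φ x) ⟨d.1.2.2.2, d.2.2⟩)
      (s.rel_t x ⟨d.1.2.1, d.2.1.1⟩ ⟨d.1.2.2.1, d.2.1.2⟩)
    have h2 := h.p_congr (s.base_apply x) d.2.2 (show g.φ x ∈ h.W d.1.2.2.2 from
      s.base_apply x ▸ d.2.2)
    change Γ.rel _ (h.p (f.φ x) ⟨d.1.2.2.2, d.2.2⟩ * _) (h.p (g.φ x) ⟨d.1.2.2.2, _⟩ * _)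
    rw [← h2]
    exact h1
  comm x i i'' j j'' d d' := sub_eq_zero.2 (whiskerRight_comm s h ⟨_, d.2.1.1⟩ ⟨_, d'.2.1.1⟩
    ⟨_, d.2.1.2⟩ ⟨_, d'.2.1.2⟩ d.2.2 d'.2.2 _ _)
  t_mem d := Γ.H_post
    (OneObj.G_res f.φ (V := f.W d.2.1 ⊓ g.W d.2.2.1 ⊓ Coc.pre f.φ (h.W d.2.2.2))
      (fun _ h => h.2) (h.p_mem d.2.2.2))
    (OneObj.H_res (𝟙 a.X) (V := f.W d.2.1 ⊓ g.W d.2.2.1 ⊓ Coc.pre f.φ (h.W d.2.2.2))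
      (U := f.W d.2.1 ⊓ g.W d.2.2.1) (fun _ h => h.1) (s.t_mem d.2.1 d.2.2.1))

/-- The associator. -/
def assoc (f : a.Hom b) (g : b.Hom c) (h : c.Hom d) :
    Ref ((f.comp g).comp h) (f.comp (g.comp h)) where
  base := rfl
  D i i₃ := Σ i₁ i₂, f.K i i₁ × g.K i₁ i₂ × h.K i₂ i₃
  V q := f.W q.2.2.1 ⊓ Coc.pre f.φ (g.W q.2.2.2.1 ⊓ Coc.pre g.φ (h.W q.2.2.2.2))
  k q := ⟨q.2.1, ⟨q.1, q.2.2.1, q.2.2.2.1⟩, q.2.2.2.2⟩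
  k' q := ⟨q.1, q.2.2.1, ⟨q.2.1, q.2.2.2.1, q.2.2.2.2⟩⟩
  V_k _ _ h := ⟨⟨h.1, h.2.1⟩, h.2.2⟩
  V_k' _ _ h := ⟨h.1, h.2.1, h.2.2⟩
  cov {x i i''} hx hx' := by
    obtain ⟨i₁, h₁⟩ := b.cov (f.φ x)
    obtain ⟨i₂, h₂⟩ := c.cov (g.φ (f.φ x))
    obtain ⟨k, hk⟩ := f.cov hx h₁
    obtain ⟨k', hk'⟩ := g.cov h₁ h₂
    obtain ⟨k'', hk''⟩ := h.cov h₂ hx'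
    exact ⟨⟨i₁, i₂, k, k', k''⟩, hk, hk', hk''⟩
  t _ _ _ _ := 0
  rel_t x _ _ q := by
    simp only [Hom.comp, mul_assoc]
    exact Γ.rel_zero _
  comm x i i'' j j'' d d' := sub_eq_zero.2 (assoc_comm f g h ⟨_, d.2.1⟩ ⟨_, d'.2.1⟩
    ⟨_, d.2.2.1⟩ ⟨_, d'.2.2.1⟩ ⟨_, d.2.2.2⟩ ⟨_, d'.2.2.2⟩)
  t_mem _ := OneObj.H_zero

/-- The left unitor. -/
def leftUnitor (f : a.Hom b) : Ref ((Hom.id a).comp f) f where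
  base := rfl
  D i i' := f.K i i'
  V q := f.W q
  k {i _} q := ⟨i, (), q⟩
  k' q := q
  V_k q _ h := ⟨⟨f.W_l q h, f.W_l q h⟩, h⟩
  V_k' _ _ h := h
  cov := f.cov
  t x i _ q := Γ.post (f.p x q) (a.u x (f.l q))
  rel_t x i _ q := by
    have := Γ.rel_post (f.p x q) (a.rel_u x (f.l q))
    rwa [mul_one] at this
  comm x i i'' j j'' d d' := sub_eq_zero.2 (leftUnitor_comm f d d')
  t_mem {i i'} q := Γ.H_post (f.p_mem q)
    (OneObj.H_res (𝟙 a.X) (V := f.W q) (U := a.U i) (fun _ h => f.W_l q h) (a.u_mem i))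

/-- The right unitor. -/
def rightUnitor (f : a.Hom b) : Ref (f.comp (Hom.id b)) f where
  base := rfl
  D i i' := f.K i i'
  V q := f.W q
  k {_ i'} q := ⟨i', q, ()⟩
  k' q := q
  V_k q _ h := ⟨h, f.W_r q h, f.W_r q h⟩
  V_k' _ _ h := h
  cov := f.cov
  t x i _ q := Γ.pre (b.u (f.φ x) (f.r q)) (f.p x q)
  rel_t x i _ q := by
    have := Γ.rel_pre (f.p x q) (b.rel_u (f.φ x) (f.r q))
    rwa [one_mul] at this
  comm x i i'' j j'' d d' := sub_eq_zero.2 (rightUnitor_comm f d d')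
  t_mem {i i'} q := Γ.H_pre
    (OneObj.H_res f.φ (V := f.W q) (U := b.U i') (fun _ h => f.W_r q h) (b.u_mem i'))
    (f.p_mem q)

end Ref

/-- The inverse of a 2-morphism. -/
def Hom₂.symm {m m' : a.Hom b} (s : Hom₂ m m') : Hom₂ m' m where
  base := s.base.symm
  t x _ _ k k' := -s.t x k' k
  rel_t x _ _ k k' := Γ.rel_neg (s.rel_t x k' k)
  comm x _ _ _ _ k k' l l' := by
    have := s.comm x k' k l' l
    rw [g_congr (s.base_apply x) _ _ (m'.r k).2 (m'.r l).2] at this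
    simp only [Γ.pre_neg, Γ.post_neg]
    linear_combination (norm := abel) -this
  t_mem k k' := OneObj.H_neg
    (OneObj.H_res (𝟙 a.X) (V := m'.W k ⊓ m.W k') (U := m.W k' ⊓ m'.W k)
      (fun _ h => ⟨h.2, h.1⟩) (s.t_mem k' k))

end Coc
namespace Coc

variable {Γ : OneObj} {a b c d : Coc Γ}

instance : CategoryStruct (Coc Γ) where
  Hom := Hom
  id := Hom.id
  comp := Hom.comp

instance : Category (a ⟶ b) where
  Hom m m' := Hom₂ (Γ := Γ) (a := a) (b := b) m m'
  id m := (Ref.id m).hom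
  comp s s' := (Ref.comp s s').hom
  id_comp {m m'} s := Hom₂.ext' fun x i i' h h' => by
    obtain ⟨k, -⟩ := Hom.exists_fib m h h'
    obtain ⟨l, -⟩ := Hom.exists_fib m' h (s.base_apply x ▸ h')
    refine ⟨k, l, ((Ref.comp (Ref.id m).hom s).hom_t x ⟨⟨k.1, k.1, l.1⟩, ⟨k.2, k.2⟩, l.2⟩).trans ?_⟩
    simp only [Ref.comp]
    rw [show (Ref.id m).hom.t x ⟨k.1, _⟩ ⟨k.1, _⟩ = 0 from (Ref.id m).hom_t x k, add_zero]
  comp_id {m m'} s := Hom₂.ext' fun x i i' h h' => by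
    obtain ⟨k, -⟩ := Hom.exists_fib m h h'
    obtain ⟨l, -⟩ := Hom.exists_fib m' h (s.base_apply x ▸ h')
    refine ⟨k, l, ((Ref.comp s (Ref.id m').hom).hom_t x ⟨⟨k.1, l.1, l.1⟩, ⟨k.2, l.2⟩, l.2⟩).trans ?_⟩
    simp only [Ref.comp]
    rw [show (Ref.id m').hom.t x ⟨l.1, _⟩ ⟨l.1, _⟩ = 0 from (Ref.id m').hom_t x l, zero_add]
  assoc {m m' m'' m₃} s s' s'' := Hom₂.ext' fun x i i' h h' => by
    obtain ⟨k, -⟩ := Hom.exists_fib m h h'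
    obtain ⟨k', -⟩ := Hom.exists_fib m' h (s.base_apply x ▸ h')
    obtain ⟨k'', -⟩ := Hom.exists_fib m'' h (s'.base_apply x ▸ s.base_apply x ▸ h')
    obtain ⟨l, -⟩ := Hom.exists_fib m₃ h (s''.base_apply x ▸ s'.base_apply x ▸ s.base_apply x ▸ h')
    have e1 := (Ref.comp s s').hom_t x ⟨⟨k.1, k'.1, k''.1⟩, ⟨k.2, k'.2⟩, k''.2⟩
    have e2 := (Ref.comp s' s'').hom_t x ⟨⟨k'.1, k''.1, l.1⟩, ⟨k'.2, k''.2⟩, l.2⟩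
    have e3 := (Ref.comp (Ref.comp s s').hom s'').hom_t x
      ⟨⟨k.1, k''.1, l.1⟩, ⟨k.2, k''.2⟩, l.2⟩
    have e4 := (Ref.comp s (Ref.comp s' s'').hom).hom_t x
      ⟨⟨k.1, k'.1, l.1⟩, ⟨k.2, k'.2⟩, l.2⟩
    refine ⟨k, l, e3.trans (Eq.trans ?_ e4.symm)⟩
    exact (congrArg (_ + ·) e1).trans ((add_assoc ..).symm.trans (congrArg (· + _) e2.symm))

/-- Evaluation of the structural 2-morphisms. -/
lemma comp_t {m m' m'' : a ⟶ b} (s : m ⟶ m') (s' : m' ⟶ m'') {x i i'} (k : Hom.Fib m x i i')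
    (k' : Hom.Fib m' x i i') (k'' : Hom.Fib m'' x i i') :
    (s ≫ s').t x k k'' = s'.t x k' k'' + s.t x k k' :=
  (Ref.comp s s').hom_t x ⟨⟨k.1, k'.1, k''.1⟩, ⟨k.2, k'.2⟩, k''.2⟩

lemma id_t (m : a ⟶ b) {x i i'} (k : Hom.Fib m x i i') :
    Hom₂.t (𝟙 m : m ⟶ m) x k k = 0 := (Ref.id m).hom_t x k

lemma Hom₂.t_congr {m m' : a ⟶ b} (s : m ⟶ m') {x y : a.X} (h : x = y) {i i'} {k : m.K i i'}
    {k' : m'.K i i'} (hk hk' hl hl') : s.t x ⟨k, hk⟩ ⟨k', hl⟩ = s.t y ⟨k, hk'⟩ ⟨k', hl'⟩ := by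
  subst h; rfl

/-- 2-morphisms are invertible. -/
@[simps] def iso {m m' : a ⟶ b} (s : m ⟶ m') : m ≅ m' where
  hom := s
  inv := Hom₂.symm s
  hom_inv_id := Hom₂.ext' fun x i i' h h' => by
    obtain ⟨k, -⟩ := Hom.exists_fib m h h'
    obtain ⟨k', -⟩ := Hom.exists_fib m' h (s.base_apply x ▸ h')
    refine ⟨k, k, ?_⟩
    rw [comp_t s _ k k' k, id_t]
    exact neg_add_cancel _
  inv_hom_id := Hom₂.ext' fun x i i' h h' => by
    obtain ⟨k', -⟩ := Hom.exists_fib m' h h'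
    obtain ⟨k, -⟩ := Hom.exists_fib m h (s.base_apply x ▸ h')
    refine ⟨k', k', ?_⟩
    rw [comp_t _ s k' k k', id_t]
    exact add_neg_cancel _

/-- Whiskering, associators and unitors. -/
def wL (f : a ⟶ b) {g h : b ⟶ c} (s : g ⟶ h) : f ≫ g ⟶ f ≫ h := (Ref.whiskerLeft f s).hom

def wR {f g : a ⟶ b} (s : f ⟶ g) (h : b ⟶ c) : f ≫ h ⟶ g ≫ h := (Ref.whiskerRight s h).hom

def asc (f : a ⟶ b) (g : b ⟶ c) (h : c ⟶ d) : (f ≫ g) ≫ h ≅ f ≫ g ≫ h := iso (Ref.assoc f g h).hom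

def lun (f : a ⟶ b) : 𝟙 a ≫ f ≅ f := iso (Ref.leftUnitor f).hom

def run (f : a ⟶ b) : f ≫ 𝟙 b ≅ f := iso (Ref.rightUnitor f).hom

lemma wl_t (f : a ⟶ b) {g h : b ⟶ c} (s : g ⟶ h) {x i i' i''} (k : Hom.Fib f x i i')
    (kg : Hom.Fib g (f.φ x) i' i'') (kh : Hom.Fib h (f.φ x) i' i'') :
    (wL f s).t x (Hom.cm k kg) (Hom.cm k kh) = Γ.pre (s.t _ kg kh) (f.p x k) :=
  (Ref.whiskerLeft f s).hom_t x ⟨⟨i', k.1, kg.1, kh.1⟩, k.2, kg.2, kh.2⟩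

lemma wr_t {f g : a ⟶ b} (s : f ⟶ g) (h : b ⟶ c) {x i i' i''} (k : Hom.Fib f x i i')
    (k' : Hom.Fib g x i i') {q : h.K i' i''} (hq : f.φ x ∈ h.W q) (hq' : g.φ x ∈ h.W q) :
    (wR s h).t x (Hom.cm k ⟨q, hq⟩) (Hom.cm k' ⟨q, hq'⟩) =
      Γ.post (h.p (f.φ x) ⟨q, hq⟩) (s.t x k k') :=
  (Ref.whiskerRight s h).hom_t x ⟨⟨i', k.1, k'.1, q⟩, ⟨k.2, k'.2⟩, hq⟩

lemma asc_t (f : a ⟶ b) (g : b ⟶ c) (h : c ⟶ d) {x i i' i'' i₃} (k : Hom.Fib f x i i')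
    (kg : Hom.Fib g (f.φ x) i' i'') (kh : Hom.Fib h (g.φ (f.φ x)) i'' i₃) :
    (asc f g h).hom.t x (Hom.cm (Hom.cm k kg) kh) (Hom.cm k (Hom.cm kg kh)) = 0 :=
  (Ref.assoc f g h).hom_t x ⟨⟨i', i'', k.1, kg.1, kh.1⟩, k.2, kg.2, kh.2⟩

lemma asc_inv_t (f : a ⟶ b) (g : b ⟶ c) (h : c ⟶ d) {x i i' i'' i₃} (k : Hom.Fib f x i i')
    (kg : Hom.Fib g (f.φ x) i' i'') (kh : Hom.Fib h (g.φ (f.φ x)) i'' i₃) :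
    (asc f g h).inv.t x (Hom.cm k (Hom.cm kg kh)) (Hom.cm (Hom.cm k kg) kh) = 0 :=
  (congrArg Neg.neg (asc_t f g h k kg kh)).trans neg_zero

/-- An index of the identity 1-morphism. -/
abbrev di {x : a.X} {i : a.I} (h : x ∈ a.U i) : Hom.Fib (Hom.id a) x i i := ⟨(), h, h⟩

lemma lu_t (f : a ⟶ b) {x i i'} (k : Hom.Fib f x i i') :
    (lun f).hom.t x (Hom.cm (m := Hom.id a) (di (Hom.l f k).2) k) k =
      Γ.post (f.p x k) (a.u x (f.l k)) := (Ref.leftUnitor f).hom_t x k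

lemma ru_t (f : a ⟶ b) {x i i'} (k : Hom.Fib f x i i') :
    (run f).hom.t x (Hom.cm (n := Hom.id b) k (di (Hom.r f k).2)) k =
      Γ.pre (b.u (f.φ x) (f.r k)) (f.p x k) := (Ref.rightUnitor f).hom_t x k

end Coc
namespace Coc

variable {Γ : OneObj} {a b c d e : Coc Γ}

lemma u_congr {x y : b.X} (h : x = y) {i : b.I} (hi hi') :
    b.u x ⟨i, hi⟩ = b.u y ⟨i, hi'⟩ := by subst h; rfl

lemma ext₂ {m m' : a ⟶ b} {s t : m ⟶ m'}
    (h : ∀ x i i', x ∈ a.U i → Hom.φ m x ∈ b.U i' →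
      ∃ (k : Hom.Fib m x i i') (k' : Hom.Fib m' x i i'), Hom₂.t s x k k' = Hom₂.t t x k k') :
    s = t := Hom₂.ext' h

lemma exists_cm (f : a ⟶ b) (g : b ⟶ c) {x i i''} (h : x ∈ a.U i) (h' : g.φ (f.φ x) ∈ c.U i'') :
    ∃ i', ∃ _ : Hom.Fib f x i i', ∃ _ : Hom.Fib g (f.φ x) i' i'', True := by
  obtain ⟨i', hi'⟩ := b.cov (f.φ x)
  obtain ⟨k, -⟩ := Hom.exists_fib f h hi'
  obtain ⟨l, -⟩ := Hom.exists_fib g hi' h'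
  exact ⟨i', k, l, trivial⟩

lemma exists_fib' {f g : a ⟶ b} (s : f ⟶ g) {x i i'} (k : Hom.Fib f x i i') :
    ∃ _ : Hom.Fib g x i i', True :=
  Hom.exists_fib g (Hom.l f k).2 (s.base_apply x ▸ (Hom.r f k).2)

lemma comp₃_t {m₀ m₁ m₂ m₃ : a ⟶ b} (s : m₀ ⟶ m₁) (t : m₁ ⟶ m₂) (r : m₂ ⟶ m₃) {x i i' w}
    (k₀ : Hom.Fib m₀ x i i') (k₁ : Hom.Fib m₁ x i i') (k₂ : Hom.Fib m₂ x i i')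
    (k₃ : Hom.Fib m₃ x i i') (hs : s.t x k₀ k₁ = 0) (ht : t.t x k₁ k₂ = w) (hr : r.t x k₂ k₃ = 0) :
    (s ≫ t ≫ r).t x k₀ k₃ = w := by
  rw [comp_t _ _ _ k₁, comp_t _ _ _ k₂, hs, ht, hr, zero_add, add_zero]

lemma whiskerLeft_id (f : a ⟶ b) (g : b ⟶ c) : wL f (𝟙 g) = 𝟙 (f ≫ g) :=
  ext₂ fun x i i'' h h' => by
    obtain ⟨i', k, l, -⟩ := exists_cm f g h h'
    refine ⟨Hom.cm k l, Hom.cm k l, ?_⟩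
    rw [wl_t, id_t, id_t, Γ.pre_zero]

lemma whiskerLeft_comp (f : a ⟶ b) {g g' g'' : b ⟶ c} (s : g ⟶ g') (s' : g' ⟶ g'') :
    wL f (s ≫ s') = wL f s ≫ wL f s' :=
  ext₂ fun x i i'' h h' => by
    obtain ⟨i', k, l, -⟩ := exists_cm f g h h'
    obtain ⟨l', -⟩ := exists_fib' s l
    obtain ⟨l'', -⟩ := exists_fib' s' l'
    refine ⟨Hom.cm k l, Hom.cm k l'', ?_⟩
    rw [wl_t, comp_t _ _ l l', comp_t _ _ _ (Hom.cm k l'), wl_t, wl_t, Γ.pre_add]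

lemma id_whiskerLeft {f g : a ⟶ b} (s : f ⟶ g) : wL (𝟙 a) s = (lun f).hom ≫ s ≫ (lun g).inv :=
  ext₂ fun x i i' h h' => by
    obtain ⟨k, -⟩ := Hom.exists_fib f h h'
    obtain ⟨l, -⟩ := exists_fib' s k
    refine ⟨Hom.cm (m := Hom.id _) (di h) k, Hom.cm (m := Hom.id _) (di h) l, ?_⟩
    refine (wl_t (𝟙 a) s (di h) k l).trans (Eq.symm ?_)
    refine (comp_t _ _ _ k _).trans ((congrArg₂ (· + ·) (comp_t _ _ _ l _) (lu_t f k)).trans ?_)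
    refine (congrArg (fun z => -z + _ + _) (lu_t g l)).trans ?_
    have := Γ.exch (rel_u x ⟨i, h⟩) (s.rel_t x k l)
    simp only [Γ.pre_one] at this
    change _ = Γ.pre (s.t x k l) (a.g x ⟨i, h⟩ ⟨i, h⟩)
    linear_combination (norm := abel) this

lemma comp_whiskerLeft (f : a ⟶ b) (g : b ⟶ c) {h h' : c ⟶ d} (s : h ⟶ h') :
    wL (f ≫ g) s = (asc f g h).hom ≫ wL f (wL g s) ≫ (asc f g h').inv :=
  ext₂ fun x i i'' hi hi' => by
    obtain ⟨i₂, k, q, -⟩ := exists_cm (f ≫ g) h hi hi'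
    obtain ⟨i₁, k, l, -⟩ := exists_cm f g hi (Hom.l h q).2
    obtain ⟨q', -⟩ := exists_fib' s q
    refine ⟨Hom.cm (Hom.cm k l) q, Hom.cm (Hom.cm k l) q', ?_⟩
    refine Eq.symm (comp₃_t _ _ _ _ (Hom.cm k (Hom.cm l q)) (Hom.cm k (Hom.cm l q')) _
      (asc_t ..) ?_ (asc_inv_t ..))
    refine (wl_t f (wL g s) k (Hom.cm l q) (Hom.cm l q')).trans ?_
    refine (congrArg (Γ.pre · _) (wl_t g s l q q')).trans ?_
    exact (Γ.pre_mul ..).symm.trans (wl_t (f ≫ g) s (Hom.cm k l) q q').symm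

lemma id_whiskerRight (f : a ⟶ b) (g : b ⟶ c) : wR (𝟙 f) g = 𝟙 (f ≫ g) :=
  ext₂ fun x i i'' h h' => by
    obtain ⟨i', k, l, -⟩ := exists_cm f g h h'
    refine ⟨Hom.cm k l, Hom.cm k l, ?_⟩
    rw [wr_t _ _ _ _ l.2 l.2, id_t, id_t, Γ.post_zero]

lemma comp_whiskerRight {f f' f'' : a ⟶ b} (s : f ⟶ f') (s' : f' ⟶ f'') (g : b ⟶ c) :
    wR (s ≫ s') g = wR s g ≫ wR s' g :=
  ext₂ fun x i i'' h h' => by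
    obtain ⟨i', k, l, -⟩ := exists_cm f g h h'
    obtain ⟨k', -⟩ := exists_fib' s k
    obtain ⟨k'', -⟩ := exists_fib' s' k'
    have h1 : f'.φ x ∈ g.W l.1 := s.base_apply x ▸ l.2
    have h2 : f''.φ x ∈ g.W l.1 := s'.base_apply x ▸ h1
    refine ⟨Hom.cm k l, Hom.cm k'' ⟨l.1, h2⟩, ?_⟩
    rw [wr_t _ _ _ _ l.2 h2, comp_t _ _ k k', comp_t _ _ _ (Hom.cm k' ⟨l.1, h1⟩),
      wr_t _ _ _ _ l.2 h1, wr_t _ _ _ _ h1 h2, Γ.post_add,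
      ← g.p_congr (s.base_apply x) l.2 h1]

lemma whiskerRight_id {f g : a ⟶ b} (s : f ⟶ g) : wR s (𝟙 b) = (run f).hom ≫ s ≫ (run g).inv :=
  ext₂ fun x i i' h h' => by
    obtain ⟨k, -⟩ := Hom.exists_fib f h h'
    obtain ⟨l, -⟩ := exists_fib' s k
    refine ⟨Hom.cm (n := Hom.id _) k (di h'), Hom.cm (n := Hom.id _) l (di (Hom.r g l).2), ?_⟩
    refine (wr_t s (𝟙 b) k l (di h').2 (di (Hom.r g l).2).2).trans (Eq.symm ?_)
    refine (comp_t _ _ _ k _).trans ((congrArg₂ (· + ·) (comp_t _ _ _ l _) (ru_t f k)).trans ?_)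
    refine (congrArg (fun z => -z + _ + _) (ru_t g l)).trans ?_
    rw [u_congr (s.base_apply x).symm _ h']
    have := Γ.exch (s.rel_t x k l) (rel_u (f.φ x) ⟨i', h'⟩)
    simp only [Γ.post_one] at this
    change _ = Γ.post (b.g (f.φ x) ⟨i', h'⟩ ⟨i', h'⟩) (s.t x k l)
    linear_combination (norm := abel) -this

lemma whiskerRight_comp {f f' : a ⟶ b} (s : f ⟶ f') (g : b ⟶ c) (h : c ⟶ d) :
    wR s (g ≫ h) = (asc f g h).inv ≫ wR (wR s g) h ≫ (asc f' g h).hom :=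
  ext₂ fun x i i'' hi hi' => by
    obtain ⟨i₁, k, kl, -⟩ := exists_cm f (g ≫ h) hi hi'
    obtain ⟨i₂, l, q, -⟩ := exists_cm g h (Hom.r f k).2 hi'
    obtain ⟨k', -⟩ := exists_fib' s k
    have h1 : f'.φ x ∈ g.W l.1 := s.base_apply x ▸ l.2
    have h2 : g.φ (f'.φ x) ∈ h.W q.1 := s.base_apply x ▸ q.2
    refine ⟨Hom.cm k (Hom.cm l q), Hom.cm k' (Hom.cm ⟨l.1, h1⟩ ⟨q.1, h2⟩), ?_⟩
    refine (wr_t s (g ≫ h) k k' (Hom.cm l q).2 (Hom.cm ⟨l.1, h1⟩ ⟨q.1, h2⟩).2).trans (Eq.symm ?_)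
    refine comp₃_t _ _ _ _ (Hom.cm (Hom.cm k l) q) (Hom.cm (Hom.cm k' ⟨l.1, h1⟩) ⟨q.1, h2⟩) _
      (asc_inv_t ..) ?_ (asc_t ..)
    refine (wr_t (wR s g) h (Hom.cm k l) (Hom.cm k' ⟨l.1, h1⟩) q.2 h2).trans ?_
    exact (congrArg _ (wr_t s g k k' l.2 h1)).trans (Γ.post_mul ..).symm

lemma whisker_assoc (f : a ⟶ b) {g g' : b ⟶ c} (s : g ⟶ g') (h : c ⟶ d) :
    wR (wL f s) h = (asc f g h).hom ≫ wL f (wR s h) ≫ (asc f g' h).inv :=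
  ext₂ fun x i i'' hi hi' => by
    obtain ⟨i₂, k, q, -⟩ := exists_cm (f ≫ g) h hi hi'
    obtain ⟨i₁, k, l, -⟩ := exists_cm f g hi (Hom.l h q).2
    obtain ⟨l', -⟩ := exists_fib' s l
    have h1 : g'.φ (f.φ x) ∈ h.W q.1 := s.base_apply (f.φ x) ▸ q.2
    refine ⟨Hom.cm (Hom.cm k l) q, Hom.cm (Hom.cm k l') ⟨q.1, h1⟩, ?_⟩
    refine Eq.symm (comp₃_t _ _ _ _ (Hom.cm k (Hom.cm l q)) (Hom.cm k (Hom.cm l' ⟨q.1, h1⟩)) _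
      (asc_t ..) ((wl_t ..).trans (Eq.symm ?_)) (asc_inv_t ..))
    refine (wr_t (wL f s) h (Hom.cm k l) (Hom.cm k l') q.2 h1).trans ?_
    refine (congrArg _ (wl_t f s k l l')).trans ?_
    refine Eq.trans ?_ (congrArg (Γ.pre · _) (wr_t s h l l' q.2 h1)).symm
    exact (Γ.pre_post ..).symm

lemma whisker_exchange {f g : a ⟶ b} {h k : b ⟶ c} (s : f ⟶ g) (t : h ⟶ k) :
    wL f t ≫ wR s k = wR s h ≫ wL g t :=
  ext₂ fun x i i'' hi hi' => by
    obtain ⟨i₁, l, q, -⟩ := exists_cm f h hi hi'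
    obtain ⟨l', -⟩ := exists_fib' s l
    obtain ⟨q', -⟩ := exists_fib' t q
    have h1 : g.φ x ∈ h.W q.1 := s.base_apply x ▸ q.2
    have h2 : g.φ x ∈ k.W q'.1 := s.base_apply x ▸ q'.2
    refine ⟨Hom.cm l q, Hom.cm l' ⟨q'.1, h2⟩, ?_⟩
    rw [comp_t _ _ _ (Hom.cm l q'), comp_t _ _ _ (Hom.cm l' ⟨q.1, h1⟩), wl_t,
      wr_t _ _ _ _ q'.2 h2, wr_t _ _ _ _ q.2 h1, wl_t, ← t.t_congr (s.base_apply x) q.2 h1 q'.2 h2,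
      add_comm, add_comm (Γ.pre _ _)]
    have := Γ.exch (s.rel_t x l l') (t.rel_t _ q q')
    linear_combination (norm := abel) -this

lemma pentagon (f : a ⟶ b) (g : b ⟶ c) (h : c ⟶ d) (k : d ⟶ e) :
    wR (asc f g h).hom k ≫ (asc f (g ≫ h) k).hom ≫ wL f (asc g h k).hom =
      (asc (f ≫ g) h k).hom ≫ (asc f g (h ≫ k)).hom :=
  ext₂ fun x i i'' hi hi' => by
    obtain ⟨i₃, p₁, p₄, -⟩ := exists_cm ((f ≫ g) ≫ h) k hi hi'
    obtain ⟨i₂, p₁, p₃, -⟩ := exists_cm (f ≫ g) h hi (Hom.l k p₄).2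
    obtain ⟨i₁, p₁, p₂, -⟩ := exists_cm f g hi (Hom.l h p₃).2
    refine ⟨Hom.cm (Hom.cm (Hom.cm p₁ p₂) p₃) p₄, Hom.cm p₁ (Hom.cm p₂ (Hom.cm p₃ p₄)), ?_⟩
    refine (comp_t _ _ _ (Hom.cm (Hom.cm p₁ (Hom.cm p₂ p₃)) p₄) _).trans ?_
    refine Eq.trans ?_ (comp_t _ _ _ (Hom.cm (Hom.cm p₁ p₂) (Hom.cm p₃ p₄)) _).symm
    refine (congrArg (· + _) (comp_t _ _ _ (Hom.cm p₁ (Hom.cm (Hom.cm p₂ p₃) p₄)) _)).trans ?_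
    have e1 := (wr_t (asc f g h).hom k (Hom.cm (Hom.cm p₁ p₂) p₃) (Hom.cm p₁ (Hom.cm p₂ p₃))
      p₄.2 p₄.2).trans ((congrArg _ (asc_t f g h p₁ p₂ p₃)).trans (Γ.post_zero _))
    have e2 := (wl_t f (asc g h k).hom p₁ (Hom.cm (Hom.cm p₂ p₃) p₄)
      (Hom.cm p₂ (Hom.cm p₃ p₄))).trans ((congrArg (Γ.pre · _) (asc_t g h k p₂ p₃ p₄)).trans
        (Γ.pre_zero _))
    refine (congrArg₂ (· + ·) (congrArg₂ (· + ·) e2 (asc_t f (g ≫ h) k p₁ (Hom.cm p₂ p₃) p₄))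
      e1).trans ?_
    refine Eq.trans ?_ (congrArg₂ (· + ·) (asc_t f g (h ≫ k) p₁ p₂ (Hom.cm p₃ p₄))
      (asc_t (f ≫ g) h k (Hom.cm p₁ p₂) p₃ p₄)).symm
    exact add_zero _

lemma triangle (f : a ⟶ b) (g : b ⟶ c) :
    (asc f (𝟙 b) g).hom ≫ wL f (lun g).hom = wR (run f).hom g :=
  ext₂ fun x i i'' hi hi' => by
    obtain ⟨i₁, l, q, -⟩ := exists_cm f g hi hi'
    refine ⟨Hom.cm (Hom.cm (n := Hom.id b) l (di (Hom.r f l).2)) q, Hom.cm l q, ?_⟩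
    refine (comp_t _ _ _ (Hom.cm l (Hom.cm (m := Hom.id b) (di (Hom.r f l).2) q)) _).trans ?_
    refine (congrArg₂ (· + ·) (wl_t f (lun g).hom l
      (Hom.cm (m := Hom.id b) (di (Hom.r f l).2) q) q)
      (asc_t f (𝟙 b) g l (di (Hom.r f l).2) q)).trans ?_
    refine Eq.trans ?_ (wr_t (run f).hom g (Hom.cm (n := Hom.id b) l (di (Hom.r f l).2)) l
      q.2 q.2).symm
    refine (add_zero _).trans ((congrArg (Γ.pre · _) (lu_t g q)).trans ?_)
    exact (Γ.pre_post ..).trans (congrArg _ (ru_t f l)).symm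

/-- The bicategory of `Γ`-cocycles.  Together with the base manifolds, it is fibred over the
category of smooth manifolds; it is the 2-stack `Γ⁺` associated to `Γ`. -/
instance : Bicategory (Coc Γ) where
  whiskerLeft := wL
  whiskerRight := wR
  associator := asc
  leftUnitor := lun
  rightUnitor := run
  whiskerLeft_id := whiskerLeft_id
  whiskerLeft_comp := whiskerLeft_comp
  id_whiskerLeft := id_whiskerLeft
  comp_whiskerLeft := comp_whiskerLeft
  id_whiskerRight := id_whiskerRight
  comp_whiskerRight := comp_whiskerRight
  whiskerRight_id := whiskerRight_id
  whiskerRight_comp := whiskerRight_comp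
  whisker_assoc := whisker_assoc
  whisker_exchange := whisker_exchange
  pentagon := pentagon
  triangle := triangle

end Coc

/-- A weak morphism of presheaves of one-object bigroupoids: on 1-morphisms `c1`, on a 2-morphism
`h` with source `g` it is `c2 g h`, and the compositor is
`cc g₂ g₁ : c1 g₂ ∘ c1 g₁ ⟹ c1 (g₂ ∘ g₁)`; it is strictly unital and strictly compatible with
restriction (being given pointwise). -/
structure OneObj.Mor (Γ Γ' : OneObj) where
  c1 : Γ.B → Γ'.B
  c2 : Γ.B → Γ.A → Γ'.A
  cc : Γ.B → Γ.B → Γ'.A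
  rel_c2 : ∀ {h g g'}, Γ.rel h g g' → Γ'.rel (c2 g h) (c1 g) (c1 g')
  c2_zero : ∀ g, c2 g 0 = 0
  c2_add : ∀ {h h' g g' g''}, Γ.rel h g g' → Γ.rel h' g' g'' → c2 g (h' + h) = c2 g' h' + c2 g h
  rel_cc : ∀ g₂ g₁, Γ'.rel (cc g₂ g₁) (c1 g₂ * c1 g₁) (c1 (g₂ * g₁))
  cc_post : ∀ {h g g'} (k), Γ.rel h g g' →
    cc k g' + Γ'.post (c1 k) (c2 g h) = c2 (k * g) (Γ.post k h) + cc k g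
  cc_pre : ∀ {h g g'} (k), Γ.rel h g g' →
    cc g' k + Γ'.pre (c2 g h) (c1 k) = c2 (g * k) (Γ.pre h k) + cc g k
  cc_assoc : ∀ g₃ g₂ g₁, cc g₃ (g₂ * g₁) + Γ'.post (c1 g₃) (cc g₂ g₁) =
    cc (g₃ * g₂) g₁ + Γ'.pre (cc g₃ g₂) (c1 g₁)
  c1_one : c1 1 = 1
  cc_one : ∀ g, cc g 1 = 0
  one_cc : ∀ g, cc 1 g = 0
  c1_mem : ∀ {X : Mfd} {g : X → Γ.B}, g ∈ Γ.G X → (fun x => c1 (g x)) ∈ Γ'.G X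
  c2_mem : ∀ {X : Mfd} {g g' : X → Γ.B} {h : X → Γ.A}, g ∈ Γ.G X → g' ∈ Γ.G X → h ∈ Γ.H X →
    (∀ x, Γ.rel (h x) (g x) (g' x)) → (fun x => c2 (g x) (h x)) ∈ Γ'.H X
  cc_mem : ∀ {X : Mfd} {g g' : X → Γ.B}, g ∈ Γ.G X → g' ∈ Γ.G X →
    (fun x => cc (g x) (g' x)) ∈ Γ'.H X

namespace OneObj.Mor

open Coc

variable {Γ Γ' : OneObj} (C : OneObj.Mor Γ Γ') {a b c d : Coc Γ}

lemma c2_neg {h g g'} (hr : Γ.rel h g g') : C.c2 g' (-h) = - C.c2 g h := by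
  have := C.c2_add hr (Γ.rel_neg hr)
  rw [neg_add_cancel, C.c2_zero] at this
  exact eq_neg_of_add_eq_zero_left this.symm

/-- The induced map on cocycles. -/
def cobj (a : Coc Γ) : Coc Γ' where
  X := a.X
  I := a.I
  U := a.U
  cov := a.cov
  g x i j := C.c1 (a.g x i j)
  γ x i j k := C.c2 (a.g x j k * a.g x i j) (a.γ x i j k) + C.cc (a.g x j k) (a.g x i j)
  rel_γ x i j k := Γ'.rel_add (C.rel_cc _ _) (C.rel_c2 (a.rel_γ x i j k))
  coc x i j k l := by
    have h1 := C.cc_post (a.g x k l) (a.rel_γ x i j k)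
    have h2 := C.cc_pre (a.g x i j) (a.rel_γ x j k l)
    have h3 := C.cc_assoc (a.g x k l) (a.g x j k) (a.g x i j)
    have h4 := C.c2_add (Γ.rel_post (a.g x k l) (a.rel_γ x i j k)) (a.rel_γ x i k l)
    have h5 := C.c2_add (Γ.rel_pre (a.g x i j) (a.rel_γ x j k l)) (a.rel_γ x i j l)
    rw [a.coc, ← mul_assoc, h5] at h4
    simp only [Γ'.pre_add, Γ'.post_add, mul_assoc] at *
    linear_combination (norm := abel) h1 - h2 + h3 - h4
  g_mem i j := C.c1_mem (a.g_mem i j)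
  γ_mem i j k := by
    have h1 := OneObj.G_res (𝟙 a.X) (V := a.U i ⊓ a.U j ⊓ a.U k) (U := a.U j ⊓ a.U k)
      (fun _ h => ⟨h.1.2, h.2⟩)
      (a.g_mem j k)
    have h2 := OneObj.G_res (𝟙 a.X) (V := a.U i ⊓ a.U j ⊓ a.U k) (U := a.U i ⊓ a.U j)
      (fun _ h => ⟨h.1.1, h.1.2⟩)
      (a.g_mem i j)
    have h3 := OneObj.G_res (𝟙 a.X) (V := a.U i ⊓ a.U j ⊓ a.U k) (U := a.U i ⊓ a.U k)
      (fun _ h => ⟨h.1.1, h.2⟩)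
      (a.g_mem i k)
    exact OneObj.H_add (C.c2_mem (OneObj.G_mul h1 h2) h3 (a.γ_mem i j k) fun x => a.rel_γ x.1 _ _ _)
      (C.cc_mem h1 h2)

/-- The 2-morphisms `e` of the induced map. -/
abbrev cme (f : a.Hom b) {x i i' j j'} (k : f.Fib x i i') (l : f.Fib x j j') : Γ'.A :=
  -C.cc (b.g (f.φ x) (f.r k) (f.r l)) (f.p x k) +
    C.c2 (f.p x l * a.g x (f.l k) (f.l l)) (f.e x k l) + C.cc (f.p x l) (a.g x (f.l k) (f.l l))

lemma cmap_coh (f : a.Hom b) {x i i' j j' r r'} (k : f.Fib x i i') (l : f.Fib x j j')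
    (m : f.Fib x r r') :
    C.cme f k m + Γ'.post (C.c1 (f.p x m)) (C.c2 (a.g x (f.l l) (f.l m) * a.g x (f.l k) (f.l l))
        (a.γ x (f.l k) (f.l l) (f.l m)) + C.cc (a.g x (f.l l) (f.l m)) (a.g x (f.l k) (f.l l))) =
      Γ'.pre (C.c2 (b.g (f.φ x) (f.r l) (f.r m) * b.g (f.φ x) (f.r k) (f.r l))
          (b.γ (f.φ x) (f.r k) (f.r l) (f.r m)) +
        C.cc (b.g (f.φ x) (f.r l) (f.r m)) (b.g (f.φ x) (f.r k) (f.r l))) (C.c1 (f.p x k)) +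
      Γ'.post (C.c1 (b.g (f.φ x) (f.r l) (f.r m))) (C.cme f k l) +
      Γ'.pre (C.cme f l m) (C.c1 (a.g x (f.l k) (f.l l))) := by
  have h1 := C.cc_post (f.p x m) (a.rel_γ x (f.l k) (f.l l) (f.l m))
  have h2 := C.cc_assoc (f.p x m) (a.g x (f.l l) (f.l m)) (a.g x (f.l k) (f.l l))
  have h3 := C.cc_pre (f.p x k) (b.rel_γ (f.φ x) (f.r k) (f.r l) (f.r m))
  have h4 := C.cc_assoc (b.g (f.φ x) (f.r l) (f.r m)) (b.g (f.φ x) (f.r k) (f.r l)) (f.p x k)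
  have h5 := C.cc_post (b.g (f.φ x) (f.r l) (f.r m)) (f.rel_e x k l)
  have h6 := C.cc_assoc (b.g (f.φ x) (f.r l) (f.r m)) (f.p x l) (a.g x (f.l k) (f.l l))
  have h7 := C.cc_pre (a.g x (f.l k) (f.l l)) (f.rel_e x l m)
  have r1 := Γ.rel_post (f.p x m) (a.rel_γ x (f.l k) (f.l l) (f.l m))
  have r2 := Γ.rel_pre (f.p x k) (b.rel_γ (f.φ x) (f.r k) (f.r l) (f.r m))
  have r3 := Γ.rel_post (b.g (f.φ x) (f.r l) (f.r m)) (f.rel_e x k l)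
  have r4 := Γ.rel_pre (a.g x (f.l k) (f.l l)) (f.rel_e x l m)
  simp only [mul_assoc] at r1 r2 r3 r4
  have h8 := C.c2_add r1 (f.rel_e x k m)
  have h9 := C.c2_add r4 (Γ.rel_add r3 r2)
  have h10 := C.c2_add r3 r2
  rw [f.coh x k l m] at h8
  simp only [cme, Γ'.pre_add, Γ'.post_add, Γ'.pre_neg, Γ'.post_neg, mul_assoc] at *
  linear_combination (norm := abel) h1 + h2 - h3 + h4 - h5 - h6 - h7 - h8 + h9 + h10

/-- The induced map on 1-morphisms of cocycles. -/
def cmap (f : a.Hom b) : (C.cobj a).Hom (C.cobj b) where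
  φ := f.φ
  K := f.K
  W := f.W
  W_l := f.W_l
  W_r := f.W_r
  cov := f.cov
  p _ _ _ k := C.c1 (f.p _ k)
  e x _ _ _ _ k l := C.cme f k l
  rel_e x _ _ _ _ k l := by
    have h := Γ'.rel_add (Γ'.rel_add (C.rel_cc (f.p x l) (a.g x (f.l k) (f.l l)))
      (C.rel_c2 (f.rel_e x k l))) (Γ'.rel_neg (C.rel_cc (b.g (f.φ x) (f.r k) (f.r l)) (f.p x k)))
    rw [← add_assoc] at h
    exact h
  coh _ _ _ _ _ _ _ k l m := C.cmap_coh f k l m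
  p_mem k := C.c1_mem (f.p_mem k)
  e_mem {i i' j j'} k l := by
    have h1 := OneObj.G_res (𝟙 a.X) (V := f.W k ⊓ f.W l) (fun _ h => h.1) (f.p_mem k)
    have h2 := OneObj.G_res (𝟙 a.X) (V := f.W k ⊓ f.W l) (fun _ h => h.2) (f.p_mem l)
    have h3 := OneObj.G_res (𝟙 a.X) (V := f.W k ⊓ f.W l)
      (U := a.U i ⊓ a.U j) (fun _ h => ⟨f.W_l k h.1, f.W_l l h.2⟩) (a.g_mem i j)
    have h4 := OneObj.G_res f.φ (V := f.W k ⊓ f.W l)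
      (U := b.U i' ⊓ b.U j') (fun _ h => ⟨f.W_r k h.1, f.W_r l h.2⟩) (b.g_mem i' j')
    exact OneObj.H_add (OneObj.H_add (OneObj.H_neg (C.cc_mem h4 h1))
      (C.c2_mem (OneObj.G_mul h2 h3) (OneObj.G_mul h4 h1) (f.e_mem k l)
        fun x => f.rel_e x.1 _ _)) (C.cc_mem h2 h3)

lemma cmap₂_comm {f g : a.Hom b} (s : Hom₂ f g) {x i i' j j'} (k : f.Fib x i i')
    (k' : g.Fib x i i') (l : f.Fib x j j') (l' : g.Fib x j j') :
    C.cme g k' l' + Γ'.pre (C.c2 (f.p x l) (s.t x l l')) (C.c1 (a.g x (f.l k) (f.l l))) =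
      Γ'.post (C.c1 (b.g (f.φ x) (f.r k) (f.r l))) (C.c2 (f.p x k) (s.t x k k')) + C.cme f k l := by
  have h1 := C.cc_pre (a.g x (f.l k) (f.l l)) (s.rel_t x l l')
  have h2 := C.cc_post (b.g (f.φ x) (f.r k) (f.r l)) (s.rel_t x k k')
  have r2 := g.rel_e x k' l'
  rw [g_congr (s.base_apply x).symm (g.W_r _ k'.2) (g.W_r _ l'.2) (f.W_r _ k.2) (f.W_r _ l.2)]
    at r2
  have h3 := C.c2_add (Γ.rel_pre (a.g x (f.l k) (f.l l)) (s.rel_t x l l')) r2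
  have h4 := C.c2_add (f.rel_e x k l)
    (Γ.rel_post (b.g (f.φ x) (f.r k) (f.r l)) (s.rel_t x k k'))
  have h5 := s.comm x k k' l l'
  rw [h5, h4] at h3
  simp only [cme]
  rw [g_congr (s.base_apply x).symm (g.W_r _ k'.2) (g.W_r _ l'.2) (f.W_r _ k.2) (f.W_r _ l.2)]
  linear_combination (norm := abel) h1 - h2 - h3

/-- The induced map on 2-morphisms of cocycles. -/
def cmap₂ {f g : a.Hom b} (s : Hom₂ f g) : Hom₂ (C.cmap f) (C.cmap g) where
  base := s.base
  t x _ _ k k' := C.c2 (f.p x k) (s.t x k k')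
  rel_t x _ _ k k' := C.rel_c2 (s.rel_t x k k')
  comm _ _ _ _ _ k k' l l' := C.cmap₂_comm s k k' l l'
  t_mem k k' := C.c2_mem
    (OneObj.G_res (𝟙 a.X) (V := f.W k ⊓ g.W k') (fun _ h => h.1) (f.p_mem k))
    (OneObj.G_res (𝟙 a.X) (V := f.W k ⊓ g.W k') (fun _ h => h.2) (g.p_mem k'))
    (s.t_mem k k') fun x => s.rel_t x.1 _ _

/-- The unit constraint; its components are identities. -/
def cid (a : Coc Γ) : Ref (C.cmap (Hom.id a)) (Hom.id (C.cobj a)) where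
  base := rfl
  D := (Hom.id a).K
  V q := (Hom.id a).W q
  k q := q
  k' q := q
  V_k _ _ h := h
  V_k' _ _ h := h
  cov := (Hom.id a).cov
  t _ _ _ _ := 0
  rel_t _ _ _ _ := Γ'.rel_zero _
  comm x i i' j j' k l := by
    let i₁ : {i // x ∈ a.U i} := ⟨i, k.2.1⟩
    let i₂ : {i // x ∈ a.U i} := ⟨i', k.2.2⟩
    let j₁ : {i // x ∈ a.U i} := ⟨j, l.2.1⟩
    let j₂ : {i // x ∈ a.U i} := ⟨j', l.2.2⟩
    have h1 := C.c2_add (a.rel_γ x i₁ j₁ j₂) (Γ.rel_neg (a.rel_γ x i₁ i₂ j₂))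
    rw [C.c2_neg (a.rel_γ x i₁ i₂ j₂), neg_add_eq_sub] at h1
    refine sub_eq_zero.2 ?_
    change C.c2 (a.g x j₁ j₂ * a.g x i₁ j₁) (a.γ x i₁ j₁ j₂) + C.cc (a.g x j₁ j₂) (a.g x i₁ j₁) -
      (C.c2 (a.g x i₂ j₂ * a.g x i₁ i₂) (a.γ x i₁ i₂ j₂) + C.cc (a.g x i₂ j₂) (a.g x i₁ i₂)) +
      Γ'.pre 0 (C.c1 (a.g x i₁ j₁)) = Γ'.post (C.c1 (a.g x i₂ j₂)) 0 +
      (-C.cc (a.g x i₂ j₂) (a.g x i₁ i₂) + C.c2 (a.g x j₁ j₂ * a.g x i₁ j₁)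
        (a.γ x i₁ j₁ j₂ - a.γ x i₁ i₂ j₂) + C.cc (a.g x j₁ j₂) (a.g x i₁ j₁))
    simp only [Γ'.pre_zero, Γ'.post_zero]
    linear_combination (norm := abel) -h1
  t_mem _ := OneObj.H_zero

lemma ccomp_comm (f : a.Hom b) (g : b.Hom c) {x i i' i'' j j' j''}
    (k : f.Fib x i i') (l : f.Fib x j j') (kg : g.Fib (f.φ x) i' i'') (lg : g.Fib (f.φ x) j' j'') :
    Γ'.post (C.c1 (g.p _ lg)) (C.cme f k l) + Γ'.pre (C.cme g kg lg) (C.c1 (f.p x k)) +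
      Γ'.pre (-C.cc (g.p _ lg) (f.p x l)) (C.c1 (a.g x (f.l k) (f.l l))) =
    Γ'.post (C.c1 (c.g (g.φ (f.φ x)) (g.r kg) (g.r lg))) (-C.cc (g.p _ kg) (f.p x k)) +
      (-C.cc (c.g (g.φ (f.φ x)) (g.r kg) (g.r lg)) (g.p _ kg * f.p x k) +
        C.c2 (g.p _ lg * f.p x l * a.g x (f.l k) (f.l l))
          (Γ.post (g.p _ lg) (f.e x k l) + Γ.pre (g.e _ kg lg) (f.p x k)) +
        C.cc (g.p _ lg * f.p x l) (a.g x (f.l k) (f.l l))) := by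
  have h1 := C.cc_assoc (g.p _ lg) (f.p x l) (a.g x (f.l k) (f.l l))
  have h2 := C.cc_assoc (c.g _ (g.r kg) (g.r lg)) (g.p _ kg) (f.p x k)
  have h3 := C.cc_assoc (g.p _ lg) (b.g _ (f.r k) (f.r l)) (f.p x k)
  have h4 := C.cc_post (g.p _ lg) (f.rel_e x k l)
  have h5 := C.cc_pre (f.p x k) (g.rel_e _ kg lg)
  have r1 := Γ.rel_post (g.p _ lg) (f.rel_e x k l)
  have r2 := Γ.rel_pre (f.p x k) (g.rel_e _ kg lg)
  rw [mul_assoc] at r2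
  have h6 := C.c2_add r1 r2
  rw [add_comm (Γ.pre _ _)] at h6
  simp only [cme, Γ'.pre_add, Γ'.post_add, Γ'.pre_neg, Γ'.post_neg, mul_assoc] at *
  linear_combination (norm := abel) h1 + h2 - h3 + h4 + h5 - h6

/-- The compositor constraint. -/
def ccomp (f : a.Hom b) (g : b.Hom c) :
    Ref (C.cmap (f.comp g)) ((C.cmap f).comp (C.cmap g)) where
  base := rfl
  D := (f.comp g).K
  V q := (f.comp g).W q
  k q := q
  k' q := q
  V_k _ _ h := h
  V_k' _ _ h := h
  cov := (f.comp g).cov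
  t x _ _ q := -C.cc (g.p (f.φ x) ⟨q.1.2.2, q.2.2⟩) (f.p x ⟨q.1.2.1, q.2.1⟩)
  rel_t _ _ _ _ := Γ'.rel_neg (C.rel_cc _ _)
  comm _ _ _ _ _ q q' := sub_eq_zero.2 (C.ccomp_comm f g ⟨_, q.2.1⟩ ⟨_, q'.2.1⟩
    ⟨_, q.2.2⟩ ⟨_, q'.2.2⟩)
  t_mem q := OneObj.H_neg (C.cc_mem
    (OneObj.G_res f.φ (V := (f.comp g).W q) (fun _ h => h.2) (g.p_mem q.2.2))
    (OneObj.G_res (𝟙 a.X) (V := (f.comp g).W q) (fun _ h => h.1) (f.p_mem q.2.1)))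

end OneObj.Mor
namespace OneObj.Mor

open Coc Bicategory

variable {Γ Γ' : OneObj} (C : OneObj.Mor Γ Γ') {a b c d : Coc Γ}

lemma cobj_u (x : a.X) (i : {i // x ∈ a.U i}) : (C.cobj a).u x i = C.c2 (a.g x i i) (a.u x i) := by
  apply Γ'.pre_inj (g := C.c1 (a.g x i i))
  have h1 := C.cc_pre (a.g x i i) (a.rel_u x i)
  rw [C.one_cc, zero_add, a.pre_u] at h1
  rw [h1]
  exact (C.cobj a).pre_u x i

lemma cid_t {x i i'} (k : (Hom.id a).Fib x i i') : (C.cid a).hom.t x k k = 0 :=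
  (C.cid a).hom_t x k

lemma ccomp_t (f : a.Hom b) (g : b.Hom c) {x i i' i''} (k : f.Fib x i i')
    (kg : g.Fib (f.φ x) i' i'') : (C.ccomp f g).hom.t x (Hom.cm k kg)
      (Hom.cm (m := C.cmap f) (n := C.cmap g) k kg) = -C.cc (g.p (f.φ x) kg) (f.p x k) :=
  (C.ccomp f g).hom_t x (Hom.cm k kg)

/-- The action of the induced functor on 1-morphisms. -/
def cm1 (f : a ⟶ b) : C.cobj a ⟶ C.cobj b := C.cmap f

/-- The action of the induced functor on 2-morphisms. -/
def cm2 {f g : a ⟶ b} (s : f ⟶ g) : C.cm1 f ⟶ C.cm1 g := C.cmap₂ s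

/-- The unit constraint of the induced functor. -/
def cId (a : Coc Γ) : C.cm1 (𝟙 a) ≅ 𝟙 (C.cobj a) := iso (C.cid a).hom

/-- The compositor constraint of the induced functor. -/
def cComp (f : a ⟶ b) (g : b ⟶ c) : C.cm1 (f ≫ g) ≅ C.cm1 f ≫ C.cm1 g := iso (C.ccomp f g).hom

lemma map₂_id (f : a ⟶ b) : C.cm2 (𝟙 f) = 𝟙 (C.cm1 f) :=
  ext₂ fun x i i' h h' => by
    obtain ⟨k, -⟩ := Hom.exists_fib f h h'
    refine ⟨k, k, Eq.trans ?_ (id_t (C.cm1 f) (x := x) k).symm⟩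
    exact (congrArg _ (id_t f k)).trans (C.c2_zero _)

lemma map₂_comp {f g h : a ⟶ b} (s : f ⟶ g) (t : g ⟶ h) :
    C.cm2 (s ≫ t) = C.cm2 s ≫ C.cm2 t :=
  ext₂ fun x i i' hi hi' => by
    obtain ⟨k, -⟩ := Hom.exists_fib f hi hi'
    obtain ⟨k', -⟩ := exists_fib' s k
    obtain ⟨k'', -⟩ := exists_fib' t k'
    refine ⟨k, k'', Eq.trans ?_ (comp_t (C.cm2 s) (C.cm2 t) (x := x) k k' k'').symm⟩
    exact (congrArg _ (comp_t s t k k' k'')).trans (C.c2_add (s.rel_t x k k') (t.rel_t x k' k''))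

lemma map₂_whisker_left (f : a ⟶ b) {g h : b ⟶ c} (s : g ⟶ h) :
    C.cm2 (f ◁ s) = (C.cComp f g).hom ≫ (C.cm1 f) ◁ (C.cm2 s) ≫ (C.cComp f h).inv :=
  ext₂ fun x i i'' hi hi' => by
    obtain ⟨i', k, q, -⟩ := exists_cm f g hi hi'
    obtain ⟨q', -⟩ := exists_fib' s q
    refine ⟨Hom.cm k q, Hom.cm k q', ?_⟩
    refine (congrArg (C.c2 _) (wl_t f s k q q')).trans (Eq.symm ?_)
    refine (comp_t (C.cComp f g).hom ((C.cm1 f) ◁ (C.cm2 s) ≫ (C.cComp f h).inv) (x := x)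
      (Hom.cm k q) (Hom.cm (m := C.cmap f) (n := C.cmap g) k q) (Hom.cm k q')).trans ?_
    refine (congrArg₂ (· + ·) ((comp_t ((C.cm1 f) ◁ (C.cm2 s)) (C.cComp f h).inv (x := x)
      _ (Hom.cm (m := C.cmap f) (n := C.cmap h) k q') _).trans (congrArg₂ (· + ·)
      (congrArg Neg.neg (C.ccomp_t f h k q')) (wl_t (C.cm1 f) (C.cm2 s) (x := x) k q q')))
      (C.ccomp_t f g k q)).trans ?_
    have := C.cc_pre (f.p x k) (s.rel_t _ q q')
    change - -C.cc _ _ + Γ'.pre (C.c2 (g.p (f.φ x) q) (s.t (f.φ x) q q')) (C.c1 (f.p x k)) +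
      -C.cc _ _ = C.c2 (_ * _) _
    linear_combination (norm := abel) this

lemma map₂_whisker_right {f g : a ⟶ b} (s : f ⟶ g) (h : b ⟶ c) :
    C.cm2 (s ▷ h) = (C.cComp f h).hom ≫ (C.cm2 s) ▷ (C.cm1 h) ≫ (C.cComp g h).inv :=
  ext₂ fun x i i'' hi hi' => by
    obtain ⟨i', k, q, -⟩ := exists_cm f h hi hi'
    obtain ⟨k', -⟩ := exists_fib' s k
    have h1 : g.φ x ∈ h.W q.1 := s.base_apply x ▸ q.2
    refine ⟨Hom.cm k q, Hom.cm k' ⟨q.1, h1⟩, ?_⟩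
    refine (congrArg (C.c2 _) (wr_t s h k k' q.2 h1)).trans (Eq.symm ?_)
    refine (comp_t (C.cComp f h).hom ((C.cm2 s) ▷ (C.cm1 h) ≫ (C.cComp g h).inv) (x := x)
      (Hom.cm k q) (Hom.cm (m := C.cmap f) (n := C.cmap h) k q) (Hom.cm k' ⟨q.1, h1⟩)).trans ?_
    refine (congrArg₂ (· + ·) ((comp_t ((C.cm2 s) ▷ (C.cm1 h)) (C.cComp g h).inv (x := x)
      _ (Hom.cm (m := C.cmap g) (n := C.cmap h) k' ⟨q.1, h1⟩) _).trans (congrArg₂ (· + ·)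
      (congrArg Neg.neg (C.ccomp_t g h k' ⟨q.1, h1⟩))
      (wr_t (C.cm2 s) (C.cm1 h) (x := x) k k' q.2 h1)))
      (C.ccomp_t f h k q)).trans ?_
    rw [← h.p_congr (s.base_apply x) q.2 h1]
    have := C.cc_post (h.p _ q) (s.rel_t x k k')
    change - -C.cc _ _ + Γ'.post (C.c1 (h.p (f.φ x) q)) (C.c2 _ _) + -C.cc _ _ = C.c2 (_ * _) _
    linear_combination (norm := abel) this

lemma map₂_left_unitor (f : a ⟶ b) : C.cm2 (λ_ f).hom =
    (C.cComp (𝟙 a) f).hom ≫ (C.cId a).hom ▷ (C.cm1 f) ≫ (λ_ (C.cm1 f)).hom :=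
  ext₂ fun x i i' hi hi' => by
    obtain ⟨k, -⟩ := Hom.exists_fib f hi hi'
    refine ⟨Hom.cm (m := Hom.id a) (di hi) k, k, ?_⟩
    refine (congrArg (C.c2 _) (lu_t f k)).trans (Eq.symm ?_)
    refine (comp_t (C.cComp (𝟙 a) f).hom ((C.cId a).hom ▷ (C.cm1 f) ≫ (λ_ (C.cm1 f)).hom)
      (x := x) (Hom.cm (m := Hom.id a) (di hi) k)
      (Hom.cm (m := C.cmap (Hom.id a)) (n := C.cmap f) (di hi) k) k).trans ?_
    refine (congrArg₂ (· + ·) ((comp_t ((C.cId a).hom ▷ (C.cm1 f)) (λ_ (C.cm1 f)).hom (x := x)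
      _ (Hom.cm (m := Hom.id (C.cobj a)) (n := C.cmap f) (di hi) k) k).trans (congrArg₂ (· + ·)
      (lu_t (C.cm1 f) (x := x) k)
      (wr_t (C.cId a).hom (C.cm1 f) (x := x) (di hi) (di hi) k.2 k.2)))
      (C.ccomp_t (𝟙 a) f (di hi) k)).trans ?_
    have h0 : (C.cId a).hom.t x (i := i) (i' := i) (di hi) (di hi) = 0 := C.cid_t (di hi)
    refine (congrArg₂ (fun z w => Γ'.post (C.c1 (f.p x k)) z + Γ'.post (C.c1 (f.p x k)) w + _)
      (C.cobj_u x ⟨i, hi⟩) h0).trans ?_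
    rw [Γ'.post_zero, add_zero]
    have := C.cc_post (f.p x k) (a.rel_u x ⟨i, hi⟩)
    rw [C.cc_one, zero_add] at this
    change Γ'.post (C.c1 _) (C.c2 _ _) + -C.cc (f.p x k) (a.g x ⟨i, hi⟩ ⟨i, hi⟩) =
      C.c2 (f.p x k * a.g x ⟨i, hi⟩ ⟨i, hi⟩) _
    linear_combination (norm := abel) this

lemma map₂_right_unitor (f : a ⟶ b) : C.cm2 (ρ_ f).hom =
    (C.cComp f (𝟙 b)).hom ≫ (C.cm1 f) ◁ (C.cId b).hom ≫ (ρ_ (C.cm1 f)).hom :=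
  ext₂ fun x i i' hi hi' => by
    obtain ⟨k, -⟩ := Hom.exists_fib f hi hi'
    refine ⟨Hom.cm (n := Hom.id b) k (di hi'), k, ?_⟩
    refine (congrArg (C.c2 _) (ru_t f k)).trans (Eq.symm ?_)
    refine (comp_t (C.cComp f (𝟙 b)).hom ((C.cm1 f) ◁ (C.cId b).hom ≫ (ρ_ (C.cm1 f)).hom)
      (x := x) (Hom.cm (n := Hom.id b) k (di hi'))
      (Hom.cm (m := C.cmap f) (n := C.cmap (Hom.id b)) k (di hi')) k).trans ?_
    refine (congrArg₂ (· + ·) ((comp_t ((C.cm1 f) ◁ (C.cId b).hom) (ρ_ (C.cm1 f)).hom (x := x)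
      _ (Hom.cm (m := C.cmap f) (n := Hom.id (C.cobj b)) k (di hi')) k).trans (congrArg₂ (· + ·)
      (ru_t (C.cm1 f) (x := x) k)
      (wl_t (C.cm1 f) (C.cId b).hom (x := x) k (di hi') (di hi'))))
      (C.ccomp_t f (𝟙 b) k (di hi'))).trans ?_
    have h0 : (C.cId b).hom.t (f.φ x) (i := i') (i' := i') (di hi') (di hi') = 0 :=
      C.cid_t (di hi')
    refine (congrArg₂ (fun z w => Γ'.pre z (C.c1 (f.p x k)) + Γ'.pre w (C.c1 (f.p x k)) + _)
      (C.cobj_u (f.φ x) ⟨i', hi'⟩) h0).trans ?_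
    rw [Γ'.pre_zero, add_zero]
    have := C.cc_pre (f.p x k) (b.rel_u (f.φ x) ⟨i', hi'⟩)
    rw [C.one_cc, zero_add] at this
    change Γ'.pre (C.c2 _ _) (C.c1 _) + -C.cc (b.g (f.φ x) ⟨i', hi'⟩ ⟨i', hi'⟩) (f.p x k) =
      C.c2 (b.g (f.φ x) ⟨i', hi'⟩ ⟨i', hi'⟩ * f.p x k) _
    linear_combination (norm := abel) this

lemma map₂_associator (f : a ⟶ b) (g : b ⟶ c) (h : c ⟶ d) : C.cm2 (α_ f g h).hom =
    (C.cComp (f ≫ g) h).hom ≫ (C.cComp f g).hom ▷ (C.cm1 h) ≫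
      (α_ (C.cm1 f) (C.cm1 g) (C.cm1 h)).hom ≫ (C.cm1 f) ◁ (C.cComp g h).inv ≫
        (C.cComp f (g ≫ h)).inv :=
  ext₂ fun x i i'' hi hi' => by
    obtain ⟨i₂, k, q, -⟩ := exists_cm (f ≫ g) h hi hi'
    obtain ⟨i₁, k, l, -⟩ := exists_cm f g hi (Hom.l h q).2
    refine ⟨Hom.cm (Hom.cm k l) q, Hom.cm k (Hom.cm l q), ?_⟩
    refine (congrArg (C.c2 _) (asc_t f g h k l q)).trans ((C.c2_zero _).trans (Eq.symm ?_))
    have e1 := C.ccomp_t (f ≫ g) h (Hom.cm k l) q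
    have e2 := (wr_t (C.cComp f g).hom (C.cm1 h) (x := x) (Hom.cm k l)
      (Hom.cm (m := C.cmap f) (n := C.cmap g) k l) q.2 q.2).trans
        (congrArg _ (C.ccomp_t f g k l))
    have e3 := asc_t (C.cm1 f) (C.cm1 g) (C.cm1 h) (x := x) k l q
    have e4 := (wl_t (C.cm1 f) (C.cComp g h).inv (x := x) k
      (Hom.cm (m := C.cmap g) (n := C.cmap h) l q) (Hom.cm l q)).trans
        (congrArg (fun z => Γ'.pre (-z) _) (C.ccomp_t g h l q))
    have e5 := congrArg Neg.neg (C.ccomp_t f (g ≫ h) k (Hom.cm l q))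
    refine (comp_t (C.cComp (f ≫ g) h).hom _ (x := x) _
      (Hom.cm (m := C.cmap (f ≫ g)) (n := C.cmap h) (Hom.cm k l) q) _).trans ?_
    refine (congrArg (· + _) ((comp_t ((C.cComp f g).hom ▷ (C.cm1 h)) _ (x := x) _
      (Hom.cm (m := (C.cmap f).comp (C.cmap g)) (n := C.cmap h)
        (Hom.cm (m := C.cmap f) (n := C.cmap g) k l) q) _).trans (congrArg (· + _)
      ((comp_t (α_ (C.cm1 f) (C.cm1 g) (C.cm1 h)).hom _ (x := x) _
      (Hom.cm (m := C.cmap f) (n := (C.cmap g).comp (C.cmap h)) k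
        (Hom.cm (m := C.cmap g) (n := C.cmap h) l q)) _).trans (congrArg (· + _)
      (comp_t ((C.cm1 f) ◁ (C.cComp g h).inv) _ (x := x) _
        (Hom.cm (m := C.cmap f) (n := C.cmap (g ≫ h)) k (Hom.cm l q)) _)))))).trans ?_
    refine (congrArg₂ (· + ·) (congrArg₂ (· + ·) (congrArg₂ (· + ·) (congrArg₂ (· + ·)
      e5 e4) e3) e2) e1).trans ?_
    have h1 := C.cc_assoc (h.p (g.φ (f.φ x)) q) (g.p (f.φ x) l) (f.p x k)
    change - -C.cc (h.p (g.φ (f.φ x)) q * g.p (f.φ x) l) (f.p x k) +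
      Γ'.pre (- -C.cc (h.p (g.φ (f.φ x)) q) (g.p (f.φ x) l)) (C.c1 (f.p x k)) + 0 +
      Γ'.post (C.c1 (h.p (g.φ (f.φ x)) q)) (-C.cc (g.p (f.φ x) l) (f.p x k)) +
      -C.cc (h.p (g.φ (f.φ x)) q) (g.p (f.φ x) l * f.p x k) = 0
    simp only [neg_neg, Γ'.post_neg]
    linear_combination (norm := abel) -h1

/-- The morphism of 2-stacks `C⁺ : Γ⁺ ⟶ Γ'⁺` induced by `C`.  It leaves the base manifolds and the
smooth maps underlying 1-morphisms unchanged. -/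
def plus : Pseudofunctor (Coc Γ) (Coc Γ') where
  obj := C.cobj
  map := C.cm1
  map₂ := C.cm2
  mapId := C.cId
  mapComp := C.cComp
  map₂_id := C.map₂_id
  map₂_comp := C.map₂_comp
  map₂_whisker_left := C.map₂_whisker_left
  map₂_whisker_right := C.map₂_whisker_right
  map₂_associator := C.map₂_associator
  map₂_left_unitor := C.map₂_left_unitor
  map₂_right_unitor := C.map₂_right_unitor

end OneObj.Mor

section smooth

open scoped Manifold

variable {E H M : Type} [NormedAddCommGroup E] [NormedSpace ℝ E] [TopologicalSpace H]
  [TopologicalSpace M] [ChartedSpace H M] (I : ModelWithCorners ℝ E H)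

/-- Smoothness of a map from a manifold to `U(1) = ℝ/ℤ`. -/
def SmU (f : M → UnitAddCircle) : Prop := ContMDiff I (𝓡 1) ∞ fun x => AddCircle.toCircle (f x)

/-- Smoothness of a map from a manifold to a vector space. -/
def SmV {V : Type} [NormedAddCommGroup V] [NormedSpace ℝ V] (f : M → V) : Prop :=
  ContMDiff I 𝓘(ℝ, V) ∞ f

variable {I}

lemma SmU.add {f g : M → UnitAddCircle} (hf : SmU I f) (hg : SmU I g) :
    SmU I fun x => f x + g x := by
  simp only [SmU, AddCircle.toCircle_add]
  exact ContMDiff.mul hf hg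

lemma SmU.neg {f : M → UnitAddCircle} (hf : SmU I f) : SmU I fun x => -f x := by
  simp only [SmU, AddCircle.toCircle_neg]
  exact ContMDiff.inv hf

lemma SmU.zero : SmU I fun _ : M => 0 := contMDiff_const

lemma SmV.toU {f : M → ℝ} (hf : SmV I f) : SmU I fun x => ((f x : ℝ) : UnitAddCircle) := by
  have : (fun x => AddCircle.toCircle ((f x : ℝ) : UnitAddCircle)) =
      fun x => Circle.exp (2 * Real.pi * f x) := by
    funext x
    simp [AddCircle.toCircle_apply_mk]
  rw [SmU, this]
  exact contMDiff_circleExp.comp (contMDiff_const.mul hf)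

lemma SmV.of_loc {V : Type} [NormedAddCommGroup V] [NormedSpace ℝ V] {Z : Type} {f : M → Z}
    (hf : IsLocallyConstant f) (k : Z → V) : SmV I fun x => k (f x) := by
  intro x
  exact (contMDiffAt_const (c := k (f x))).congr_of_eventuallyEq
    ((hf.eventually_eq x).mono fun y hy => congrArg k hy)

lemma SmV.add {V : Type} [NormedAddCommGroup V] [NormedSpace ℝ V] {f g : M → V}
    (hf : SmV I f) (hg : SmV I g) : SmV I fun x => f x + g x := ContMDiff.add hf hg

lemma SmV.neg {V : Type} [NormedAddCommGroup V] [NormedSpace ℝ V] {f : M → V}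
    (hf : SmV I f) : SmV I fun x => -f x := ContMDiff.neg hf

lemma SmV.dot {n : ℕ} {f g : M → Fin n → ℝ} (hf : SmV I f) (hg : SmV I g) :
    SmV I fun x => f x ⬝ᵥ g x :=
  contMDiff_finsetSum fun i _ => (contMDiff_pi_space.1 hf i).mul (contMDiff_pi_space.1 hg i)

lemma SmV.fst {V W : Type} [NormedAddCommGroup V] [NormedSpace ℝ V] [NormedAddCommGroup W]
    [NormedSpace ℝ W] {f : M → V × W} (hf : SmV I f) : SmV I fun x => (f x).1 :=
  contDiff_fst.contMDiff.comp hf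

lemma SmV.snd {V W : Type} [NormedAddCommGroup V] [NormedSpace ℝ V] [NormedAddCommGroup W]
    [NormedSpace ℝ W] {f : M → V × W} (hf : SmV I f) : SmV I fun x => (f x).2 :=
  contDiff_snd.contMDiff.comp hf

lemma SmV.pull {E' H' M' : Type} [NormedAddCommGroup E'] [NormedSpace ℝ E'] [TopologicalSpace H']
    [TopologicalSpace M'] [ChartedSpace H' M'] {J : ModelWithCorners ℝ E' H'} {V : Type}
    [NormedAddCommGroup V] [NormedSpace ℝ V] {f : M → V} (hf : SmV I f) {φ : M' → M}
    (hφ : ContMDiff J I ∞ φ) : SmV J fun x => f (φ x) := ContMDiff.comp (g := f) hf hφ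

lemma SmU.pull {E' H' M' : Type} [NormedAddCommGroup E'] [NormedSpace ℝ E'] [TopologicalSpace H']
    [TopologicalSpace M'] [ChartedSpace H' M'] {J : ModelWithCorners ℝ E' H'}
    {f : M → UnitAddCircle} (hf : SmU I f) {φ : M' → M}
    (hφ : ContMDiff J I ∞ φ) : SmU J fun x => f (φ x) :=
  ContMDiff.comp (g := fun x => AddCircle.toCircle (f x)) hf hφ

lemma SmU.of_restr {f : M → UnitAddCircle}
    (h : ∀ x, ∃ U : Opens M, x ∈ U ∧ SmU I fun y : U => f y.1) : SmU I f := by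
  intro x
  obtain ⟨U, hx, h1⟩ := h x
  exact contMDiffAt_subtype_iff (f := fun x => AddCircle.toCircle (f x)) (x := ⟨x, hx⟩) |>.1
    (h1 ⟨x, hx⟩)

end smooth

section TD

open scoped Manifold

variable {n : ℕ}

/-- An integer vector as a real vector. -/
def zr (m : Fin n → ℤ) : Fin n → ℝ := fun i => m i

@[simp] lemma zr_zero : zr (0 : Fin n → ℤ) = 0 := by ext; simp [zr]
@[simp] lemma zr_add (m m' : Fin n → ℤ) : zr (m + m') = zr m + zr m' := by ext; simp [zr]
@[simp] lemma zr_neg (m : Fin n → ℤ) : zr (-m) = -zr m := by ext; simp [zr]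

@[simp] lemma zr_dot_zr (m m' : Fin n → ℤ) : ((zr m ⬝ᵥ zr m' : ℝ) : UnitAddCircle) = 0 := by
  rw [show zr m ⬝ᵥ zr m' = ((∑ i, m i * m' i : ℤ) : ℝ) by simp [zr, dotProduct]]
  exact (AddCircle.coe_eq_zero_iff _).2 ⟨_, zsmul_one _⟩

/-- The group of pairs `(a, â)` of vectors, written multiplicatively. -/
abbrev TDB (n : ℕ) : Type := Multiplicative ((Fin n → ℝ) × (Fin n → ℝ))

/-- The components of an object of the 2-group. -/
abbrev TDB.a (g : TDB n) : Fin n → ℝ := g.toAdd.1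

abbrev TDB.b (g : TDB n) : Fin n → ℝ := g.toAdd.2

/-- The presheaf `BTD` of smooth functions with values in the one-object bicategory associated to
the strict 2-group `TD`: 1-morphisms over `X` are pairs `(a, â)` of smooth maps `X → ℝⁿ`, composed
by addition; 2-morphisms `(t, m, m̂) : (a, â) ⟹ (a + m, â + m̂)` consist of a smooth map
`t : X → U(1)` and smooth (that is, locally constant) maps `m, m̂ : X → ℤⁿ`; vertical
composition is addition, and the horizontal composition of `(t₁, m₁, m̂₁)` with
`(t₂, m₂, m̂₂) : (a₂, â₂) ⟹ (a₂', â₂')` is `(t₂ + t₁ - m₁ â₂, m₁ + m₂, m̂₁ + m̂₂)`. -/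
def TD (n : ℕ) : OneObj where
  B := TDB n
  A := UnitAddCircle × (Fin n → ℤ) × (Fin n → ℤ)
  rel h g g' := g'.a = g.a + zr h.2.1 ∧ g'.b = g.b + zr h.2.2
  pre h _ := h
  post k h := (h.1 - ((zr h.2.1 ⬝ᵥ k.b : ℝ) : UnitAddCircle), h.2.1, h.2.2)
  rel_zero g := by simp
  rel_add h h' := by
    rw [h'.1, h'.2, h.1, h.2]
    simp only [Prod.fst_add, Prod.snd_add, zr_add]
    exact ⟨by abel, by abel⟩
  rel_neg h := by
    rw [h.1, h.2]
    simp
  rel_pre k h := by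
    simp only [TDB.a, TDB.b, toAdd_mul, Prod.fst_add, Prod.snd_add] at *
    rw [h.1, h.2]
    exact ⟨by abel, by abel⟩
  rel_post k h := by
    simp only [TDB.a, TDB.b, toAdd_mul, Prod.fst_add, Prod.snd_add] at *
    rw [h.1, h.2]
    exact ⟨by abel, by abel⟩
  pre_add _ _ _ := rfl
  post_add g h h' := by
    ext : 1
    · simp only [Prod.fst_add, Prod.snd_add, zr_add, add_dotProduct, AddCircle.coe_add]
      abel
    · rfl
  pre_one _ := rfl
  post_one h := by simp [TDB.b]
  pre_mul _ _ _ := rfl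
  post_mul g g' h := by
    ext : 1
    · simp only [TDB.b, toAdd_mul, Prod.snd_add, dotProduct_add, AddCircle.coe_add]
      abel
    · rfl
  pre_post _ _ _ := rfl
  exch {h₁ h₂ g₁ g₁' g₂ g₂'} _ hr := by
    ext : 1
    · simp only [Prod.fst_add, hr.2, dotProduct_add, AddCircle.coe_add, zr_dot_zr]
      abel
    · exact add_comm _ _
  G X := { carrier := {g | SmV (𝓡 X.dim) fun x => (g x).toAdd}
           mul_mem' := fun hf hg => SmV.add hf hg
           one_mem' := contMDiff_const
           inv_mem' := fun hf => SmV.neg hf }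
  H X := { carrier := {h | SmU (𝓡 X.dim) (fun x => (h x).1) ∧ IsLocallyConstant fun x => (h x).2}
           add_mem' := fun hf hg => ⟨hf.1.add hg.1, hf.2.add hg.2⟩
           zero_mem' := ⟨SmU.zero, IsLocallyConstant.const _⟩
           neg_mem' := fun hf => ⟨hf.1.neg, hf.2.neg⟩ }
  G_pull φ _ hg := SmV.pull hg φ.2
  H_pull φ _ hh := ⟨SmU.pull hh.1 φ.2, hh.2.comp_continuous φ.2.continuous⟩
  H_pre hh _ := hh
  H_post {X g h} hg hh := by
    refine ⟨?_, hh.2⟩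
    have h1 : SmV (𝓡 X.dim) fun x => zr (h x).2.1 ⬝ᵥ (g x).b :=
      SmV.dot (SmV.of_loc hh.2 fun z => zr z.1) (SmV.snd hg)
    have := hh.1.add h1.toU.neg
    simpa only [← sub_eq_add_neg] using this
  H_local {X} h hl := by
    refine ⟨SmU.of_restr fun x => ?_, ?_⟩
    · obtain ⟨U, hx, h1, -⟩ := hl x
      exact ⟨U, hx, h1⟩
    · rw [IsLocallyConstant.iff_eventually_eq]
      intro x
      obtain ⟨U, hx, -, h1⟩ := hl x
      have h2 := h1.eventually_eq (⟨x, hx⟩ : U)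
      rw [← U.2.isOpenEmbedding_subtypeVal.map_nhds_eq (⟨x, hx⟩ : U)]
      exact Filter.eventually_map.2 h2

end TD


section Poincare

open Equiv

variable {n : ℕ}

/-- The torus `𝕋ⁿ = U(1)ⁿ`. -/
abbrev Tor (n : ℕ) : Type := Fin n → UnitAddCircle

/-- The projection `ℝⁿ → 𝕋ⁿ`. -/
def pj (v : Fin n → ℝ) : Tor n := fun i => (v i : UnitAddCircle)

@[simp] lemma pj_add (v w : Fin n → ℝ) : pj (v + w) = pj v + pj w := rfl
@[simp] lemma pj_zero : pj (0 : Fin n → ℝ) = 0 := rfl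
@[simp] lemma pj_neg (v : Fin n → ℝ) : pj (-v) = -pj v := rfl
@[simp] lemma pj_sub (v w : Fin n → ℝ) : pj (v - w) = pj v - pj w := rfl

@[simp] lemma pj_zr (m : Fin n → ℤ) : pj (zr m) = 0 := by
  funext i
  exact (AddCircle.coe_eq_zero_iff _).2 ⟨m i, by simp [zr]⟩

lemma pj_surj (c : Tor n) : ∃ v, pj v = c := by
  choose v hv using fun i => QuotientAddGroup.mk_surjective (c i)
  exact ⟨v, funext hv⟩

/-- The equivalence relation `(a, â, t) ∼ (a + m, â + m̂, t + m̂ a)` on `ℝⁿ × ℝⁿ × U(1)`. -/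
def poiSetoid (n : ℕ) : Setoid ((Fin n → ℝ) × (Fin n → ℝ) × UnitAddCircle) where
  r p q := ∃ m m' : Fin n → ℤ, q.1 = p.1 + zr m ∧ q.2.1 = p.2.1 + zr m' ∧
    q.2.2 = p.2.2 + ((zr m' ⬝ᵥ p.1 : ℝ) : UnitAddCircle)
  iseqv := by
    refine ⟨fun p => ⟨0, 0, by simp, by simp, by simp⟩, ?_, ?_⟩
    · rintro ⟨a, b, t⟩ ⟨a', b', t'⟩ ⟨m, m', h1, h2, h3⟩
      dsimp only at h1 h2 h3
      subst h1 h2 h3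
      refine ⟨-m, -m', by simp, by simp, ?_⟩
      simp only [zr_neg, neg_dotProduct, dotProduct_add, AddCircle.coe_neg, AddCircle.coe_add,
        zr_dot_zr]
      abel
    · rintro ⟨a, b, t⟩ ⟨a', b', t'⟩ ⟨a'', b'', t''⟩ ⟨m, m', h1, h2, h3⟩ ⟨k, k', h4, h5, h6⟩
      dsimp only at h1 h2 h3 h4 h5 h6
      subst h1 h2 h3 h4 h5 h6
      refine ⟨m + k, m' + k', by simp [add_assoc], by simp [add_assoc], ?_⟩
      simp only [zr_add, add_dotProduct, dotProduct_add, AddCircle.coe_add, zr_dot_zr]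
      abel

/-- The total space of the `n`-fold Poincaré bundle, a principal `U(1)`-bundle over
`𝕋ⁿ × 𝕋ⁿ`: the quotient of `ℝⁿ × ℝⁿ × U(1)` by `(a, â, t) ∼ (a + m, â + m̂, t + m̂ a)`. -/
def Poi (n : ℕ) : Type := Quotient (poiSetoid n)

namespace Poi

/-- The class of `(a, â, t)`. -/
def mk (a b : Fin n → ℝ) (t : UnitAddCircle) : Poi n := Quotient.mk (poiSetoid n) (a, b, t)

lemma ind {p : Poi n → Prop} (h : ∀ a b t, p (mk a b t)) (x) : p x :=
  Quotient.ind (fun y => h y.1 y.2.1 y.2.2) x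

lemma mk_eq (a b : Fin n → ℝ) (t) (m m' : Fin n → ℤ) :
    mk (a + zr m) (b + zr m') t = mk a b (t - ((zr m' ⬝ᵥ a : ℝ) : UnitAddCircle)) :=
  (Quotient.sound (s := poiSetoid n) (show (poiSetoid n).r _ _ from
    ⟨m, m', rfl, rfl, by simp⟩)).symm

/-- A map out of the total space. -/
def lift {Z : Type} (f : (Fin n → ℝ) → (Fin n → ℝ) → UnitAddCircle → Z)
    (h : ∀ a b t (m m' : Fin n → ℤ),
      f (a + zr m) (b + zr m') (t + ((zr m' ⬝ᵥ a : ℝ) : UnitAddCircle)) = f a b t) : Poi n → Z :=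
  Quotient.lift (fun y => f y.1 y.2.1 y.2.2) (by
    rintro ⟨a, b, t⟩ ⟨a', b', t'⟩ ⟨m, m', h1, h2, h3⟩
    dsimp only at h1 h2 h3
    subst h1 h2 h3
    exact (h a b t m m').symm)

/-- The bundle projection, first component. -/
def fst : Poi n → Tor n := lift (fun a _ _ => pj a) (by simp)

/-- The bundle projection, second component. -/
def snd : Poi n → Tor n := lift (fun _ b _ => pj b) (by simp)

/-- The principal action of `U(1)`. -/
def act (s : UnitAddCircle) : Poi n → Poi n := lift (fun a b t => mk a b (t + s)) (by
  intro a b t m m'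
  rw [mk_eq]
  congr 1
  abel)

@[simp] lemma fst_mk (a b : Fin n → ℝ) (t) : fst (mk a b t) = pj a := rfl
@[simp] lemma snd_mk (a b : Fin n → ℝ) (t) : snd (mk a b t) = pj b := rfl
@[simp] lemma act_mk (s) (a b : Fin n → ℝ) (t) : act s (mk a b t) = mk a b (t + s) := rfl

@[simp] lemma fst_act (s) (p : Poi n) : fst (act s p) = fst p := by
  induction p using ind; rfl

@[simp] lemma snd_act (s) (p : Poi n) : snd (act s p) = snd p := by
  induction p using ind; rfl

@[simp] lemma act_zero (p : Poi n) : act 0 p = p := by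
  induction p using ind; simp

lemma act_add (s s') (p : Poi n) : act (s + s') p = act s (act s' p) := by
  induction p using ind; simp only [act_mk]; congr 1; abel

/-- The automorphism of the Poincaré bundle, covering the translation by `(a, â)`, that underlies
`A_{a, â}`, namely `a â ⊗ R(a, â)`, where `R(a, â)` sends `[a', â', t]` to
`[a' + a, â' + â, t + â' a]`. -/
def zeta (a b : Fin n → ℝ) : Perm (Poi n) where
  toFun := lift (fun a' b' t =>
    mk (a' + a) (b' + b) (t + ((b' ⬝ᵥ a : ℝ) : UnitAddCircle) + ((a ⬝ᵥ b : ℝ) : UnitAddCircle)))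
    (by
      intro a' b' t m m'
      rw [add_right_comm a', add_right_comm b', mk_eq]
      simp only [add_dotProduct, dotProduct_add, AddCircle.coe_add]
      congr 1
      abel)
  invFun := lift (fun a' b' t => mk (a' - a) (b' - b) (t - ((b' ⬝ᵥ a : ℝ) : UnitAddCircle)))
    (by
      intro a' b' t m m'
      rw [add_sub_right_comm a', add_sub_right_comm b', mk_eq]
      simp only [add_dotProduct, dotProduct_sub, AddCircle.coe_add, AddCircle.coe_sub]
      congr 1
      abel)
  left_inv p := by
    induction p using ind with | _ a' b' t
    change mk (a' + a - a) (b' + b - b) _ = _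
    rw [add_sub_cancel_right, add_sub_cancel_right, dotProduct_comm a b]
    simp only [add_dotProduct, AddCircle.coe_add]
    congr 1
    abel
  right_inv p := by
    induction p using ind with | _ a' b' t
    change mk (a' - a + a) (b' - b + b) _ = _
    rw [sub_add_cancel, sub_add_cancel, dotProduct_comm a b]
    simp only [sub_dotProduct, AddCircle.coe_sub]
    congr 1
    abel

@[simp] lemma zeta_mk (a b a' b' : Fin n → ℝ) (t) : zeta a b (mk a' b' t) =
    mk (a' + a) (b' + b)
      (t + ((b' ⬝ᵥ a : ℝ) : UnitAddCircle) + ((a ⬝ᵥ b : ℝ) : UnitAddCircle)) := rfl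

end Poi

/-- The pointwise automorphisms `((f, id), (f̂, id), ζ)` of the correspondence
`((𝕋ⁿ, I), (𝕋ⁿ, I), id_I ⊗ Pₙ)` given by the trivial torus bundles, the trivial bundle gerbes, and
the action of the Poincaré bundle `Pₙ` on the identity of the trivial gerbe: `f` and `f̂` are
`𝕋ⁿ`-equivariant maps and `ζ : Pₙ → (f × f̂)^* Pₙ` is an isomorphism of principal `U(1)`-bundles,
regarded as an equivariant map `ζ : Pₙ → Pₙ` that covers `f × f̂`. -/
def Aut (n : ℕ) : Subgroup (Perm (Tor n) × Perm (Tor n) × Perm (Poi n)) where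
  carrier := {z | (∀ c d, z.1 (c + d) = z.1 c + d) ∧ (∀ c d, z.2.1 (c + d) = z.2.1 c + d) ∧
    (∀ p, (z.2.2 p).fst = z.1 p.fst) ∧ (∀ p, (z.2.2 p).snd = z.2.1 p.snd) ∧
    ∀ s p, z.2.2 (p.act s) = (z.2.2 p).act s}
  mul_mem' := by
    rintro z w ⟨h1, h2, h3, h4, h5⟩ ⟨k1, k2, k3, k4, k5⟩
    refine ⟨fun c d => ?_, fun c d => ?_, fun p => ?_, fun p => ?_, fun s p => ?_⟩
    · simp [h1, k1]
    · simp [h2, k2]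
    · simp [h3, k3]
    · simp [h4, k4]
    · simp [h5, k5]
  one_mem' := ⟨fun _ _ => rfl, fun _ _ => rfl, fun _ => rfl, fun _ => rfl, fun _ _ => rfl⟩
  inv_mem' := by
    rintro z ⟨h1, h2, h3, h4, h5⟩
    refine ⟨fun c d => ?_, fun c d => ?_, fun p => ?_, fun p => ?_, fun s p => ?_⟩
    · exact Perm.inv_eq_iff_eq.2 (by simp [h1])
    · exact Perm.inv_eq_iff_eq.2 (by simp [h2])
    · exact Perm.eq_inv_iff_eq.2 (by simp [← h3])
    · exact Perm.eq_inv_iff_eq.2 (by simp [← h4])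
    · exact Perm.inv_eq_iff_eq.2 (by simp [h5])

/-- The group of pointwise automorphisms. -/
abbrev TB (n : ℕ) : Type := Aut n

namespace TB

/-- The map `f` of the automorphism `((f, id), (f̂, id), ζ)`. -/
abbrev f (z : TB n) : Perm (Tor n) := z.1.1

/-- The map `f̂` of the automorphism `((f, id), (f̂, id), ζ)`. -/
abbrev f' (z : TB n) : Perm (Tor n) := z.1.2.1

/-- The bundle isomorphism `ζ` of the automorphism `((f, id), (f̂, id), ζ)`. -/
abbrev ζ (z : TB n) : Perm (Poi n) := z.1.2.2

lemma fst_ζ (z : TB n) (p : Poi n) : (z.ζ p).fst = z.f p.fst := z.2.2.2.1 p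
lemma snd_ζ (z : TB n) (p : Poi n) : (z.ζ p).snd = z.f' p.snd := z.2.2.2.2.1 p
lemma ζ_act (z : TB n) (s) (p : Poi n) : z.ζ (p.act s) = (z.ζ p).act s := z.2.2.2.2.2 s p

@[simp] lemma f_mul (z w : TB n) (c) : (z * w).f c = z.f (w.f c) := rfl
@[simp] lemma f'_mul (z w : TB n) (c) : (z * w).f' c = z.f' (w.f' c) := rfl
@[simp] lemma ζ_mul (z w : TB n) (c) : (z * w).ζ c = z.ζ (w.ζ c) := rfl

end TB

/-- The automorphism `A_{a, â} = ((f_a, id), (f_â, id), ζ_{a, â})`, at a point. -/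
def Aab (a b : Fin n → ℝ) : TB n :=
  ⟨(Equiv.addRight (pj a), Equiv.addRight (pj b), Poi.zeta a b), by
    refine ⟨fun c d => add_right_comm _ _ _, fun c d => add_right_comm _ _ _,
      fun p => ?_, fun p => ?_, fun s p => ?_⟩ <;> induction p using Poi.ind
    · simp
    · simp
    · simp only [Poi.act_mk, Poi.zeta_mk]
      congr 1
      abel⟩

open scoped Manifold

/-- The smooth families of automorphisms in the class generated by the `A_{a, â}`: all finite
compositions of the `A_{a, â}`, for smooth `a, â : X → ℝⁿ`, and of their inverses. -/
def TG (n : ℕ) (X : Mfd) : Subgroup (X → TB n) :=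
  Subgroup.closure {z | ∃ a b : X → Fin n → ℝ, SmV (𝓡 X.dim) a ∧ SmV (𝓡 X.dim) b ∧
    z = fun x => Aab (a x) (b x)}

lemma Aab_mem {X : Mfd} {a b : X → Fin n → ℝ} (ha : SmV (𝓡 X.dim) a) (hb : SmV (𝓡 X.dim) b) :
    (fun x => Aab (a x) (b x)) ∈ TG n X := Subgroup.subset_closure ⟨a, b, ha, hb, rfl⟩

lemma TG_pull {X Y : Mfd} (φ : X ⟶ Y) {g : Y → TB n} (hg : g ∈ TG n Y) :
    (fun x => g (φ x)) ∈ TG n X := by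
  induction hg using Subgroup.closure_induction with
  | mem z hz =>
    obtain ⟨a, b, ha, hb, rfl⟩ := hz
    exact Aab_mem (ha.pull φ.2) (hb.pull φ.2)
  | one => exact (TG n X).one_mem
  | mul z w _ _ h1 h2 => exact (TG n X).mul_mem h1 h2
  | inv z _ h1 => exact (TG n X).inv_mem h1

lemma TG_f {X : Mfd} {g : X → TB n} (hg : g ∈ TG n X) : ∃ a b : X → Fin n → ℝ,
    SmV (𝓡 X.dim) a ∧ SmV (𝓡 X.dim) b ∧ (∀ x c, (g x).f c = c + pj (a x)) ∧
      ∀ x c, (g x).f' c = c + pj (b x) := by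
  induction hg using Subgroup.closure_induction with
  | mem z hz =>
    obtain ⟨a, b, ha, hb, rfl⟩ := hz
    exact ⟨a, b, ha, hb, fun _ _ => rfl, fun _ _ => rfl⟩
  | one => exact ⟨fun _ => 0, fun _ => 0, contMDiff_const, contMDiff_const,
      fun _ c => (add_zero c).symm, fun _ c => (add_zero c).symm⟩
  | mul z w _ _ h1 h2 =>
    obtain ⟨a, b, ha, hb, h3, h4⟩ := h1
    obtain ⟨a', b', ha', hb', h3', h4'⟩ := h2
    refine ⟨_, _, ha'.add ha, hb'.add hb, fun x c => ?_, fun x c => ?_⟩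
    · change (z x).f ((w x).f c) = _
      rw [h3', h3, pj_add, add_assoc]
    · change (z x).f' ((w x).f' c) = _
      rw [h4', h4, pj_add, add_assoc]
  | inv z _ h1 =>
    obtain ⟨a, b, ha, hb, h3, h4⟩ := h1
    refine ⟨_, _, ha.neg, hb.neg, fun x c => ?_, fun x c => ?_⟩
    · exact Perm.inv_eq_iff_eq.2 (by rw [h3]; simp)
    · exact Perm.inv_eq_iff_eq.2 (by rw [h4]; simp)

/-- Smoothness of a map `X × 𝕋ⁿ → U(1)`; equivalently, smoothness of its composition with the
covering `X × ℝⁿ → X × 𝕋ⁿ`. -/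
def SmT (X : Mfd) (α : X → Tor n → UnitAddCircle) : Prop :=
  SmU ((𝓡 X.dim).prod 𝓘(ℝ, Fin n → ℝ)) fun y : X × (Fin n → ℝ) => α y.1 (pj y.2)

lemma SmT.pull {X Y : Mfd} {α : Y → Tor n → UnitAddCircle} (h : SmT Y α) (φ : X ⟶ Y) :
    SmT X fun x => α (φ x) :=
  SmU.pull (φ := fun y : X × (Fin n → ℝ) => (φ y.1, y.2)) h
    ((φ.2.comp contMDiff_fst).prodMk contMDiff_snd)

lemma SmT.shift {X : Mfd} {α : X → Tor n → UnitAddCircle} (h : SmT X α) {f : X → Tor n → Tor n}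
    {a : X → Fin n → ℝ} (ha : SmV (𝓡 X.dim) a) (hf : ∀ x c, f x c = c + pj (a x)) :
    SmT X fun x c => α x (f x c) := by
  simp only [hf]
  exact SmU.pull (φ := fun y : X × (Fin n → ℝ) => (y.1, y.2 + a y.1)) h
    (contMDiff_fst.prodMk (contMDiff_snd.add (ContMDiff.comp (g := a) ha contMDiff_fst)))

lemma SmT.of_local {X : Mfd} {α : X → Tor n → UnitAddCircle}
    (h : ∀ x, ∃ U : Opens X, x ∈ U ∧ SmT (X.op U) fun y => α y.1) : SmT X α := by
  refine SmU.of_restr fun y => ?_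
  obtain ⟨U, hx, h1⟩ := h y.1
  refine ⟨⟨Prod.fst ⁻¹' (U : Set X), U.2.preimage continuous_fst⟩, hx, ?_⟩
  have h2 : ContMDiff ((𝓡 X.dim).prod 𝓘(ℝ, Fin n → ℝ)) (𝓡 X.dim) ∞
      fun y : (⟨Prod.fst ⁻¹' (U : Set X), U.2.preimage continuous_fst⟩ :
        Opens (X × (Fin n → ℝ))) => (⟨y.1.1, y.2⟩ : U) :=
    (ContMDiff.subtypeVal_comp_iff U _).1 (contMDiff_fst.comp contMDiff_subtype_val)
  exact SmU.pull h1 (h2.prodMk (contMDiff_snd.comp contMDiff_subtype_val))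

lemma SmT.base {X : Mfd} {t : X → UnitAddCircle} (h : SmU (𝓡 X.dim) t) :
    SmT (n := n) X fun x _ => t x :=
  SmU.pull (φ := fun y : X × (Fin n → ℝ) => y.1) h contMDiff_fst

/-- The presheaf of bicategories `𝒯`: its single object over `X` is the correspondence
`((X × 𝕋ⁿ, I), (X × 𝕋ⁿ, I), id_I ⊗ pr^* Pₙ)`, its 1-morphisms are the automorphisms of it in the
class generated by the `A_{a, â}`, and a 2-morphism
`((f, id), (f̂, id), ζ) ⟹ ((f', id), (f̂', id), ζ')` exists only if `f = f'` and `f̂ = f̂'`, and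
consists of smooth maps `α, β : X × 𝕋ⁿ → U(1)` (automorphisms of the identities of the trivial
gerbes) such that `pr₁^* α ⬝ ζ = ζ' ⬝ pr₂^* β`. -/
def TT (n : ℕ) : OneObj where
  B := TB n
  A := (Tor n → UnitAddCircle) × (Tor n → UnitAddCircle)
  rel h z z' := z.f = z'.f ∧ z.f' = z'.f' ∧
    ∀ p, (z.ζ p).act (h.1 p.fst) = (z'.ζ p).act (h.2 p.snd)
  pre h k := (fun c => h.1 (k.f c), fun c => h.2 (k.f' c))
  post _ h := h
  rel_zero _ := ⟨rfl, rfl, fun _ => rfl⟩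
  rel_add {h h' g g' g''} r r' := by
    refine ⟨r.1.trans r'.1, r.2.1.trans r'.2.1, fun p => ?_⟩
    simp only [Prod.fst_add, Prod.snd_add, Pi.add_apply]
    rw [Poi.act_add, r.2.2 p, ← Poi.act_add, add_comm, Poi.act_add, r'.2.2 p, ← Poi.act_add,
      add_comm]
  rel_neg {h g g'} r := by
    refine ⟨r.1.symm, r.2.1.symm, fun p => ?_⟩
    have h1 := congrArg (Poi.act (-h.1 p.fst - h.2 p.snd)) (r.2.2 p)
    rw [← Poi.act_add, ← Poi.act_add] at h1
    have e1 : -h.1 p.fst - h.2 p.snd + h.1 p.fst = -h.2 p.snd := by abel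
    have e2 : -h.1 p.fst - h.2 p.snd + h.2 p.snd = -h.1 p.fst := by abel
    rw [e1, e2] at h1
    exact h1.symm
  rel_pre {h g g'} k r := by
    refine ⟨Equiv.ext fun c => ?_, Equiv.ext fun c => ?_, fun p => ?_⟩
    · simp [r.1]
    · simp [r.2.1]
    · have h1 := r.2.2 (k.ζ p)
      rwa [k.fst_ζ, k.snd_ζ] at h1
  rel_post {h g g'} k r := by
    refine ⟨Equiv.ext fun c => ?_, Equiv.ext fun c => ?_, fun p => ?_⟩
    · simp [r.1]
    · simp [r.2.1]
    · have h1 := congrArg k.ζ (r.2.2 p)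
      rwa [k.ζ_act, k.ζ_act] at h1
  pre_add _ _ _ := rfl
  post_add _ _ _ := rfl
  pre_one _ := rfl
  post_one _ := rfl
  pre_mul _ _ _ := rfl
  post_mul _ _ _ := rfl
  pre_post _ _ _ := rfl
  exch {h₁ h₂ g₁ g₁' g₂ g₂'} r _ := by
    rw [r.1, r.2.1, add_comm]
  G := TG n
  H X := { carrier := {h | SmT X (fun x => (h x).1) ∧ SmT X fun x => (h x).2}
           add_mem' := fun hf hg => ⟨hf.1.add hg.1, hf.2.add hg.2⟩
           zero_mem' := ⟨SmU.zero, SmU.zero⟩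
           neg_mem' := fun hf => ⟨hf.1.neg, hf.2.neg⟩ }
  G_pull := TG_pull
  H_pull φ _ hh := ⟨hh.1.pull φ, hh.2.pull φ⟩
  H_pre hh hg := by
    obtain ⟨a, b, ha, hb, h1, h2⟩ := TG_f hg
    exact ⟨hh.1.shift ha h1, hh.2.shift hb h2⟩
  H_post _ hh := hh
  H_local _ hl := ⟨SmT.of_local fun x => (hl x).imp fun _ h => ⟨h.1, h.2.1⟩,
    SmT.of_local fun x => (hl x).imp fun _ h => ⟨h.1, h.2.2⟩⟩

/-- The pairing `m c` of an integer vector `m` with `c ∈ 𝕋ⁿ`. -/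
def zdot (m : Fin n → ℤ) (c : Tor n) : UnitAddCircle := ∑ i, m i • c i

lemma zdot_add (m : Fin n → ℤ) (c d : Tor n) : zdot m (c + d) = zdot m c + zdot m d := by
  simp [zdot, Finset.sum_add_distrib]

lemma add_zdot (m m' : Fin n → ℤ) (c : Tor n) : zdot (m + m') c = zdot m c + zdot m' c := by
  simp [zdot, Finset.sum_add_distrib, add_smul]

@[simp] lemma zero_zdot (c : Tor n) : zdot 0 c = 0 := by simp [zdot]

@[simp] lemma zdot_zero (m : Fin n → ℤ) : zdot m 0 = 0 := by simp [zdot]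

lemma zdot_pj (m : Fin n → ℤ) (v : Fin n → ℝ) :
    zdot m (pj v) = ((zr m ⬝ᵥ v : ℝ) : UnitAddCircle) := by
  have h : ∀ s : Finset (Fin n), ∑ i ∈ s, m i • pj v i =
      ((∑ i ∈ s, zr m i * v i : ℝ) : UnitAddCircle) := by
    intro s
    induction s using Finset.induction_on with
    | empty => simp
    | insert i s hi ih =>
      rw [Finset.sum_insert hi, Finset.sum_insert hi, ih, AddCircle.coe_add, zr, ← zsmul_eq_mul,
        AddCircle.coe_zsmul]
      rfl
  exact h Finset.univ

lemma SmT.zdot {X : Mfd} {m : X → Fin n → ℤ} (hm : IsLocallyConstant m) :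
    SmT X fun x c => zdot (m x) c := by
  simp only [SmT, zdot_pj]
  refine SmV.toU (SmV.dot ?_ contMDiff_snd)
  exact SmV.pull (φ := fun y : X × (Fin n → ℝ) => y.1) (SmV.of_loc (I := 𝓡 X.dim) hm zr)
    contMDiff_fst

/-- The 2-functor `C : BTD → 𝒯`, sending `(a, â)` to `A_{a, â}` and the 2-morphism `(t, m, m̂)` with
source `(a, â)` to `(α, β)`, where `α(x, c) = -t(x) - m̂ c` and `β(x, c) = -t(x) - m (c + â(x))`,
with compositor `A_{a₂, â₂} ∘ A_{a₁, â₁} ⟹ A_{a₁ + a₂, â₁ + â₂}` given by `(â₂ a₁, 0)`. -/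
def functorC (n : ℕ) : OneObj.Mor (TD n) (TT n) where
  c1 (g : TDB n) := Aab g.a g.b
  c2 (g : TDB n) h := (fun c => -h.1 - zdot h.2.2 c, fun c => -h.1 - zdot h.2.1 (c + pj g.b))
  cc (g₂ g₁ : TDB n) := (fun _ => ((g₂.b ⬝ᵥ g₁.a : ℝ) : UnitAddCircle), fun _ => 0)
  rel_c2 {h g g'} r := by
    obtain ⟨a, b⟩ := g
    obtain ⟨a₂, b₂⟩ := g'
    obtain ⟨s, m, m'⟩ := h
    obtain ⟨r1, r2⟩ := r
    change a₂ = a + zr m at r1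
    change b₂ = b + zr m' at r2
    subst r1 r2
    refine ⟨?_, ?_, fun p => ?_⟩
    · change Equiv.addRight (pj a) = Equiv.addRight (pj (a + zr m))
      simp
    · change Equiv.addRight (pj b) = Equiv.addRight (pj (b + zr m'))
      simp
    · induction p using Poi.ind with | _ a' b' t
      change Poi.mk (a' + a) (b' + b) (t + ((b' ⬝ᵥ a : ℝ) : UnitAddCircle) +
        ((a ⬝ᵥ b : ℝ) : UnitAddCircle) + (-s - zdot m' (pj a'))) =
        Poi.mk (a' + (a + zr m)) (b' + (b + zr m')) (t + ((b' ⬝ᵥ (a + zr m) : ℝ) : UnitAddCircle) +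
          (((a + zr m) ⬝ᵥ (b + zr m') : ℝ) : UnitAddCircle) + (-s - zdot m (pj b' + pj b)))
      rw [← add_assoc a', ← add_assoc b', Poi.mk_eq, ← pj_add, zdot_pj, zdot_pj]
      simp only [add_dotProduct, dotProduct_add, AddCircle.coe_add, zr_dot_zr]
      rw [dotProduct_comm b' (zr m), dotProduct_comm a (zr m')]
      congr 1
      abel
  c2_zero g := Prod.ext
    (funext fun c => show -0 - zdot 0 c = 0 by simp)
    (funext fun c => show -0 - zdot 0 (c + pj (TDB.b g)) = 0 by simp)
  c2_add {h h' g g' g''} r r' := by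
    obtain ⟨a, b⟩ := g
    obtain ⟨a₂, b₂⟩ := g'
    obtain ⟨s, m, m'⟩ := h
    obtain ⟨t, k, k'⟩ := h'
    obtain ⟨-, r2⟩ := r
    change b₂ = b + zr m' at r2
    subst r2
    refine Prod.ext (funext fun c => ?_) (funext fun c => ?_)
    · change -(t + s) - zdot (k' + m') c = (-t - zdot k' c) + (-s - zdot m' c)
      rw [add_zdot]
      abel
    · change -(t + s) - zdot (k + m) (c + pj b) =
        (-t - zdot k (c + pj (b + zr m'))) + (-s - zdot m (c + pj b))
      rw [add_zdot, pj_add, pj_zr, add_zero]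
      abel
  rel_cc g₂ g₁ := by
    obtain ⟨a₂, b₂⟩ := g₂
    obtain ⟨a₁, b₁⟩ := g₁
    refine ⟨Equiv.ext fun c => ?_, Equiv.ext fun c => ?_, fun p => ?_⟩
    · change c + pj a₁ + pj a₂ = c + pj (a₂ + a₁)
      rw [pj_add, add_assoc, add_comm (pj a₁)]
    · change c + pj b₁ + pj b₂ = c + pj (b₂ + b₁)
      rw [pj_add, add_assoc, add_comm (pj b₁)]
    · induction p using Poi.ind with | _ a' b' t
      change Poi.mk (a' + a₁ + a₂) (b' + b₁ + b₂) (t + ((b' ⬝ᵥ a₁ : ℝ) : UnitAddCircle) +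
        ((a₁ ⬝ᵥ b₁ : ℝ) : UnitAddCircle) + (((b' + b₁) ⬝ᵥ a₂ : ℝ) : UnitAddCircle) +
        ((a₂ ⬝ᵥ b₂ : ℝ) : UnitAddCircle) + ((b₂ ⬝ᵥ a₁ : ℝ) : UnitAddCircle)) =
        Poi.mk (a' + (a₂ + a₁)) (b' + (b₂ + b₁)) (t + ((b' ⬝ᵥ (a₂ + a₁) : ℝ) : UnitAddCircle) +
          (((a₂ + a₁) ⬝ᵥ (b₂ + b₁) : ℝ) : UnitAddCircle) + 0)
      rw [add_assoc a', add_comm a₁, add_assoc b', add_comm b₁]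
      simp only [add_dotProduct, dotProduct_add, AddCircle.coe_add]
      rw [dotProduct_comm b₁ a₂, dotProduct_comm b₂ a₁]
      congr 1
      abel
  cc_post {h g g'} k r := by
    obtain ⟨a, b⟩ := g
    obtain ⟨a₂, b₂⟩ := g'
    obtain ⟨a₃, b₃⟩ := k
    obtain ⟨s, m, m'⟩ := h
    obtain ⟨r1, -⟩ := r
    change a₂ = a + zr m at r1
    subst r1
    refine Prod.ext (funext fun c => ?_) (funext fun c => ?_)
    · change ((b₃ ⬝ᵥ (a + zr m) : ℝ) : UnitAddCircle) + (-s - zdot m' c) =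
        -(s - ((zr m ⬝ᵥ b₃ : ℝ) : UnitAddCircle)) - zdot m' c + ((b₃ ⬝ᵥ a : ℝ) : UnitAddCircle)
      rw [dotProduct_add, AddCircle.coe_add, dotProduct_comm b₃ (zr m)]
      abel
    · change 0 + (-s - zdot m (c + pj b)) =
        -(s - ((zr m ⬝ᵥ b₃ : ℝ) : UnitAddCircle)) - zdot m (c + pj (b₃ + b)) + 0
      rw [pj_add, zdot_add, zdot_add, zdot_add, zdot_pj m b₃]
      abel
  cc_pre {h g g'} k r := by
    obtain ⟨a, b⟩ := g
    obtain ⟨a₂, b₂⟩ := g'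
    obtain ⟨a₃, b₃⟩ := k
    obtain ⟨s, m, m'⟩ := h
    obtain ⟨-, r2⟩ := r
    change b₂ = b + zr m' at r2
    subst r2
    refine Prod.ext (funext fun c => ?_) (funext fun c => ?_)
    · change (((b + zr m') ⬝ᵥ a₃ : ℝ) : UnitAddCircle) + (-s - zdot m' (c + pj a₃)) =
        -s - zdot m' c + ((b ⬝ᵥ a₃ : ℝ) : UnitAddCircle)
      rw [add_dotProduct, AddCircle.coe_add, zdot_add, zdot_pj m' a₃]
      abel
    · change 0 + (-s - zdot m (c + pj b₃ + pj b)) = -s - zdot m (c + pj (b + b₃)) + 0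
      rw [pj_add, zdot_add, zdot_add, zdot_add, zdot_add]
      abel
  cc_assoc g₃ g₂ g₁ := by
    obtain ⟨a₁, b₁⟩ := g₁
    obtain ⟨a₂, b₂⟩ := g₂
    obtain ⟨a₃, b₃⟩ := g₃
    refine Prod.ext (funext fun c => ?_) (funext fun c => rfl)
    change ((b₃ ⬝ᵥ (a₂ + a₁) : ℝ) : UnitAddCircle) + ((b₂ ⬝ᵥ a₁ : ℝ) : UnitAddCircle) =
      (((b₃ + b₂) ⬝ᵥ a₁ : ℝ) : UnitAddCircle) + ((b₃ ⬝ᵥ a₂ : ℝ) : UnitAddCircle)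
    simp only [add_dotProduct, dotProduct_add, AddCircle.coe_add]
    abel
  c1_one := by
    apply Subtype.ext
    refine Prod.ext (Equiv.ext fun c => add_zero c) (Prod.ext (Equiv.ext fun c => add_zero c)
      (Equiv.ext fun p => ?_))
    induction p using Poi.ind with | _ a' b' t
    change Poi.mk (a' + 0) (b' + 0) (t + ((b' ⬝ᵥ 0 : ℝ) : UnitAddCircle) +
      (((0 : Fin n → ℝ) ⬝ᵥ 0 : ℝ) : UnitAddCircle)) = Poi.mk a' b' t
    simp
  cc_one g := Prod.ext
    (funext fun _ => show ((TDB.b g ⬝ᵥ 0 : ℝ) : UnitAddCircle) = 0 by simp) rfl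
  one_cc g := Prod.ext
    (funext fun _ => show ((0 ⬝ᵥ TDB.a g : ℝ) : UnitAddCircle) = 0 by simp) rfl
  c1_mem hg := Aab_mem (SmV.fst hg) (SmV.snd hg)
  c2_mem {X g g' h} hg _ hh _ := by
    have hb : SmV (𝓡 X.dim) fun x => (g x).b := SmV.snd hg
    have h1 : IsLocallyConstant fun x => (h x).2.1 := hh.2.comp Prod.fst
    have h2 : IsLocallyConstant fun x => (h x).2.2 := hh.2.comp Prod.snd
    simp only [sub_eq_add_neg]
    exact ⟨SmU.add (SmU.neg (SmT.base hh.1)) (SmU.neg (SmT.zdot h2)),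
      SmU.add (SmU.neg (SmT.base hh.1))
        (SmU.neg ((SmT.zdot h1).shift (f := fun x c => c + pj (g x).b) hb fun _ _ => rfl))⟩
  cc_mem {X g g'} hg hg' :=
    ⟨SmT.base (SmV.toU (SmV.dot (SmV.snd hg) (SmV.fst hg'))), SmU.zero⟩

end Poincare

/-- The 2-stackification `BTD⁺`. -/
abbrev BTDplus (n : ℕ) : Type 1 := Coc (TD n)

/-- The 2-stack of T-duality correspondences: the closure of `𝒯` under descent, that is,
everything obtained by gluing the standard Poincaré correspondence along the automorphisms
generated by the `A_{a, â}`. -/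
abbrev TCor (n : ℕ) : Type 1 := Coc (TT n)

/-- The 2-functor induced by `C`. -/
abbrev Cplus (n : ℕ) : Pseudofunctor (BTDplus n) (TCor n) := (functorC n).plus

end TDual

end

/-! A morphism of presheaves of one-object bigroupoids induces an isomorphism of the associated
2-stacks as soon as it is an equivalence over every manifold: bijective on 2-morphisms between
images of given 1-morphisms, and surjective on 1-morphisms up to 2-isomorphism. The predicate
`IsEquiv` records this, and the proof splits into the general implication and its verification for
`C`.

For the general implication, descent data consist of local 1-morphisms, local 2-morphisms and
equations between 2-morphisms. Local 1-morphisms of the target can be moved into the image of `C`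
along 2-morphisms. For the transition 1-morphisms of a cocycle this gives an equivalent cocycle over
the identity of the base (`Twist.equivalence`); for the components of a 1-morphism of cocycles it
gives an isomorphic 1-morphism (`Hom.toConj`). After that, every remaining datum is a 2-morphism
between images of `C`, up to compositors, so it has exactly one preimage. An equation between
preimages holds because it holds after applying `C` (`eLift_coh`, `map₂Lift`, `objLift`). No cover
is ever refined, since the assumption on 1-morphisms is available over each member of the given
covers.

For `C` itself, the geometric input is that a 2-automorphism in 𝒯 is a pair (α, β) with α(c) = β(d)
for all c and d, because U(1) acts freely on the Poincaré bundle and the bundle surjects onto 𝕋ⁿ ×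
𝕋ⁿ; hence α and β are the same constant. A 2-morphism from the image of (a, â) to that of (a', â')
forces a' - a and â' - â to be integral, and these differences together with α(0) determine it; this
gives the bijection on 2-morphisms. Smoothness is reflected because continuous integral differences
are locally constant and t is recovered as -α(x, 0). On 1-morphisms the images of `C` generate 𝒯,
and being 2-isomorphic to an image is stable under products, by the compositor, and under inverses,
by `rel_c1_inv`. -/

noncomputable section

namespace TDual

/-! ### Changing the components of a 1-morphism of cocycles along 2-morphisms. -/

namespace Coc

variable {Γ : OneObj} {a b : Coc Γ}

/-- A 1-morphism of cocycles, modified along 2-morphisms `h k : p k ⟹ q k`. -/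
def Hom.conj (F : a.Hom b) (q : ∀ (x : a.X) {i i'}, F.Fib x i i' → Γ.B)
    (h : ∀ (x : a.X) {i i'}, F.Fib x i i' → Γ.A)
    (hr : ∀ (x : a.X) {i i'} (k : F.Fib x i i'), Γ.rel (h x k) (F.p x k) (q x k))
    (hq : ∀ {i i'} (k : F.K i i'),
      (fun x : a.X.op (F.W k) => q x.1 ⟨k, x.2⟩) ∈ Γ.G (a.X.op (F.W k)))
    (hh : ∀ {i i'} (k : F.K i i'),
      (fun x : a.X.op (F.W k) => h x.1 ⟨k, x.2⟩) ∈ Γ.H (a.X.op (F.W k))) : a.Hom b where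
  φ := F.φ
  K := F.K
  W := F.W
  W_l := F.W_l
  W_r := F.W_r
  cov := F.cov
  p x _ _ k := q x k
  -- The value is forced by the wish that `h` be a 2-morphism: go back along `h x l` from `q x l ∘
  -- g` to `p x l ∘ g`, apply the old `e`, then go forward along `h x k`.
  e x _ _ _ _ k l := Γ.post (b.g (F.φ x) (F.r k) (F.r l)) (h x k) + F.e x k l -
    Γ.pre (h x l) (a.g x (F.l k) (F.l l))
  rel_e x _ _ _ _ k l := by
    have h1 := Γ.rel_add (Γ.rel_neg (Γ.rel_pre (a.g x (F.l k) (F.l l)) (hr x l)))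
      (Γ.rel_add (F.rel_e x k l) (Γ.rel_post (b.g (F.φ x) (F.r k) (F.r l)) (hr x k)))
    rwa [← sub_eq_add_neg] at h1
  coh x _ _ _ _ _ _ k l m := by
    -- The two occurrences of `h x l` cancel. The outer ones, `h x m` and `h x k`, slide past `a.γ`
    -- and `b.γ` by the exchange law, which leaves the old coherence.
    have h0 := F.coh x k l m
    have h1 := Γ.exch (a.rel_γ x (F.l k) (F.l l) (F.l m)) (hr x m)
    have h2 := Γ.exch (hr x k) (b.rel_γ (F.φ x) (F.r k) (F.r l) (F.r m))
    simp only [Γ.pre_sub, Γ.post_sub, Γ.pre_add, Γ.post_add, Γ.pre_post, Γ.pre_mul,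
      Γ.post_mul] at *
    linear_combination (norm := abel) h0 - h1 - h2
  p_mem := hq
  e_mem {i i' j j'} k l :=
    OneObj.H_sub (OneObj.H_add (Γ.H_post
      (OneObj.G_res F.φ (V := F.W k ⊓ F.W l) (U := b.U i' ⊓ b.U j')
        (fun _ h => ⟨F.W_r k h.1, F.W_r l h.2⟩) (b.g_mem i' j'))
      (OneObj.H_res (𝟙 a.X) (V := F.W k ⊓ F.W l) (fun _ h => h.1) (hh k))) (F.e_mem k l))
      (Γ.H_pre (OneObj.H_res (𝟙 a.X) (V := F.W k ⊓ F.W l) (fun _ h => h.2) (hh l))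
        (OneObj.G_res (𝟙 a.X) (V := F.W k ⊓ F.W l) (U := a.U i ⊓ a.U j)
          (fun _ h => ⟨F.W_l k h.1, F.W_l l h.2⟩) (a.g_mem i j)))

/-- The 2-morphism to the modified 1-morphism. -/
def Hom.toConj (F : a.Hom b) (q : ∀ (x : a.X) {i i'}, F.Fib x i i' → Γ.B)
    (h : ∀ (x : a.X) {i i'}, F.Fib x i i' → Γ.A)
    (hr : ∀ (x : a.X) {i i'} (k : F.Fib x i i'), Γ.rel (h x k) (F.p x k) (q x k))
    (hq : ∀ {i i'} (k : F.K i i'),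
      (fun x : a.X.op (F.W k) => q x.1 ⟨k, x.2⟩) ∈ Γ.G (a.X.op (F.W k)))
    (hh : ∀ {i i'} (k : F.K i i'),
      (fun x : a.X.op (F.W k) => h x.1 ⟨k, x.2⟩) ∈ Γ.H (a.X.op (F.W k))) :
    Ref F (F.conj q h hr hq hh) where
  base := rfl
  D := F.K
  V := F.W
  k d := d
  k' d := d
  V_k _ _ h := h
  V_k' _ _ h := h
  cov := F.cov
  t x _ _ d := h x d
  rel_t x _ _ d := hr x d
  comm _ _ _ _ _ _ _ := sub_eq_zero.2 (sub_add_cancel _ _)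
  t_mem := hh

/-! ### Changing the transition 1-morphisms of a cocycle along 2-morphisms. -/

lemma g_res (y : Coc Γ) (i j : y.I) {V : Opens y.X} (hi : ∀ x ∈ V, x ∈ y.U i) (hj : ∀ x ∈ V, x ∈ y.U j) :
    (fun x : V => y.g x.1 ⟨i, hi x.1 x.2⟩ ⟨j, hj x.1 x.2⟩) ∈ Γ.G (y.X.op V) :=
  OneObj.G_res (𝟙 y.X) (V := V) (U := y.U i ⊓ y.U j) (fun x h => ⟨hi x h, hj x h⟩) (y.g_mem i j)

lemma γ_res (y : Coc Γ) (i j k : y.I) {V : Opens y.X} (hi : ∀ x ∈ V, x ∈ y.U i) (hj : ∀ x ∈ V, x ∈ y.U j)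
    (hk : ∀ x ∈ V, x ∈ y.U k) :
    (fun x : V => y.γ x.1 ⟨i, hi x.1 x.2⟩ ⟨j, hj x.1 x.2⟩ ⟨k, hk x.1 x.2⟩) ∈
      Γ.H (y.X.op V) :=
  OneObj.H_res (𝟙 y.X) (V := V) (U := y.U i ⊓ y.U j ⊓ y.U k)
    (fun x h => ⟨⟨hi x h, hj x h⟩, hk x h⟩) (y.γ_mem i j k)

/-- A family of 2-morphisms out of the 1-morphisms of a cocycle. -/
structure Twist (y : Coc Γ) where
  q : ∀ x : y.X, {i // x ∈ y.U i} → {i // x ∈ y.U i} → Γ.B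
  h : ∀ x : y.X, {i // x ∈ y.U i} → {i // x ∈ y.U i} → Γ.A
  rel_h : ∀ x i j, Γ.rel (h x i j) (y.g x i j) (q x i j)
  q_mem : ∀ i j, (fun x : y.X.op (y.U i ⊓ y.U j) => q x.1 ⟨i, x.2.1⟩ ⟨j, x.2.2⟩) ∈
    Γ.G (y.X.op (y.U i ⊓ y.U j))
  h_mem : ∀ i j, (fun x : y.X.op (y.U i ⊓ y.U j) => h x.1 ⟨i, x.2.1⟩ ⟨j, x.2.2⟩) ∈
    Γ.H (y.X.op (y.U i ⊓ y.U j))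

namespace Twist

variable {y : Coc Γ} (T : Twist y)

lemma q_res (i j : y.I) {V : Opens y.X} (hi : ∀ x ∈ V, x ∈ y.U i) (hj : ∀ x ∈ V, x ∈ y.U j) :
    (fun x : V => T.q x.1 ⟨i, hi x.1 x.2⟩ ⟨j, hj x.1 x.2⟩) ∈ Γ.G (y.X.op V) :=
  OneObj.G_res (𝟙 y.X) (V := V) (U := y.U i ⊓ y.U j) (fun x h => ⟨hi x h, hj x h⟩) (T.q_mem i j)

lemma h_res (i j : y.I) {V : Opens y.X} (hi : ∀ x ∈ V, x ∈ y.U i) (hj : ∀ x ∈ V, x ∈ y.U j) :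
    (fun x : V => T.h x.1 ⟨i, hi x.1 x.2⟩ ⟨j, hj x.1 x.2⟩) ∈ Γ.H (y.X.op V) :=
  OneObj.H_res (𝟙 y.X) (V := V) (U := y.U i ⊓ y.U j) (fun x h => ⟨hi x h, hj x h⟩) (T.h_mem i j)

/-- The cocycle modified along a twist. -/
def coc : Coc Γ where
  X := y.X
  I := y.I
  U := y.U
  cov := y.cov
  g := T.q
  -- The composite `q j k ∘ q i j ⟹ g j k ∘ g i j ⟹ g i k ⟹ q i k`; the subtracted bracket is the
  -- horizontal composite of `h i j` and `h j k`.
  γ x i j k := T.h x i k + y.γ x i j k -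
    (Γ.pre (T.h x j k) (T.q x i j) + Γ.post (y.g x j k) (T.h x i j))
  rel_γ x i j k := by
    have h1 := Γ.rel_neg (Γ.rel_add (Γ.rel_post (y.g x j k) (T.rel_h x i j))
      (Γ.rel_pre (T.q x i j) (T.rel_h x j k)))
    have h2 := Γ.rel_add h1 (Γ.rel_add (y.rel_γ x i j k) (T.rel_h x i k))
    rwa [← sub_eq_add_neg] at h2
  coc x i j k l := by
    -- By the exchange laws, each side equals the corresponding side of the old condition, followed
    -- by `h i l` and preceded by the inverse of the triple horizontal composite of `h i j`, `h j
    -- k`, `h k l`.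
    have h0 := y.coc x i j k l
    have h1 := Γ.exch (T.rel_h x i k) (T.rel_h x k l)
    have h2 := Γ.exch (y.rel_γ x i j k) (T.rel_h x k l)
    have h3 := Γ.exch (T.rel_h x i j) (y.rel_γ x j k l)
    have h4 := congrArg (fun z => Γ.pre z (T.q x i j)) (Γ.exch (T.rel_h x j k) (T.rel_h x k l))
    have h5 := Γ.exch (T.rel_h x i j) (Γ.rel_pre (y.g x j k) (T.rel_h x k l))
    simp only [Γ.pre_sub, Γ.post_sub, Γ.pre_add, Γ.post_add, Γ.pre_post, Γ.pre_mul,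
      Γ.post_mul] at *
    linear_combination (norm := abel) h0 - h1 - h2 - h3 + h4 + h5
  g_mem := T.q_mem
  γ_mem i j k :=
    OneObj.H_sub (OneObj.H_add
      (T.h_res i k (V := y.U i ⊓ y.U j ⊓ y.U k) (fun _ h => h.1.1) (fun _ h => h.2))
      (y.γ_mem i j k))
      (OneObj.H_add (Γ.H_pre
        (T.h_res j k (V := y.U i ⊓ y.U j ⊓ y.U k) (fun _ h => h.1.2) (fun _ h => h.2))
        (T.q_res i j (V := y.U i ⊓ y.U j ⊓ y.U k) (fun _ h => h.1.1) (fun _ h => h.1.2)))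
        (Γ.H_post
        (y.g_res j k (V := y.U i ⊓ y.U j ⊓ y.U k) (fun _ h => h.1.2) (fun _ h => h.2))
        (T.h_res i j (V := y.U i ⊓ y.U j ⊓ y.U k) (fun _ h => h.1.1) (fun _ h => h.1.2))))

/-- The 1-morphism from the modified cocycle. -/
def hom : T.coc.Hom y where
  φ := 𝟙 y.X
  K _ _ := Unit
  W {i i'} _ := y.U i ⊓ y.U i'
  W_l _ _ h := h.1
  W_r _ _ h := h.2
  cov h h' := ⟨(), h, h'⟩
  -- The components are those of the identity of `y`. Only `e` changes: the transition of the source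
  -- is now `q i j`, so `h i j` must be undone before the 2-morphism of the identity applies.
  p x i i' k := y.g x ⟨i, k.2.1⟩ ⟨i', k.2.2⟩
  e x i i' j j' k l := y.γ x ⟨i, k.2.1⟩ ⟨j, l.2.1⟩ ⟨j', l.2.2⟩ -
    y.γ x ⟨i, k.2.1⟩ ⟨i', k.2.2⟩ ⟨j', l.2.2⟩ -
    Γ.post (y.g x ⟨j, l.2.1⟩ ⟨j', l.2.2⟩) (T.h x ⟨i, k.2.1⟩ ⟨j, l.2.1⟩)
  rel_e x i i' j j' k l := by
    have h1 := Γ.rel_neg (Γ.rel_post (y.g x ⟨j, l.2.1⟩ ⟨j', l.2.2⟩)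
      (T.rel_h x ⟨i, k.2.1⟩ ⟨j, l.2.1⟩))
    have h2 := Γ.rel_add (Γ.rel_add h1 (y.rel_γ x ⟨i, k.2.1⟩ ⟨j, l.2.1⟩ ⟨j', l.2.2⟩))
      (Γ.rel_neg (y.rel_γ x ⟨i, k.2.1⟩ ⟨i', k.2.2⟩ ⟨j', l.2.2⟩))
    convert h2 using 1
    · abel
    all_goals rfl
  coh x i i' j j' r r' k l m := by
    let i₁ : {i // x ∈ y.U i} := ⟨i, k.2.1⟩
    let i₂ : {i // x ∈ y.U i} := ⟨i', k.2.2⟩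
    let j₁ : {i // x ∈ y.U i} := ⟨j, l.2.1⟩
    let j₂ : {i // x ∈ y.U i} := ⟨j', l.2.2⟩
    let r₁ : {i // x ∈ y.U i} := ⟨r, m.2.1⟩
    let r₂ : {i // x ∈ y.U i} := ⟨r', m.2.2⟩
    change y.γ x i₁ r₁ r₂ - y.γ x i₁ i₂ r₂ - Γ.post (y.g x r₁ r₂) (T.h x i₁ r₁) +
      Γ.post (y.g x r₁ r₂) (T.h x i₁ r₁ + y.γ x i₁ j₁ r₁ -
        (Γ.pre (T.h x j₁ r₁) (T.q x i₁ j₁) + Γ.post (y.g x j₁ r₁) (T.h x i₁ j₁))) =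
      Γ.pre (y.γ x i₂ j₂ r₂) (y.g x i₁ i₂) + Γ.post (y.g x j₂ r₂)
        (y.γ x i₁ j₁ j₂ - y.γ x i₁ i₂ j₂ - Γ.post (y.g x j₁ j₂) (T.h x i₁ j₁)) +
      Γ.pre (y.γ x j₁ r₁ r₂ - y.γ x j₁ j₂ r₂ - Γ.post (y.g x r₁ r₂) (T.h x j₁ r₁)) (T.q x i₁ j₁)
    -- The terms without `T.h` form the coherence of the identity of `y`; the others are matched by
    -- moving `T.h x i₁ j₁` past `γ`.
    have h0 := Hom.id_coh i₁ i₂ j₁ j₂ r₁ r₂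
    have h1 := Γ.exch (T.rel_h x i₁ j₁) (y.rel_γ x j₁ r₁ r₂)
    have h2 := Γ.exch (T.rel_h x i₁ j₁) (y.rel_γ x j₁ j₂ r₂)
    simp only [Γ.pre_sub, Γ.post_sub, Γ.post_add, Γ.pre_post,
      Γ.post_mul] at *
    linear_combination (norm := abel) h0 - h1 + h2
  p_mem {i i'} _ := y.g_mem i i'
  e_mem {i i' j j'} _ _ := by
    have e1 : ∀ x ∈ (y.U i ⊓ y.U i') ⊓ (y.U j ⊓ y.U j'), x ∈ y.U i := fun _ h => h.1.1
    have e2 : ∀ x ∈ (y.U i ⊓ y.U i') ⊓ (y.U j ⊓ y.U j'), x ∈ y.U i' := fun _ h => h.1.2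
    have e3 : ∀ x ∈ (y.U i ⊓ y.U i') ⊓ (y.U j ⊓ y.U j'), x ∈ y.U j := fun _ h => h.2.1
    have e4 : ∀ x ∈ (y.U i ⊓ y.U i') ⊓ (y.U j ⊓ y.U j'), x ∈ y.U j' := fun _ h => h.2.2
    exact OneObj.H_sub (OneObj.H_sub (y.γ_res i j j' e1 e3 e4) (y.γ_res i i' j' e1 e2 e4))
      (Γ.H_post (y.g_res j j' e3 e4) (T.h_res i j e1 e3))

/-- The 1-morphism to the modified cocycle. -/
def inv : y.Hom T.coc where
  φ := 𝟙 y.X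
  K _ _ := Unit
  W {i i'} _ := y.U i ⊓ y.U i'
  W_l _ _ h := h.1
  W_r _ _ h := h.2
  cov h h' := ⟨(), h, h'⟩
  p x i i' k := y.g x ⟨i, k.2.1⟩ ⟨i', k.2.2⟩
  -- Now the target carries the modified transitions, so `h i' j'` is appended after the 2-morphism
  -- of the identity.
  e x i i' j j' k l := y.γ x ⟨i, k.2.1⟩ ⟨j, l.2.1⟩ ⟨j', l.2.2⟩ -
    y.γ x ⟨i, k.2.1⟩ ⟨i', k.2.2⟩ ⟨j', l.2.2⟩ +
    Γ.pre (T.h x ⟨i', k.2.2⟩ ⟨j', l.2.2⟩) (y.g x ⟨i, k.2.1⟩ ⟨i', k.2.2⟩)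
  rel_e x i i' j j' k l := by
    have h1 := Γ.rel_pre (y.g x ⟨i, k.2.1⟩ ⟨i', k.2.2⟩) (T.rel_h x ⟨i', k.2.2⟩ ⟨j', l.2.2⟩)
    have h2 := Γ.rel_add (Γ.rel_add (y.rel_γ x ⟨i, k.2.1⟩ ⟨j, l.2.1⟩ ⟨j', l.2.2⟩)
      (Γ.rel_neg (y.rel_γ x ⟨i, k.2.1⟩ ⟨i', k.2.2⟩ ⟨j', l.2.2⟩))) h1
    convert h2 using 1
    · abel
    all_goals rfl
  coh x i i' j j' r r' k l m := by
    let i₁ : {i // x ∈ y.U i} := ⟨i, k.2.1⟩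
    let i₂ : {i // x ∈ y.U i} := ⟨i', k.2.2⟩
    let j₁ : {i // x ∈ y.U i} := ⟨j, l.2.1⟩
    let j₂ : {i // x ∈ y.U i} := ⟨j', l.2.2⟩
    let r₁ : {i // x ∈ y.U i} := ⟨r, m.2.1⟩
    let r₂ : {i // x ∈ y.U i} := ⟨r', m.2.2⟩
    change y.γ x i₁ r₁ r₂ - y.γ x i₁ i₂ r₂ + Γ.pre (T.h x i₂ r₂) (y.g x i₁ i₂) +
      Γ.post (y.g x r₁ r₂) (y.γ x i₁ j₁ r₁) =
      Γ.pre (T.h x i₂ r₂ + y.γ x i₂ j₂ r₂ -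
        (Γ.pre (T.h x j₂ r₂) (T.q x i₂ j₂) + Γ.post (y.g x j₂ r₂) (T.h x i₂ j₂))) (y.g x i₁ i₂) +
      Γ.post (T.q x j₂ r₂)
        (y.γ x i₁ j₁ j₂ - y.γ x i₁ i₂ j₂ + Γ.pre (T.h x i₂ j₂) (y.g x i₁ i₂)) +
      Γ.pre (y.γ x j₁ r₁ r₂ - y.γ x j₁ j₂ r₂ + Γ.pre (T.h x j₂ r₂) (y.g x j₁ j₂)) (y.g x i₁ j₁)
    have h0 := Hom.id_coh i₁ i₂ j₁ j₂ r₁ r₂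
    have h1 := Γ.exch (y.rel_γ x i₁ j₁ j₂) (T.rel_h x j₂ r₂)
    have h2 := Γ.exch (y.rel_γ x i₁ i₂ j₂) (T.rel_h x j₂ r₂)
    have h3 := congrArg (fun z => Γ.pre z (y.g x i₁ i₂))
      (Γ.exch (T.rel_h x i₂ j₂) (T.rel_h x j₂ r₂))
    simp only [Γ.pre_sub, Γ.post_sub, Γ.pre_add, Γ.post_add, Γ.pre_post, Γ.pre_mul] at *
    linear_combination (norm := abel) h0 + h1 - h2 + h3
  p_mem {i i'} _ := y.g_mem i i'
  e_mem {i i' j j'} _ _ := by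
    have e1 : ∀ x ∈ (y.U i ⊓ y.U i') ⊓ (y.U j ⊓ y.U j'), x ∈ y.U i := fun _ h => h.1.1
    have e2 : ∀ x ∈ (y.U i ⊓ y.U i') ⊓ (y.U j ⊓ y.U j'), x ∈ y.U i' := fun _ h => h.1.2
    have e3 : ∀ x ∈ (y.U i ⊓ y.U i') ⊓ (y.U j ⊓ y.U j'), x ∈ y.U j := fun _ h => h.2.1
    have e4 : ∀ x ∈ (y.U i ⊓ y.U i') ⊓ (y.U j ⊓ y.U j'), x ∈ y.U j' := fun _ h => h.2.2
    exact OneObj.H_add (OneObj.H_sub (y.γ_res i j j' e1 e3 e4) (y.γ_res i i' j' e1 e2 e4))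
      (Γ.H_pre (T.h_res i' j' e2 e4) (y.g_res i i' e1 e2))

/-- The 2-morphism from `hom` after `inv` to the identity. -/
def counit : Ref (T.inv.comp T.hom) (Hom.id y) where
  base := rfl
  D := (T.inv.comp T.hom).K
  V q := (T.inv.comp T.hom).W q
  k q := q
  k' _ := ()
  V_k _ _ h := h
  V_k' _ _ h := ⟨h.1.1, h.2.2⟩
  cov := (T.inv.comp T.hom).cov
  -- The composite has component `g i' i'' ∘ g i i'` and the identity has `g i i''`, so `γ` is the
  -- comparison.
  t x i i'' q := y.γ x ⟨i, q.2.1.1⟩ ⟨q.1.1, q.2.1.2⟩ ⟨i'', q.2.2.2⟩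
  rel_t x i i'' q := y.rel_γ x ⟨i, q.2.1.1⟩ ⟨q.1.1, q.2.1.2⟩ ⟨i'', q.2.2.2⟩
  comm x i i'' j j'' k l := by
    let i₁ : {i // x ∈ y.U i} := ⟨i, k.2.1.1⟩
    let i₂ : {i // x ∈ y.U i} := ⟨k.1.1, k.2.1.2⟩
    let i₃ : {i // x ∈ y.U i} := ⟨i'', k.2.2.2⟩
    let j₁ : {i // x ∈ y.U i} := ⟨j, l.2.1.1⟩
    let j₂ : {i // x ∈ y.U i} := ⟨l.1.1, l.2.1.2⟩
    let j₃ : {i // x ∈ y.U i} := ⟨j'', l.2.2.2⟩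
    refine sub_eq_zero.2 ?_
    change y.γ x i₁ j₁ j₃ - y.γ x i₁ i₃ j₃ + Γ.pre (y.γ x j₁ j₂ j₃) (y.g x i₁ j₁) =
      Γ.post (y.g x i₃ j₃) (y.γ x i₁ i₂ i₃) +
      (Γ.post (y.g x j₂ j₃) (y.γ x i₁ j₁ j₂ - y.γ x i₁ i₂ j₂ +
        Γ.pre (T.h x i₂ j₂) (y.g x i₁ i₂)) +
      Γ.pre (y.γ x i₂ j₂ j₃ - y.γ x i₂ i₃ j₃ - Γ.post (y.g x j₂ j₃) (T.h x i₂ j₂)) (y.g x i₁ i₂))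
    -- The two contributions of `T.h x i₂ j₂`, from `inv` and from `hom`, cancel; only cocycle
    -- conditions of `y` remain.
    have h1 := y.coc x i₁ j₁ j₂ j₃
    have h2 := y.coc x i₁ i₂ i₃ j₃
    have h3 := y.coc x i₁ i₂ j₂ j₃
    simp only [Γ.pre_sub, Γ.post_sub, Γ.post_add, Γ.pre_post] at *
    linear_combination (norm := abel) -h1 - h2 + h3
  t_mem {i i''} q := y.γ_res i q.1 i'' (V := (T.inv.comp T.hom).W q) (fun _ h => h.1.1)
    (fun _ h => h.1.2) (fun _ h => h.2.2)

/-- The 2-morphism from `inv` after `hom` to the identity. -/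
def unit : Ref (T.hom.comp T.inv) (Hom.id T.coc) where
  base := rfl
  D := (T.hom.comp T.inv).K
  V q := (T.hom.comp T.inv).W q
  k q := q
  k' _ := ()
  V_k _ _ h := h
  V_k' _ _ h := ⟨h.1.1, h.2.2⟩
  cov := (T.hom.comp T.inv).cov
  -- The identity of the modified cocycle has component `q i i''`, so `γ` has to be followed by `h i
  -- i''`.
  t x i i'' q := T.h x ⟨i, q.2.1.1⟩ ⟨i'', q.2.2.2⟩ +
    y.γ x ⟨i, q.2.1.1⟩ ⟨q.1.1, q.2.1.2⟩ ⟨i'', q.2.2.2⟩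
  rel_t x i i'' q := Γ.rel_add (y.rel_γ x ⟨i, q.2.1.1⟩ ⟨q.1.1, q.2.1.2⟩ ⟨i'', q.2.2.2⟩)
    (T.rel_h x _ _)
  comm x i i'' j j'' k l := by
    let i₁ : {i // x ∈ y.U i} := ⟨i, k.2.1.1⟩
    let i₂ : {i // x ∈ y.U i} := ⟨k.1.1, k.2.1.2⟩
    let i₃ : {i // x ∈ y.U i} := ⟨i'', k.2.2.2⟩
    let j₁ : {i // x ∈ y.U i} := ⟨j, l.2.1.1⟩
    let j₂ : {i // x ∈ y.U i} := ⟨l.1.1, l.2.1.2⟩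
    let j₃ : {i // x ∈ y.U i} := ⟨j'', l.2.2.2⟩
    refine sub_eq_zero.2 ?_
    change (T.h x i₁ j₃ + y.γ x i₁ j₁ j₃ -
        (Γ.pre (T.h x j₁ j₃) (T.q x i₁ j₁) + Γ.post (y.g x j₁ j₃) (T.h x i₁ j₁))) -
      (T.h x i₁ j₃ + y.γ x i₁ i₃ j₃ -
        (Γ.pre (T.h x i₃ j₃) (T.q x i₁ i₃) + Γ.post (y.g x i₃ j₃) (T.h x i₁ i₃))) +
      Γ.pre (T.h x j₁ j₃ + y.γ x j₁ j₂ j₃) (T.q x i₁ j₁) =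
      Γ.post (T.q x i₃ j₃) (T.h x i₁ i₃ + y.γ x i₁ i₂ i₃) +
      (Γ.post (y.g x j₂ j₃) (y.γ x i₁ j₁ j₂ - y.γ x i₁ i₂ j₂ -
        Γ.post (y.g x j₁ j₂) (T.h x i₁ j₁)) +
      Γ.pre (y.γ x i₂ j₂ j₃ - y.γ x i₂ i₃ j₃ + Γ.pre (T.h x i₃ j₃) (y.g x i₂ i₃)) (y.g x i₁ i₂))
    have h1 := y.coc x i₁ j₁ j₂ j₃
    have h2 := y.coc x i₁ i₂ i₃ j₃
    have h3 := y.coc x i₁ i₂ j₂ j₃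
    have h4 := Γ.exch (T.rel_h x i₁ i₃) (T.rel_h x i₃ j₃)
    have h5 := Γ.exch (T.rel_h x i₁ j₁) (y.rel_γ x j₁ j₂ j₃)
    have h6 := Γ.exch (y.rel_γ x i₁ i₂ i₃) (T.rel_h x i₃ j₃)
    simp only [Γ.pre_sub, Γ.post_sub, Γ.pre_add, Γ.post_add, Γ.pre_mul,
      Γ.post_mul] at *
    linear_combination (norm := abel) -h1 - h2 + h3 + h4 + h5 + h6
  t_mem {i i''} q := OneObj.H_add
    (T.h_res i i'' (V := (T.hom.comp T.inv).W q) (fun _ h => h.1.1) (fun _ h => h.2.2))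
    (y.γ_res i q.1 i'' (V := (T.hom.comp T.inv).W q) (fun _ h => h.1.1)
      (fun _ h => h.1.2) (fun _ h => h.2.2))

/-- The modified cocycle is equivalent to the original one. -/
def equivalence : Bicategory.Equivalence T.coc y :=
  -- The triangle identities need no check: adjointification corrects the counit, so two invertible
  -- 2-morphisms suffice.
  Bicategory.Equivalence.mkOfAdjointifyCounit (f := T.hom) (g := T.inv)
    (Coc.iso (m := (T.hom.comp T.inv : T.coc ⟶ T.coc)) (m' := 𝟙 T.coc) T.unit.hom).symm
    (Coc.iso (m := (T.inv.comp T.hom : y ⟶ y)) (m' := 𝟙 y) T.counit.hom)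

end Twist

end Coc

/-! ### Morphisms that are equivalences over every manifold, and preimages of 2-morphisms. -/

namespace OneObj.Mor

open Coc

variable {Γ Γ' : OneObj} (C : OneObj.Mor Γ Γ')

/-- A morphism of presheaves of one-object bigroupoids that is bijective on 2-morphisms, compatibly
with smoothness, and essentially surjective on 1-morphisms. -/
structure IsEquiv : Prop where
  -- Existence and uniqueness on 2-morphisms are asked at single points; `mem_of_c2` then reflects
  -- smoothness. For 1-morphisms a smooth solution over all of `X` is required, so that lifting does
  -- not refine covers.
  exists_c2 : ∀ {h' g g'}, Γ'.rel h' (C.c1 g) (C.c1 g') → ∃ h, Γ.rel h g g' ∧ C.c2 g h = h'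
  c2_inj : ∀ {h k g g'}, Γ.rel h g g' → Γ.rel k g g' → C.c2 g h = C.c2 g k → h = k
  mem_of_c2 : ∀ {X : Mfd} {g g' : X → Γ.B} {h : X → Γ.A}, g ∈ Γ.G X → g' ∈ Γ.G X →
    (∀ x, Γ.rel (h x) (g x) (g' x)) → (fun x => C.c2 (g x) (h x)) ∈ Γ'.H X → h ∈ Γ.H X
  exists_c1 : ∀ {X : Mfd} {z : X → Γ'.B}, z ∈ Γ'.G X → ∃ g ∈ Γ.G X, ∃ h ∈ Γ'.H X,
    ∀ x, Γ'.rel (h x) (z x) (C.c1 (g x))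

variable {C} (hC : C.IsEquiv) {a b : Coc Γ}

namespace IsEquiv

/-- The preimage of a 2-morphism. -/
def lift {h' g g'} (r : Γ'.rel h' (C.c1 g) (C.c1 g')) : Γ.A := (hC.exists_c2 r).choose

lemma rel_lift {h' g g'} (r : Γ'.rel h' (C.c1 g) (C.c1 g')) : Γ.rel (hC.lift r) g g' :=
  (hC.exists_c2 r).choose_spec.1

lemma c2_lift {h' g g'} (r : Γ'.rel h' (C.c1 g) (C.c1 g')) : C.c2 g (hC.lift r) = h' :=
  (hC.exists_c2 r).choose_spec.2

/-- Preimages are chosen point by point, yet form a smooth family: their image under `c2` is the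
given smooth family, and `mem_of_c2` reflects smoothness. -/
lemma lift_mem {X : Mfd} {g g' : X → Γ.B} {h' : X → Γ'.A} (hg : g ∈ Γ.G X) (hg' : g' ∈ Γ.G X)
    (hh : h' ∈ Γ'.H X) (r : ∀ x, Γ'.rel (h' x) (C.c1 (g x)) (C.c1 (g' x))) :
    (fun x => hC.lift (r x)) ∈ Γ.H X :=
  hC.mem_of_c2 hg hg' (fun x => hC.rel_lift (r x)) (by simpa only [hC.c2_lift] using hh)

/-- The preimage of a 2-morphism of cocycles. -/
def map₂Lift {f g : a ⟶ b} (s : C.cm1 f ⟶ C.cm1 g) : Hom₂ f g where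
  base := s.base
  t x _ _ k k' := hC.lift (s.rel_t x k k')
  rel_t x _ _ k k' := hC.rel_lift (s.rel_t x k k')
  comm x i i' j j' k k' l l' := by
    have bk : Γ.rel _ (Hom.p f x k) (Hom.p g x k') := hC.rel_lift (s.rel_t x k k')
    have bl : Γ.rel _ (Hom.p f x l) (Hom.p g x l') := hC.rel_lift (s.rel_t x l l')
    have ek : C.c2 (Hom.p f x k) _ = s.t x k k' := hC.c2_lift (s.rel_t x k k')
    have el : C.c2 (Hom.p f x l) _ = s.t x l l' := hC.c2_lift (s.rel_t x l l')
    have h1 := C.cc_pre (a.g x (Hom.l f k) (Hom.l f l)) bl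
    have h2 := C.cc_post (b.g (Hom.φ f x) (Hom.r f k) (Hom.r f l)) bk
    have r2 := Hom.rel_e g x k' l'
    have eb : b.g (Hom.φ g x) (Hom.r g k') (Hom.r g l') =
        b.g (Hom.φ f x) (Hom.r f k) (Hom.r f l) :=
      g_congr (show Hom.φ g x = Hom.φ f x from (s.base_apply x).symm) _ _ _ _
    rw [eb] at r2
    have r3 := Γ.rel_pre (a.g x (Hom.l f k) (Hom.l f l)) bl
    have r4 := Γ.rel_post (b.g (Hom.φ f x) (Hom.r f k) (Hom.r f l)) bk
    have h3 := C.c2_add r3 r2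
    have h4 := C.c2_add (Hom.rel_e f x k l) r4
    -- Both sides are 2-morphisms `p l ∘ g ⟹ g' ∘ p' k'`, so they may be compared after applying
    -- `C`. There, naturality of the compositor turns the claim into the compatibility of `s`.
    refine hC.c2_inj (Γ.rel_add r3 r2) (Γ.rel_add (Hom.rel_e f x k l) r4) ?_
    have h5 : C.cme g k' l' + Γ'.pre (s.t x l l') (C.c1 (a.g x (Hom.l f k) (Hom.l f l))) =
      Γ'.post (C.c1 (b.g (Hom.φ f x) (Hom.r f k) (Hom.r f l))) (s.t x k k') + C.cme f k l :=
      s.comm x k k' l l'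
    rw [← ek, ← el, cme, cme, eb] at h5
    linear_combination (norm := abel) h3 - h4 + h5 - h1 + h2
  t_mem k k' := hC.lift_mem
    (OneObj.G_res (𝟙 a.X) (V := Hom.W f k ⊓ Hom.W g k') (fun _ h => h.1) (Hom.p_mem f k))
    (OneObj.G_res (𝟙 a.X) (V := Hom.W f k ⊓ Hom.W g k') (fun _ h => h.2) (Hom.p_mem g k'))
    (s.t_mem k k') fun x => s.rel_t x.1 _ _

lemma cm2_map₂Lift {f g : a ⟶ b} (s : C.cm1 f ⟶ C.cm1 g) : C.cm2 (hC.map₂Lift s) = s := by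
  apply Hom₂.ext
  funext x i i' k k'
  exact hC.c2_lift (s.rel_t x k k')

include hC in
lemma cm2_injective {f g : a ⟶ b} : Function.Injective (C.cm2 (f := f) (g := g)) := by
  intro s t h
  apply Hom₂.ext
  funext x i i' k k'
  refine hC.c2_inj (s.rel_t x k k') (t.rel_t x k k') ?_
  exact congrArg (fun w : Hom₂ (C.cmap f) (C.cmap g) => w.t x k k') h

/-! ### Preimages of 1-morphisms of cocycles. -/

section

variable (F : (C.cobj a).Hom (C.cobj b)) (q : ∀ (x : a.X) {i i'}, F.Fib x i i' → Γ.B)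
  (hF : ∀ (x : a.X) {i i'} (k : F.Fib x i i'), F.p x k = C.c1 (q x k))

include hF in
-- Between images of `C`, the 2-morphism `F.e` relates products of images, whereas `exists_c2` needs
-- images of products. Compositors at both ends repair this, exactly inverting the correction made
-- in `cme`.
lemma rel_homLift (x : a.X) {i i' j j'} (k : F.Fib x i i') (l : F.Fib x j j') :
    Γ'.rel (C.cc (b.g (F.φ x) (F.r k) (F.r l)) (q x k) + F.e x k l -
      C.cc (q x l) (a.g x (F.l k) (F.l l)))
      (C.c1 (q x l * a.g x (F.l k) (F.l l))) (C.c1 (b.g (F.φ x) (F.r k) (F.r l) * q x k)) := by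
  have h1 : Γ'.rel (F.e x k l) (F.p x l * C.c1 (a.g x (F.l k) (F.l l)))
    (C.c1 (b.g (F.φ x) (F.r k) (F.r l)) * F.p x k) := F.rel_e x k l
  rw [hF, hF] at h1
  have h2 := Γ'.rel_add (Γ'.rel_neg (C.rel_cc (q x l) (a.g x (F.l k) (F.l l))))
    (Γ'.rel_add h1 (C.rel_cc (b.g (F.φ x) (F.r k) (F.r l)) (q x k)))
  rwa [← sub_eq_add_neg] at h2

/-- The 2-morphisms `e` of a preimage of a 1-morphism. -/
abbrev eLift (x : a.X) {i i' j j'} (k : F.Fib x i i') (l : F.Fib x j j') : Γ.A :=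
  hC.lift (rel_homLift F q hF x k l)

/-- This is `cmap_coh` read backwards. The identities for compositors that show that `C` preserves
coherence express the image of the claim through `F.coh`, and injectivity of `c2` removes `C`. -/
lemma eLift_coh (x : a.X) {i i' j j' r r'} (k : F.Fib x i i') (l : F.Fib x j j')
    (m : F.Fib x r r') :
    hC.eLift F q hF x k m + Γ.post (q x m) (a.γ x (F.l k) (F.l l) (F.l m)) =
      Γ.pre (b.γ (F.φ x) (F.r k) (F.r l) (F.r m)) (q x k) +
      Γ.post (b.g (F.φ x) (F.r l) (F.r m)) (hC.eLift F q hF x k l) +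
      Γ.pre (hC.eLift F q hF x l m) (a.g x (F.l k) (F.l l)) := by
  have rkl := hC.rel_lift (rel_homLift F q hF x k l)
  have rkm := hC.rel_lift (rel_homLift F q hF x k m)
  have rlm := hC.rel_lift (rel_homLift F q hF x l m)
  have ekl := hC.c2_lift (rel_homLift F q hF x k l)
  have ekm := hC.c2_lift (rel_homLift F q hF x k m)
  have elm := hC.c2_lift (rel_homLift F q hF x l m)
  have h1 := C.cc_post (q x m) (a.rel_γ x (F.l k) (F.l l) (F.l m))
  have h2 := C.cc_assoc (q x m) (a.g x (F.l l) (F.l m)) (a.g x (F.l k) (F.l l))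
  have h3 := C.cc_pre (q x k) (b.rel_γ (F.φ x) (F.r k) (F.r l) (F.r m))
  have h4 := C.cc_assoc (b.g (F.φ x) (F.r l) (F.r m)) (b.g (F.φ x) (F.r k) (F.r l)) (q x k)
  have h5 := C.cc_post (b.g (F.φ x) (F.r l) (F.r m)) rkl
  have h6 := C.cc_assoc (b.g (F.φ x) (F.r l) (F.r m)) (q x l) (a.g x (F.l k) (F.l l))
  have h7 := C.cc_pre (a.g x (F.l k) (F.l l)) rlm
  have r1 := Γ.rel_post (q x m) (a.rel_γ x (F.l k) (F.l l) (F.l m))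
  have r2 := Γ.rel_pre (q x k) (b.rel_γ (F.φ x) (F.r k) (F.r l) (F.r m))
  have r3 := Γ.rel_post (b.g (F.φ x) (F.r l) (F.r m)) rkl
  have r4 := Γ.rel_pre (a.g x (F.l k) (F.l l)) rlm
  simp only [mul_assoc] at r1 r2 r3 r4
  have h8 := C.c2_add r1 rkm
  have h9 := C.c2_add r4 (Γ.rel_add r3 r2)
  have h10 := C.c2_add r3 r2
  have h0 : F.e x k m + Γ'.post (F.p x m) (C.c2 (a.g x (F.l l) (F.l m) * a.g x (F.l k) (F.l l))
        (a.γ x (F.l k) (F.l l) (F.l m)) + C.cc (a.g x (F.l l) (F.l m)) (a.g x (F.l k) (F.l l))) =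
      Γ'.pre (C.c2 (b.g (F.φ x) (F.r l) (F.r m) * b.g (F.φ x) (F.r k) (F.r l))
          (b.γ (F.φ x) (F.r k) (F.r l) (F.r m)) +
        C.cc (b.g (F.φ x) (F.r l) (F.r m)) (b.g (F.φ x) (F.r k) (F.r l))) (F.p x k) +
      Γ'.post (C.c1 (b.g (F.φ x) (F.r l) (F.r m))) (F.e x k l) +
      Γ'.pre (F.e x l m) (C.c1 (a.g x (F.l k) (F.l l))) := F.coh x k l m
  rw [hF, hF] at h0
  refine hC.c2_inj (Γ.rel_add r1 rkm) (Γ.rel_add r4 (Γ.rel_add r3 r2)) ?_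
  simp only [Γ'.pre_add, Γ'.post_add, mul_assoc] at *
  rw [ekm] at h8
  rw [ekl] at h5
  rw [elm] at h7
  simp only [Γ'.pre_add, Γ'.post_add, Γ'.pre_sub, Γ'.post_sub] at *
  linear_combination (norm := abel) h0 + h8 - h9 - h10 - h1 - h2 + h3 - h4 + h5 + h6 + h7

/-- The preimage of a 1-morphism of cocycles that lies in the image of `C` on local 1-morphisms. -/
def homLift (hq : ∀ {i i'} (k : F.K i i'),
    (fun x : a.X.op (F.W k) => q x.1 ⟨k, x.2⟩) ∈ Γ.G (a.X.op (F.W k))) : a.Hom b where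
  φ := F.φ
  K := F.K
  W := F.W
  W_l := F.W_l
  W_r := F.W_r
  cov := F.cov
  p x _ _ k := q x k
  e x _ _ _ _ k l := hC.eLift F q hF x k l
  rel_e x _ _ _ _ k l := hC.rel_lift (rel_homLift F q hF x k l)
  coh x _ _ _ _ _ _ k l m := hC.eLift_coh F q hF x k l m
  p_mem := hq
  e_mem {i i' j j'} k l := by
    have h1 := OneObj.G_res (𝟙 a.X) (V := F.W k ⊓ F.W l) (fun _ h => h.1) (hq k)
    have h2 := OneObj.G_res (𝟙 a.X) (V := F.W k ⊓ F.W l) (fun _ h => h.2) (hq l)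
    have h3 := OneObj.G_res (𝟙 a.X) (V := F.W k ⊓ F.W l)
      (U := a.U i ⊓ a.U j) (fun _ h => ⟨F.W_l k h.1, F.W_l l h.2⟩) (a.g_mem i j)
    have h4 := OneObj.G_res F.φ (V := F.W k ⊓ F.W l)
      (U := b.U i' ⊓ b.U j') (fun _ h => ⟨F.W_r k h.1, F.W_r l h.2⟩) (b.g_mem i' j')
    exact hC.lift_mem (OneObj.G_mul h2 h3) (OneObj.G_mul h4 h1)
      (OneObj.H_sub (OneObj.H_add (C.cc_mem h4 h1) (F.e_mem k l)) (C.cc_mem h2 h3)) _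

/-- The comparison 2-morphism. -/
def homLiftRef (hq : ∀ {i i'} (k : F.K i i'),
    (fun x : a.X.op (F.W k) => q x.1 ⟨k, x.2⟩) ∈ Γ.G (a.X.op (F.W k))) :
    Ref (C.cmap (hC.homLift F q hF hq)) F where
  base := rfl
  D := F.K
  V := F.W
  k d := d
  k' d := d
  V_k _ _ h := h
  V_k' _ _ h := h
  cov := F.cov
  t _ _ _ _ := 0
  rel_t x _ _ d := by
    have h0 : ∀ z, z = C.c1 (q x d) → Γ'.rel 0 (C.c1 (q x d)) z := by
      rintro _ rfl
      exact Γ'.rel_zero _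
    exact h0 _ (hF x d)
  comm x i i' j j' k l := by
    -- The compositors inserted before taking the preimage cancel those added by `cme`, so the
    -- 2-morphisms `e` of the two sides agree and 0 is compatible with them.
    have ekl : C.c2 (q x l * a.g x (F.l k) (F.l l)) (hC.eLift F q hF x k l) = _ :=
      hC.c2_lift (rel_homLift F q hF x k l)
    refine sub_eq_zero.2 ?_
    change F.e x k l + Γ'.pre 0 _ = Γ'.post _ 0 + (-C.cc (b.g (F.φ x) (F.r k) (F.r l)) (q x k) +
      C.c2 (q x l * a.g x (F.l k) (F.l l)) (hC.eLift F q hF x k l) +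
        C.cc (q x l) (a.g x (F.l k) (F.l l)))
    rw [ekl, Γ'.pre_zero, Γ'.post_zero]
    abel
  t_mem _ := OneObj.H_zero

end

include hC in
-- The components of `F` are only 2-isomorphic to images of `C`. Conjugating `F` by such
-- 2-isomorphisms makes them equal to images, and then the remaining data of `F` have unique
-- preimages. The refinement underlying `F` is kept.
lemma exists_map_iso (F : C.cobj a ⟶ C.cobj b) : ∃ f : a ⟶ b, Nonempty (C.cm1 f ≅ F) := by
  let F₀ : (C.cobj a).Hom (C.cobj b) := F
  -- One choice for each member `W k` of the refinement. The choices over different members need not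
  -- match, since `conj` absorbs their differences into `e`.
  choose q hq h hh hr using fun i i' (k : F₀.K i i') => hC.exists_c1 (F₀.p_mem k)
  let q' (x : a.X) {i i'} (k : F₀.Fib x i i') : Γ.B := q i i' k.1 ⟨x, k.2⟩
  let F₁ := F₀.conj (fun x _ _ k => C.c1 (q' x k)) (fun x i i' k => h i i' k.1 ⟨x, k.2⟩)
    (fun x _ _ k => hr _ _ k.1 ⟨x, k.2⟩) (fun k => C.c1_mem (hq _ _ k)) (fun k => hh _ _ k)
  let s : F ⟶ (F₁ : C.cobj a ⟶ C.cobj b) := (F₀.toConj (fun x _ _ k => C.c1 (q' x k))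
    (fun x i i' k => h i i' k.1 ⟨x, k.2⟩) (fun x _ _ k => hr _ _ k.1 ⟨x, k.2⟩)
    (fun k => C.c1_mem (hq _ _ k)) (fun k => hh _ _ k)).hom
  let f : a ⟶ b := hC.homLift F₁ q' (fun _ _ _ _ => rfl) (fun k => hq _ _ k)
  let s' : C.cm1 f ⟶ (F₁ : C.cobj a ⟶ C.cobj b) :=
    (hC.homLiftRef F₁ q' (fun _ _ _ _ => rfl) (fun k => hq _ _ k)).hom
  exact ⟨f, ⟨iso s' ≪≫ (iso s).symm⟩⟩

include hC in
/-- The induced functors on categories of 1-morphisms are equivalences. -/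
theorem mapFunctor_isEquivalence (a b : Coc Γ) : (C.plus.mapFunctor a b).IsEquivalence where
  faithful := ⟨fun h => hC.cm2_injective h⟩
  full := ⟨fun s => ⟨hC.map₂Lift s, hC.cm2_map₂Lift s⟩⟩
  essSurj := ⟨fun F => hC.exists_map_iso F⟩

/-! ### Preimages of cocycles, and essential surjectivity on objects. -/

section

variable (y : Coc Γ') (q : ∀ x : y.X, {i // x ∈ y.U i} → {i // x ∈ y.U i} → Γ.B)
  (hy : ∀ x i j, y.g x i j = C.c1 (q x i j))

include hy in
-- The compositor is removed from `y.γ` because `cobj` adds it back; what is left starts at the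
-- image of a product, as `exists_c2` demands.
lemma rel_objLift (x : y.X) (i j k : {i // x ∈ y.U i}) :
    Γ'.rel (y.γ x i j k - C.cc (q x j k) (q x i j)) (C.c1 (q x j k * q x i j))
      (C.c1 (q x i k)) := by
  have h1 := y.rel_γ x i j k
  simp only [hy] at h1
  have h2 := Γ'.rel_add (Γ'.rel_neg (C.rel_cc (q x j k) (q x i j))) h1
  rwa [← sub_eq_add_neg] at h2

/-- The preimage of a cocycle that lies in the image of `C` on local 1-morphisms. -/
def objLift (hq : ∀ i j, (fun x : y.X.op (y.U i ⊓ y.U j) => q x.1 ⟨i, x.2.1⟩ ⟨j, x.2.2⟩) ∈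
    Γ.G (y.X.op (y.U i ⊓ y.U j))) : Coc Γ where
  X := y.X
  I := y.I
  U := y.U
  cov := y.cov
  g := q
  γ x i j k := hC.lift (rel_objLift y q hy x i j k)
  rel_γ x i j k := hC.rel_lift (rel_objLift y q hy x i j k)
  coc x i j k l := by
    have rijk := hC.rel_lift (rel_objLift y q hy x i j k)
    have rjkl := hC.rel_lift (rel_objLift y q hy x j k l)
    have rikl := hC.rel_lift (rel_objLift y q hy x i k l)
    have rijl := hC.rel_lift (rel_objLift y q hy x i j l)
    have eijk := hC.c2_lift (rel_objLift y q hy x i j k)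
    have ejkl := hC.c2_lift (rel_objLift y q hy x j k l)
    have eikl := hC.c2_lift (rel_objLift y q hy x i k l)
    have eijl := hC.c2_lift (rel_objLift y q hy x i j l)
    have h0 := y.coc x i j k l
    have h1 := C.cc_post (q x k l) rijk
    have h2 := C.cc_pre (q x i j) rjkl
    have h3 := C.cc_assoc (q x k l) (q x j k) (q x i j)
    have r1 := Γ.rel_post (q x k l) rijk
    have r2 := Γ.rel_pre (q x i j) rjkl
    rw [mul_assoc] at r2
    have h4 := C.c2_add r1 rikl
    have h5 := C.c2_add r2 rijl
    -- After applying `C`, naturality and associativity of the compositor identify the claim with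
    -- the cocycle condition of `y`.
    refine hC.c2_inj (Γ.rel_add r1 rikl) (Γ.rel_add r2 rijl) ?_
    rw [eikl] at h4
    rw [eijl] at h5
    rw [eijk] at h1
    rw [ejkl] at h2
    simp only [hy, Γ'.pre_sub, Γ'.post_sub, mul_assoc] at *
    linear_combination (norm := abel) h0 + h4 - h5 - h1 + h2 - h3
  g_mem := hq
  γ_mem i j k := by
    have h1 := OneObj.G_res (𝟙 y.X) (V := y.U i ⊓ y.U j ⊓ y.U k) (U := y.U j ⊓ y.U k)
      (fun _ h => ⟨h.1.2, h.2⟩) (hq j k)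
    have h2 := OneObj.G_res (𝟙 y.X) (V := y.U i ⊓ y.U j ⊓ y.U k) (U := y.U i ⊓ y.U j)
      (fun _ h => ⟨h.1.1, h.1.2⟩) (hq i j)
    have h3 := OneObj.G_res (𝟙 y.X) (V := y.U i ⊓ y.U j ⊓ y.U k) (U := y.U i ⊓ y.U k)
      (fun _ h => ⟨h.1.1, h.2⟩) (hq i k)
    exact hC.lift_mem (OneObj.G_mul h1 h2) h3
      (OneObj.H_sub (y.γ_mem i j k) (C.cc_mem h1 h2)) _

/-- The equality is strict: the transitions are images of `C` on the nose by `hy`, and the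
compositor subtracted before taking the preimage is the one that `cobj` adds. -/
lemma cobj_objLift (hq) : C.cobj (hC.objLift y q hy hq) = y := by
  obtain ⟨X, I, U, cov, g, γ, rel_γ, coc, g_mem, γ_mem⟩ := y
  simp only [cobj, objLift, c2_lift, sub_add_cancel]
  congr 1
  funext x i j
  exact (hy x i j).symm

end

include hC in
/-- The induced map on cocycles is essentially surjective, over the identity of the base. -/
theorem exists_equivalence (y : Coc Γ') : ∃ (x : Coc Γ) (h : x.X = y.X)
    (e : Bicategory.Equivalence (C.plus.obj x) y), e.hom.φ = eqToHom h := by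
  -- The transition 1-morphisms are replaced separately on each double intersection, with no
  -- condition on triple ones; the modified `γ` compensates.
  choose q hq h hh hr using fun i j => hC.exists_c1 (y.g_mem i j)
  let T : Twist y :=
    { q := fun x i j => C.c1 (q i.1 j.1 ⟨x, i.2, j.2⟩)
      h := fun x i j => h i.1 j.1 ⟨x, i.2, j.2⟩
      rel_h := fun x i j => hr i.1 j.1 ⟨x, i.2, j.2⟩
      q_mem := fun i j => C.c1_mem (hq i j)
      h_mem := fun i j => hh i j }
  -- The image of the lifted cocycle equals `T.coc` only propositionally. With a variable `z` the
  -- equality can be eliminated, and then the equality of bases is `rfl` and `T.hom` lies over the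
  -- identity.
  have key : ∀ z : Coc Γ', z = T.coc → ∃ (h : z.X = y.X) (e : Bicategory.Equivalence z y),
      e.hom.φ = eqToHom h := by
    rintro z rfl
    exact ⟨rfl, T.equivalence, rfl⟩
  exact ⟨_, key _ (hC.cobj_objLift T.coc (fun x i j => q i.1 j.1 ⟨x, i.2, j.2⟩)
    (fun _ _ _ => rfl) hq)⟩

end IsEquiv

end OneObj.Mor

/-! ### Integral vectors, and freeness of the action on the Poincaré bundle. -/

open scoped Manifold

variable {n : ℕ}

lemma zr_injective : Function.Injective (zr (n := n)) := by
  intro m m' h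
  funext i
  exact Int.cast_injective (congrFun h i)

lemma exists_eq_add_zr {a b : Fin n → ℝ} (h : pj a = pj b) : ∃ m, b = a + zr m := by
  have h1 : ∀ i, ∃ k : ℤ, b i = a i + k := fun i => by
    have h2 : ((b i - a i : ℝ) : UnitAddCircle) = 0 := by
      rw [AddCircle.coe_sub, sub_eq_zero]
      exact (congrFun h i).symm
    obtain ⟨k, hk⟩ := (AddCircle.coe_eq_zero_iff _).1 h2
    refine ⟨k, ?_⟩
    rw [zsmul_eq_mul, mul_one] at hk
    linarith
  choose m hm using h1
  exact ⟨m, funext hm⟩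

/-- The embedding of ℤ in ℝ is topological, so continuity may be tested in ℝⁿ; a continuous map to
the discrete space ℤⁿ is locally constant. -/
lemma isLocallyConstant_of_zr {M : Type} [TopologicalSpace M] {m : M → Fin n → ℤ}
    (h : Continuous fun x => zr (m x)) : IsLocallyConstant m := by
  refine (IsLocallyConstant.iff_continuous m).2 (continuous_pi fun i => ?_)
  exact Int.isClosedEmbedding_coe_real.continuous_iff.2 ((continuous_apply i).comp h)

/-- Two representatives with the same second vector differ by the lattice vector `m' = 0`, and then
the phase correction `m' a` vanishes, so the phases agree. -/
lemma Poi.act_inj {s s' : UnitAddCircle} {p : Poi n} (h : p.act s = p.act s') : s = s' := by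
  induction p using Poi.ind with | _ a b t
  obtain ⟨m, m', h1, h2, h3⟩ := Quotient.exact h
  have h4 : zr m' = 0 := by simpa using h2.symm
  rw [h4, zero_dotProduct, AddCircle.coe_zero, add_zero] at h3
  exact (add_left_cancel h3).symm

/-- An automorphism 2-cell of `𝒯` that vanishes at a point vanishes. -/
lemma TT_eq_zero {z : TB n} {h : (TT n).A} (r : (TT n).rel h z z) (h0 : h.1 0 = 0) : h = 0 := by
  -- Every pair (c, d) lies under a point of the bundle. There the condition on a 2-automorphism
  -- compares the actions of α(c) and β(d) on one point, and the action is free. As c and d vary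
  -- independently, both functions are the same constant.
  have key : ∀ c d, h.1 c = h.2 d := fun c d => by
    obtain ⟨a, rfl⟩ := pj_surj c
    obtain ⟨b, rfl⟩ := pj_surj d
    exact Poi.act_inj (r.2.2 (Poi.mk a b 0))
  refine Prod.ext (funext fun c => ?_) (funext fun d => ?_)
  · exact (key c 0).trans ((key 0 0).symm.trans h0)
  · exact (key 0 d).symm.trans h0

/-! ### The 2-functor `C` on 2-morphisms. -/

lemma functorC_exists_c2 {h' : (TT n).A} {g g' : TDB n}
    (r : (TT n).rel h' ((functorC n).c1 g) ((functorC n).c1 g')) :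
    ∃ h, (TD n).rel h g g' ∧ (functorC n).c2 g h = h' := by
  -- A 2-morphism exists only between equal translations of the tori; evaluating these at 0 shows
  -- that `g` and `g'` differ by integral vectors, which serve as m and m̂.
  have e1 : (0 : Tor n) + pj g.a = 0 + pj g'.a := congrArg (fun f : Equiv.Perm (Tor n) => f 0) r.1
  have e2 : (0 : Tor n) + pj g.b = 0 + pj g'.b :=
    congrArg (fun f : Equiv.Perm (Tor n) => f 0) r.2.1
  rw [zero_add, zero_add] at e1 e2
  obtain ⟨m, hm⟩ := exists_eq_add_zr e1
  obtain ⟨m', hm'⟩ := exists_eq_add_zr e2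
  -- The value of t is forced: the first function of the image of (t, m, m̂) is -t - m̂ c, which is
  -- -t at c = 0.
  have r1 : (TD n).rel (-h'.1 0, m, m') g g' := ⟨hm, hm'⟩
  refine ⟨_, r1, ?_⟩
  -- The difference of `h'` and the image of the candidate is a 2-automorphism, and t was chosen so
  -- that its first function vanishes at 0; hence it is zero.
  have r2 := (TT n).rel_add r ((TT n).rel_neg ((functorC n).rel_c2 r1))
  refine neg_add_eq_zero.1 (TT_eq_zero r2 ?_)
  change -(- -h'.1 0 - zdot m' 0) + h'.1 0 = 0
  simp

/-- Source and target already determine m and m̂, and t is read off as -α(0). -/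
lemma functorC_c2_inj {h k : (TD n).A} {g g' : TDB n} (rh : (TD n).rel h g g')
    (rk : (TD n).rel k g g') (e : (functorC n).c2 g h = (functorC n).c2 g k) : h = k := by
  have e1 : zr h.2.1 = zr k.2.1 := add_left_cancel (rh.1.symm.trans rk.1)
  have e2 : zr h.2.2 = zr k.2.2 := add_left_cancel (rh.2.symm.trans rk.2)
  have e3 : -h.1 - zdot h.2.2 0 = -k.1 - zdot k.2.2 0 :=
    congrArg (fun z : (TT n).A => z.1 0) e
  rw [zdot_zero, zdot_zero, sub_zero, sub_zero, neg_inj] at e3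
  exact Prod.ext e3 (Prod.ext (zr_injective e1) (zr_injective e2))

/-- Smoothness of m and m̂ comes from the 1-morphisms, not from the image: they are differences of
continuous maps and integral, hence locally constant. Only t uses the smoothness of (α, β). -/
lemma functorC_mem_of_c2 {X : Mfd} {g g' : X → TDB n} {h : X → (TD n).A} (hg : g ∈ (TD n).G X)
    (hg' : g' ∈ (TD n).G X) (r : ∀ x, (TD n).rel (h x) (g x) (g' x))
    (hh : (fun x => (functorC n).c2 (g x) (h x)) ∈ (TT n).H X) : h ∈ (TD n).H X := by
  have ca : ∀ {k : X → TDB n}, k ∈ (TD n).G X → Continuous fun x => (k x).toAdd :=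
    fun hk => ContMDiff.continuous (f := fun x => (_ : TDB n).toAdd) hk
  have c1 := ca hg
  have c2 := ca hg'
  have m1 : IsLocallyConstant fun x => (h x).2.1 := by
    refine isLocallyConstant_of_zr ?_
    have : (fun x => zr (h x).2.1) = fun x => (g' x).a - (g x).a := by
      funext x
      rw [(r x).1, add_sub_cancel_left]
    rw [this]
    exact (continuous_fst.comp c2).sub (continuous_fst.comp c1)
  have m2 : IsLocallyConstant fun x => (h x).2.2 := by
    refine isLocallyConstant_of_zr ?_
    have : (fun x => zr (h x).2.2) = fun x => (g' x).b - (g x).b := by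
      funext x
      rw [(r x).2, add_sub_cancel_left]
    rw [this]
    exact (continuous_snd.comp c2).sub (continuous_snd.comp c1)
  refine ⟨?_, m1.prodMk m2⟩
  -- Restriction of α to the zero section x ↦ (x, 0), where the pairing with m̂ vanishes and -t
  -- remains.
  have h1 : SmU (𝓡 X.dim) fun x => -(h x).1 - zdot (h x).2.2 (pj 0) :=
    SmU.pull (φ := fun x : X => (x, (0 : Fin n → ℝ))) hh.1 (contMDiff_id.prodMk contMDiff_const)
  have h2 := h1.neg
  simpa using h2

/-! ### The 2-functor `C` on 1-morphisms. -/

lemma OneObj.Mor.rel_c1_inv {Γ Γ' : OneObj} (C : OneObj.Mor Γ Γ') {h : Γ'.A} {z : Γ'.B} {g : Γ.B}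
    (r : Γ'.rel h z (C.c1 g)) :
    Γ'.rel (-(Γ'.post z⁻¹ (C.cc g g⁻¹) + Γ'.pre (Γ'.post z⁻¹ h) (C.c1 g⁻¹))) z⁻¹ (C.c1 g⁻¹) := by
  -- Writing `C g⁻¹` as `z⁻¹ z C g⁻¹`, apply `h` in the middle to reach `z⁻¹ C g C g⁻¹`, then the
  -- compositor and unitality to reach `z⁻¹`. The required 2-morphism is the inverse of this
  -- composite.
  have r1 := Γ'.rel_pre (C.c1 g⁻¹) (Γ'.rel_post z⁻¹ r)
  have r2 := Γ'.rel_post z⁻¹ (C.rel_cc g g⁻¹)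
  rw [inv_mul_cancel, one_mul] at r1
  rw [mul_inv_cancel, C.c1_one, mul_one, ← mul_assoc] at r2
  exact Γ'.rel_neg (Γ'.rel_add r1 r2)

/-- Induction over the generated subgroup. The 2-morphism is needed because the automorphisms in the
image do not form a subgroup: `Aab` of the negated pair differs from the inverse of `Aab a b` by the
phase `a â`, in accordance with the compositor. -/
lemma functorC_exists_c1 {X : Mfd} {z : X → TB n} (hz : z ∈ TG n X) :
    ∃ g ∈ (TD n).G X, ∃ h ∈ (TT n).H X,
      ∀ x, (TT n).rel (h x) (z x) ((functorC n).c1 (g x)) := by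
  induction hz using Subgroup.closure_induction with
  | mem z hz =>
    obtain ⟨a, b, ha, hb, rfl⟩ := hz
    exact ⟨fun x => Multiplicative.ofAdd (a x, b x), ContMDiff.prodMk_space ha hb, 0,
      ((TT n).H X).zero_mem, fun x => (TT n).rel_zero _⟩
  | one =>
    refine ⟨1, ((TD n).G X).one_mem, 0, ((TT n).H X).zero_mem, fun x => ?_⟩
    have h0 : ∀ w, w = (1 : (TT n).B) → (TT n).rel 0 1 w := by
      rintro _ rfl
      exact (TT n).rel_zero _
    exact h0 _ (functorC n).c1_one
  | mul z w hz hw h1 h2 =>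
    obtain ⟨g, hg, h, hh, r⟩ := h1
    obtain ⟨g', hg', h', hh', r'⟩ := h2
    -- The composite `z w ⟹ C g w ⟹ C g C g' ⟹ C (g g')`, whose last arrow is the compositor.
    exact ⟨fun x => g x * g' x, OneObj.G_mul hg hg', _,
      OneObj.H_add ((functorC n).cc_mem hg hg') (OneObj.H_add
        ((TT n).H_post ((functorC n).c1_mem hg) hh') ((TT n).H_pre hh hw)),
      fun x => (TT n).rel_add ((TT n).rel_add ((TT n).rel_pre (w x) (r x))
        ((TT n).rel_post ((functorC n).c1 (g x)) (r' x))) ((functorC n).rel_cc (g x) (g' x))⟩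
  | inv z hz h1 =>
    obtain ⟨g, hg, h, hh, r⟩ := h1
    have hg' := OneObj.G_inv hg
    have hz' := OneObj.G_inv (Γ := TT n) hz
    exact ⟨fun x => (g x)⁻¹, hg', _, OneObj.H_neg (OneObj.H_add
      ((TT n).H_post hz' ((functorC n).cc_mem hg hg'))
      ((TT n).H_pre ((TT n).H_post hz' hh) ((functorC n).c1_mem hg'))),
      fun x => (functorC n).rel_c1_inv (r x)⟩

/-- The 2-functor `C` is bijective on 2-morphisms and essentially surjective on 1-morphisms. -/
theorem functorC_isEquiv (n : ℕ) : (functorC n).IsEquiv where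
  exists_c2 := functorC_exists_c2
  c2_inj := functorC_c2_inj
  mem_of_c2 := functorC_mem_of_c2
  exists_c1 := functorC_exists_c1

end TDual

end

theorem mainTheorem5 (n : ℕ) :
    (∀ y : TDual.TCor n, ∃ (x : TDual.BTDplus n) (h : x.X = y.X)
      (e : Bicategory.Equivalence ((TDual.Cplus n).obj x) y), e.hom.φ = eqToHom h) ∧
    ∀ x x' : TDual.BTDplus n, ((TDual.Cplus n).mapFunctor x x').IsEquivalence :=
  ⟨(TDual.functorC_isEquiv n).exists_equivalence,
    (TDual.functorC_isEquiv n).mapFunctor_isEquivalence⟩
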